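/- Let $n\ge 1$ and $d\ge 1$ be integers, $1<p<\infty$ and $\alpha>-1$. Let $\mathbb B_n$ be the open unit ball of $\mathbb C^n$, $\langle z,w\rangle=\sum_i z_i\overline{w_i}$, and $dv_\alpha(z)=c_\alpha(1-|z|^2)^\alpha\,dV(z)$ with $V$ Lebesgue measure and $c_\alpha$ such that $v_\alpha(\mathbb B_n)=1$. Let $L^p_\alpha$ be the space of measurable $f:\mathbb B_n\to\mathbb C^d$ with $\|f\|^p=\int_{\mathbb B_n}\|f(z)\|_p^p\,dv_\alpha(z)<\infty$, where $\|\cdot\|_p$ is the $\ell^p$ norm on $\mathbb C^d$, let $A^p_\alpha$ be its subspace of holomorphic functions, and let $\mathcal L(A^p_\alpha)$ be the algebra of bounded linear operators on $A^p_\alpha$ with the operator norm. For a measurable, essentially bounded function $\varphi$ on $\mathbb B_n$ with values in the complex $d\times d$ matrices, the Toeplitz operator $T_\varphi\in\mathcal L(A^p_\alpha)$ is $$T_\varphi f(z)=\int_{\mathbb B_n}\frac{\varphi(w)f(w)}{(1-\langle z,w\rangle)^{n+1+\alpha}}\,dv_\alpha(w).$$ Let $\mathcal T_{p,\alpha}$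 (the Toeplitz algebra) be the operator-norm closure of the set of finite sums of finite products of operators $T_\varphi$ with such symbols $\varphi$. Let $\rho(z,w)=|\phi_z(w)|$ be the pseudo-hyperbolic metric, where $\phi_z$ is the involutive automorphism of $\mathbb B_n$ interchanging $0$ and $z$; let $\mathcal A$ be the algebra of all bounded functions $\mathbb B_n\to\mathbb C$ that are uniformly continuous from $(\mathbb B_n,\rho)$ to $(\mathbb C,|\cdot|)$, and let $\mathcal A_d$ be the set of $d\times d$ matrix-valued functions with all entries in $\mathcal A$. Then for every essentially bounded measurable matrix symbol $\varphi$, and for every $\varphi\in\mathcal A_d$, the formula above defines a unique bounded operator $T_\varphi$ on $A^p_\alpha$, and $\mathcal T_{p,\alpha}$ equals the norm-closed subalgebra of $\mathcal L(A^p_\alpha)$ generated by $\{T_a : a\in\mathcal A_d\}$. -/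

import Mathlib

open MeasureTheory
open scoped ENNReal

noncomputable section

namespace BergmanToeplitz

/-- Complex Euclidean space `ℂⁿ`; its unit ball is `Metric.ball 0 1`. -/
abbrev Cn (n : ℕ) : Type := EuclideanSpace ℂ (Fin n)

/-- `ℂᵈ` with the `ℓᵖ` norm. -/
abbrev Cd (d : ℕ) (p : ℝ≥0∞) : Type := PiLp p (fun _ : Fin d => ℂ)

/-- The measure `(1 - |z|²)^α dV(z)` on the unit ball, extended by zero to `ℂⁿ`. -/
def weightedVolume (n : ℕ) (α : ℝ) : Measure (Cn n) :=
  (volume.restrict (Metric.ball (0 : Cn n) 1)).withDensity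
    (fun z => ENNReal.ofReal ((1 - ‖z‖ ^ 2) ^ α))

/-- The measure `dv_α = c_α (1 - |z|²)^α dV`, where `c_α` makes the total mass one. -/
def vMeasure (n : ℕ) (α : ℝ) : Measure (Cn n) :=
  (weightedVolume n α Set.univ)⁻¹ • weightedVolume n α

/-- `L^p_α(𝔹ₙ; ℂᵈ)`, normed by `(∫ ‖f z‖_p ^ p dv_α) ^ (1 / p)`. -/
abbrev LpAlpha (n d : ℕ) (p : ℝ≥0∞) [Fact (1 ≤ p)] (α : ℝ) : Type :=
  Lp (Cd d p) p (vMeasure n α)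

/-- The weighted Bergman space `A^p_α(𝔹ₙ; ℂᵈ)`: the elements of `L^p_α` that are represented by
a function holomorphic on the ball. -/
def bergmanSpace (n d : ℕ) (p : ℝ≥0∞) [Fact (1 ≤ p)] (α : ℝ) :
    Submodule ℂ (LpAlpha n d p α) where
  carrier := {f | ∃ g : Cn n → Cd d p,
    DifferentiableOn ℂ g (Metric.ball 0 1) ∧ f =ᵐ[vMeasure n α] g}
  zero_mem' := ⟨0, differentiableOn_const 0, Lp.coeFn_zero _ _ _⟩
  add_mem' := by
    rintro f₁ f₂ ⟨g₁, hg₁, h₁⟩ ⟨g₂, hg₂, h₂⟩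
    exact ⟨g₁ + g₂, hg₁.add hg₂, (Lp.coeFn_add f₁ f₂).trans (h₁.add h₂)⟩
  smul_mem' := by
    rintro c f ⟨g, hg, h⟩
    exact ⟨c • g, hg.const_smul c, (Lp.coeFn_smul c f).trans (h.const_smul c)⟩

instance (n d : ℕ) (p : ℝ≥0∞) [Fact (1 ≤ p)] (α : ℝ) :
    NormedAddCommGroup (bergmanSpace n d p α) :=
  Submodule.normedAddCommGroup _

instance (n d : ℕ) (p : ℝ≥0∞) [Fact (1 ≤ p)] (α : ℝ) :
    NormedSpace ℂ (bergmanSpace n d p α) :=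
  Submodule.normedSpace _

/-- The bounded linear operators on `A^p_α(𝔹ₙ; ℂᵈ)`, with composition and the operator norm. -/
abbrev BergmanOp (n d : ℕ) (p : ℝ≥0∞) [Fact (1 ≤ p)] (α : ℝ) : Type :=
  bergmanSpace n d p α →L[ℂ] bergmanSpace n d p α

instance (n d : ℕ) (p : ℝ≥0∞) [Fact (1 ≤ p)] (α : ℝ) : NormedRing (BergmanOp n d p α) :=
  ContinuousLinearMap.toNormedRing

instance (n d : ℕ) (p : ℝ≥0∞) [Fact (1 ≤ p)] (α : ℝ) : NormedAlgebra ℂ (BergmanOp n d p α) :=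
  ContinuousLinearMap.toNormedAlgebra

/-- The kernel `(1 - ⟨z, w⟩)^{-(n+1+α)}`, with `⟨z, w⟩ = ∑ zᵢ conj(wᵢ)` and the principal branch of
the power (for `z`, `w` in the ball the base has positive real part). -/
def bergmanKernel (n : ℕ) (α : ℝ) (z w : Cn n) : ℂ :=
  1 / (1 - inner ℂ w z) ^ (((n : ℝ) + 1 + α : ℝ) : ℂ)

/-- The Bergman projection `P_α f (z) = ∫ f(w) (1 - ⟨z, w⟩)^{-(n+1+α)} dv_α(w)`. -/
def bergmanProj (n d : ℕ) (p : ℝ≥0∞) [Fact (1 ≤ p)] (α : ℝ) (f : Cn n → Cd d p) (z : Cn n) :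
    Cd d p :=
  ∫ w, bergmanKernel n α z w • f w ∂(vMeasure n α)

/-- Pointwise multiplication of a `ℂᵈ`-valued function by a matrix-valued function. -/
def matMul {n d : ℕ} {p : ℝ≥0∞} (φ : Cn n → Matrix (Fin d) (Fin d) ℂ) (f : Cn n → Cd d p)
    (w : Cn n) : Cd d p :=
  WithLp.toLp p ((φ w).mulVec (WithLp.ofLp (f w)))

/-- The bounded operator `T` on `A^p_α` is the Toeplitz operator `T_φ = P_α M_φ`. -/
def IsToeplitz {n d : ℕ} {p : ℝ≥0∞} [Fact (1 ≤ p)] {α : ℝ}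
    (φ : Cn n → Matrix (Fin d) (Fin d) ℂ) (T : BergmanOp n d p α) : Prop :=
  ∀ f : bergmanSpace n d p α,
    ((T f : LpAlpha n d p α) : Cn n → Cd d p) =ᵐ[vMeasure n α]
      bergmanProj n d p α (matMul φ ((f : LpAlpha n d p α) : Cn n → Cd d p))

/-- Essentially bounded measurable matrix-valued symbols. -/
def IsBoundedSymbol (n d : ℕ) (α : ℝ) (φ : Cn n → Matrix (Fin d) (Fin d) ℂ) : Prop :=
  ∀ i j, MemLp (fun z => φ z i j) ∞ (vMeasure n α)

/-- The closure of the set of finite sums of finite products of elements of `s`. -/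
def closureSumsOfProducts {B : Type*} [NormedRing B] (s : Set B) : Set B :=
  closure (AddSubmonoid.closure (Subsemigroup.closure s : Set B) : Set B)

/-- The closed complex algebra generated by `s` (no unit is adjoined). -/
def closedAlgebraGenerated {B : Type*} [NormedRing B] [NormedAlgebra ℂ B] (s : Set B) :
    NonUnitalSubalgebra ℂ B :=
  (NonUnitalAlgebra.adjoin ℂ s).topologicalClosure

/-- The Toeplitz algebra: the operator-norm closure of the set of finite sums of finite products
of Toeplitz operators with essentially bounded matrix symbols. -/
def toeplitzAlgebra (n d : ℕ) (p : ℝ≥0∞) [Fact (1 ≤ p)] (α : ℝ) : Set (BergmanOp n d p α) :=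
  closureSumsOfProducts {T : BergmanOp n d p α | ∃ φ, IsBoundedSymbol n d α φ ∧ IsToeplitz φ T}

/-- The involutive automorphism of the ball that interchanges `z` and `0`:
`φ_z(w) = (z - P_z w - √(1 - |z|²) Q_z w) / (1 - ⟨w, z⟩)`, with `P_z` the orthogonal projection
onto the span of `z` and `Q_z = 1 - P_z` (so `φ_0(w) = -w`). -/
def ballAut {n : ℕ} (z w : Cn n) : Cn n :=
  let Pzw : Cn n := (ℂ ∙ z).starProjection w
  (1 - inner ℂ z w)⁻¹ • (z - Pzw - ((√(1 - ‖z‖ ^ 2) : ℝ) : ℂ) • (w - Pzw))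

/-- The pseudo-hyperbolic metric on the ball. -/
def pseudoHyp {n : ℕ} (z w : Cn n) : ℝ := ‖ballAut z w‖

/-- The algebra `𝒜` of bounded functions on the ball that are uniformly continuous for the
pseudo-hyperbolic metric (values outside the ball are irrelevant). -/
def IsBUC {n : ℕ} (a : Cn n → ℂ) : Prop :=
  (∃ C : ℝ, ∀ z ∈ Metric.ball (0 : Cn n) 1, ‖a z‖ ≤ C) ∧
  ∀ ε : ℝ, 0 < ε → ∃ δ : ℝ, 0 < δ ∧ ∀ z ∈ Metric.ball (0 : Cn n) 1, ∀ w ∈ Metric.ball (0 : Cn n) 1,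
    pseudoHyp z w < δ → ‖a z - a w‖ < ε

/-- Matrix-valued symbols all of whose entries belong to `𝒜`. -/
def IsBUCSymbol {n d : ℕ} (a : Cn n → Matrix (Fin d) (Fin d) ℂ) : Prop :=
  ∀ i j, IsBUC (fun z => a z i j)

/-- The operator-norm closed algebra generated by the Toeplitz operators `T_a` whose symbols have
all entries in `𝒜`. -/
def bucToeplitzAlgebra (n d : ℕ) (p : ℝ≥0∞) [Fact (1 ≤ p)] (α : ℝ) :
    NonUnitalSubalgebra ℂ (BergmanOp n d p α) :=
  closedAlgebraGenerated {T : BergmanOp n d p α | ∃ a, IsBUCSymbol a ∧ IsToeplitz a T}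

end BergmanToeplitz

end

/-!
# Toeplitz operators with uniformly continuous symbols generate the Toeplitz algebra

The point is that every `T_φ` with a bounded symbol is a norm limit of operators `T_a` with `a ∈
𝒜_d`; no products are needed. The approximating symbol is the average `a = smoothing α r φ` of `φ`
at a small scale `r` of the Bergman metric. It lies in `𝒜` for every small `r` (`isBUC_smoothing`).

To compare `T_φ f` and `T_a f` for a holomorphic `f`, move the averaging from the symbol to the
integrand `K(u, ·) f`, where `K` is the Bergman kernel (`enorm_integral_sub_smoothing_le`). Over a
ball of small Bergman radius both factors oscillate little: the kernel in the multiplicative sense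
and uniformly in `u` (`exists_norm_bergmanKernel_sub_le`), and `f` by the mean value property and
the Schwarz lemma, relative to the average of `|f|` over a larger ball of fixed radius
(`enorm_sub_le_gaugeAverage`). Since `v_α` is doubling on such balls, the averages may be removed
again after integration. This bounds `|T_φ f - T_a f|` pointwise by `ε` times the positive Bergman
operator applied to `|f|` (`exists_isBUC_enorm_sub_le`), and that operator is bounded on `L^p_α` for
`1 < p < ∞` by the Schur test and the Forelli–Rudin estimate (`exists_forelliRudin`,
`exists_lintegral_rpow_bergmanKernel_le`). The same bound, with differentiation under the integral
sign, gives the existence of `T_φ` (`exists_isToeplitz`); uniqueness is immediate, as the formula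
determines `T_φ f` almost everywhere.

Balls of the Bergman metric are replaced by the balls of an explicit norm, `bergmanGauge z`, on the
tangent space at `z`. This makes their translates, dilates and Lebesgue volumes trivial to handle,
at the price of the comparison `bergmanGauge_le_pseudoHyp` with the pseudo-hyperbolic metric.
-/

open MeasureTheory
open scoped ENNReal

noncomputable section

namespace BergmanToeplitz

variable {n : ℕ}

/-! ### The gauge of the Bergman metric -/

/-- The defining function `1 - |z|²` of the unit ball. -/
def defect (z : Cn n) : ℝ := 1 - ‖z‖ ^ 2

/-- The norm `|x| / (1 - |z|²)^{1/2} + |⟨x, z⟩| / (1 - |z|²)` on tangent vectors at the point `z` of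
the ball. Its small balls, translated to `z`, are comparable with small pseudo-hyperbolic balls
around `z`. -/
def bergmanGauge (z x : Cn n) : ℝ := ‖x‖ / √(defect z) + ‖inner ℂ z x‖ / defect z

lemma defect_pos {z : Cn n} (hz : ‖z‖ < 1) : 0 < defect z := by
  unfold defect; nlinarith [norm_nonneg z]

lemma defect_pos_iff {z : Cn n} : 0 < defect z ↔ ‖z‖ < 1 := by
  refine ⟨fun h => ?_, defect_pos⟩
  unfold defect at h
  nlinarith [norm_nonneg z]

lemma defect_le_one (z : Cn n) : defect z ≤ 1 := by
  unfold defect; nlinarith [norm_nonneg z]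

lemma continuous_defect : Continuous (defect : Cn n → ℝ) := by
  unfold defect; fun_prop

lemma bergmanGauge_nonneg {z : Cn n} (hz : ‖z‖ < 1) (x : Cn n) : 0 ≤ bergmanGauge z x := by
  have := defect_pos hz
  unfold bergmanGauge; positivity

lemma bergmanGauge_zero (z : Cn n) : bergmanGauge z 0 = 0 := by
  simp [bergmanGauge]

lemma bergmanGauge_smul (z x : Cn n) (c : ℂ) :
    bergmanGauge z (c • x) = ‖c‖ * bergmanGauge z x := by
  simp only [bergmanGauge, norm_smul, inner_smul_right, norm_mul]; ring

lemma bergmanGauge_neg (z x : Cn n) : bergmanGauge z (-x) = bergmanGauge z x := by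
  simp [bergmanGauge]

lemma bergmanGauge_sub_comm (z x y : Cn n) : bergmanGauge z (x - y) = bergmanGauge z (y - x) := by
  rw [← bergmanGauge_neg, neg_sub]

lemma bergmanGauge_add_le {z : Cn n} (hz : ‖z‖ < 1) (x y : Cn n) :
    bergmanGauge z (x + y) ≤ bergmanGauge z x + bergmanGauge z y := by
  have hd := defect_pos hz
  have h1 : ‖x + y‖ / √(defect z) ≤ ‖x‖ / √(defect z) + ‖y‖ / √(defect z) := by
    rw [← add_div]; gcongr; exact norm_add_le _ _
  have h2 : ‖inner ℂ z (x + y)‖ / defect z ≤ ‖inner ℂ z x‖ / defect z + ‖inner ℂ z y‖ / defect z := by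
    rw [← add_div, inner_add_right]; gcongr; exact norm_add_le _ _
  unfold bergmanGauge; linarith

lemma norm_le_bergmanGauge {z : Cn n} (hz : ‖z‖ < 1) (x : Cn n) :
    ‖x‖ ≤ √(defect z) * bergmanGauge z x := by
  have hd := defect_pos hz
  have hs := Real.sqrt_pos.2 hd
  have h : ‖x‖ / √(defect z) ≤ bergmanGauge z x := by
    unfold bergmanGauge
    exact le_add_of_nonneg_right (by positivity)
  rw [div_le_iff₀ hs] at h; linarith

lemma norm_inner_le_bergmanGauge {z : Cn n} (hz : ‖z‖ < 1) (x : Cn n) :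
    ‖inner ℂ z x‖ ≤ defect z * bergmanGauge z x := by
  have hd := defect_pos hz
  have h : ‖inner ℂ z x‖ / defect z ≤ bergmanGauge z x := by
    unfold bergmanGauge
    exact le_add_of_nonneg_left (by positivity)
  rw [div_le_iff₀ hd] at h; linarith

lemma measurable_bergmanGauge :
    Measurable (fun q : Cn n × Cn n => bergmanGauge q.1 q.2) := by
  unfold bergmanGauge
  have : Continuous (defect : Cn n → ℝ) := continuous_defect
  have h1 : Measurable (fun q : Cn n × Cn n => defect q.1) := (this.comp continuous_fst).measurable
  have h2 : Measurable (fun q : Cn n × Cn n => inner ℂ q.1 q.2) :=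
    (continuous_fst.inner continuous_snd).measurable
  exact (measurable_snd.norm.div h1.sqrt).add (h2.norm.div h1)

lemma continuous_bergmanGauge (z : Cn n) : Continuous (bergmanGauge z) := by
  unfold bergmanGauge; fun_prop

lemma defect_add (w x : Cn n) :
    defect (w + x) = defect w - 2 * (inner ℂ w x).re - ‖x‖ ^ 2 := by
  unfold defect
  have := @norm_add_sq ℂ _ _ _ _ w x
  simp only [RCLike.re_eq_complex_re] at this
  rw [this]; ring

lemma norm_sq_le_bergmanGauge {z : Cn n} (hz : ‖z‖ < 1) (x : Cn n) :
    ‖x‖ ^ 2 ≤ defect z * bergmanGauge z x ^ 2 := by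
  have h := norm_le_bergmanGauge hz x
  calc ‖x‖ ^ 2 ≤ (√(defect z) * bergmanGauge z x) ^ 2 := by gcongr
    _ = _ := by rw [mul_pow, Real.sq_sqrt (defect_pos hz).le]

/-- On a gauge ball of radius `1 / 8` the quantity `1 - |z|²` is constant up to a factor two. -/
lemma defect_add_bounds {w x : Cn n} (hw : ‖w‖ < 1) (hx : bergmanGauge w x ≤ 1 / 8) :
    defect w / 2 ≤ defect (w + x) ∧ defect (w + x) ≤ 2 * defect w := by
  have hd := defect_pos hw
  have h0 := bergmanGauge_nonneg hw x
  have h1 := norm_sq_le_bergmanGauge hw x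
  have h2 := norm_inner_le_bergmanGauge hw x
  have h3 := abs_le.1 (Complex.abs_re_le_norm (inner ℂ w x))
  have h4 : defect w * bergmanGauge w x ^ 2 ≤ defect w * (1 / 8) ^ 2 := by gcongr
  have h5 : defect w * bergmanGauge w x ≤ defect w * (1 / 8) := by gcongr
  rw [defect_add]
  constructor <;> nlinarith [sq_nonneg ‖x‖]

lemma norm_add_lt_one {w x : Cn n} (hw : ‖w‖ < 1) (hx : bergmanGauge w x ≤ 1 / 8) :
    ‖w + x‖ < 1 :=
  defect_pos_iff.1 (by linarith [(defect_add_bounds hw hx).1, defect_pos hw])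

/-- The gauges at two nearby points are comparable. -/
lemma bergmanGauge_add_le_two_mul {w x : Cn n} (hw : ‖w‖ < 1) (hx : bergmanGauge w x ≤ 1 / 8)
    (y : Cn n) : bergmanGauge (w + x) y ≤ 2 * bergmanGauge w y := by
  have hd := defect_pos hw
  have hs := Real.sqrt_pos.2 hd
  obtain ⟨hl, -⟩ := defect_add_bounds hw hx
  have hd' : 0 < defect (w + x) := by linarith
  have hx1 := norm_le_bergmanGauge hw x
  have key1 : ‖y‖ / √(defect (w + x)) ≤ (3 / 2) * (‖y‖ / √(defect w)) := by
    have : √(defect w) ≤ (3 / 2) * √(defect (w + x)) := by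
      rw [show (3 / 2 : ℝ) = √((3 / 2) ^ 2) by rw [Real.sqrt_sq (by norm_num)],
        ← Real.sqrt_mul (by norm_num)]
      apply Real.sqrt_le_sqrt; linarith
    rw [div_le_iff₀ (Real.sqrt_pos.2 hd')]
    calc ‖y‖ = (‖y‖ / √(defect w)) * √(defect w) := by field_simp
      _ ≤ (‖y‖ / √(defect w)) * ((3 / 2) * √(defect (w + x))) := by gcongr
      _ = _ := by ring
  have key2 : ‖inner ℂ (w + x) y‖ / defect (w + x) ≤
      2 * (‖inner ℂ w y‖ / defect w) + (1 / 4) * (‖y‖ / √(defect w)) := by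
    have h1 : ‖inner ℂ (w + x) y‖ ≤ ‖inner ℂ w y‖ + ‖x‖ * ‖y‖ := by
      rw [inner_add_left]
      exact (norm_add_le _ _).trans (by gcongr; exact norm_inner_le_norm _ _)
    have h2 : ‖x‖ * ‖y‖ ≤ defect w * (1 / 8 * (‖y‖ / √(defect w))) := by
      calc ‖x‖ * ‖y‖ ≤ (√(defect w) * (1 / 8)) * ‖y‖ := by
            gcongr; exact hx1.trans (by gcongr)
        _ = (√(defect w) * √(defect w)) * (1 / 8 * (‖y‖ / √(defect w))) := by field_simp
        _ = _ := by rw [Real.mul_self_sqrt hd.le]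
    have h3 : ‖inner ℂ w y‖ = defect w * (‖inner ℂ w y‖ / defect w) := by field_simp
    rw [div_le_iff₀ hd']
    have h4 : 0 ≤ ‖inner ℂ w y‖ / defect w + 1 / 8 * (‖y‖ / √(defect w)) := by positivity
    calc ‖inner ℂ (w + x) y‖ ≤
          defect w * (‖inner ℂ w y‖ / defect w + 1 / 8 * (‖y‖ / √(defect w))) := by
            rw [mul_add, ← h3]; linarith
      _ ≤ (2 * defect (w + x)) * (‖inner ℂ w y‖ / defect w + 1 / 8 * (‖y‖ / √(defect w))) := by
            gcongr; linarith
      _ = _ := by ring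
  unfold bergmanGauge
  have : 0 ≤ ‖y‖ / √(defect w) := by positivity
  linarith

/-- Version of `bergmanGauge_add_le_two_mul` with the roles of the two points exchanged. -/
lemma bergmanGauge_le_two_mul_add {w x : Cn n} (hw : ‖w‖ < 1) (hx : bergmanGauge w x ≤ 1 / 16)
    (y : Cn n) : bergmanGauge w y ≤ 2 * bergmanGauge (w + x) y := by
  have h1 := norm_add_lt_one hw (hx.trans (by norm_num))
  have h2 := bergmanGauge_add_le_two_mul hw (hx.trans (by norm_num)) (-x)
  rw [bergmanGauge_neg w] at h2
  have h3 := bergmanGauge_add_le_two_mul h1 (h2.trans (by linarith)) y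
  simpa using h3

lemma one_sub_re_inner_pos {w u : Cn n} (hw : ‖w‖ < 1) (hu : ‖u‖ < 1) :
    0 < (1 - inner ℂ w u).re := by
  have h1 := (Complex.re_le_norm (inner ℂ w u)).trans (norm_inner_le_norm w u)
  have h2 : ‖w‖ * ‖u‖ < 1 := by nlinarith [norm_nonneg w, norm_nonneg u]
  simp only [Complex.sub_re, Complex.one_re]; linarith

lemma one_sub_inner_ne_zero {w u : Cn n} (hw : ‖w‖ < 1) (hu : ‖u‖ < 1) :
    1 - inner ℂ w u ≠ 0 := fun h => by
  have := one_sub_re_inner_pos hw hu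
  simp [h] at this

lemma one_sub_norm_le {w : Cn n} (u : Cn n) (hw : ‖w‖ ≤ 1) : 1 - ‖u‖ ≤ ‖1 - inner ℂ w u‖ := by
  have h1 := (Complex.re_le_norm (inner ℂ w u)).trans (norm_inner_le_norm w u)
  have h2 := Complex.re_le_norm (1 - inner ℂ w u)
  simp only [Complex.sub_re, Complex.one_re] at h2
  nlinarith [norm_nonneg u]

lemma defect_le_two_mul_norm {w u : Cn n} (hw : ‖w‖ < 1) (hu : ‖u‖ < 1) :
    defect w ≤ 2 * ‖1 - inner ℂ w u‖ := by
  have h1 := (Complex.re_le_norm (inner ℂ w u)).trans (norm_inner_le_norm w u)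
  have h2 := Complex.re_le_norm (1 - inner ℂ w u)
  simp only [Complex.sub_re, Complex.one_re] at h2
  unfold defect
  nlinarith [norm_nonneg u, norm_nonneg w]

/-- The relative change of `1 - ⟨u, w⟩`, when `w` is moved by `x`, is controlled by the gauge of `x`
at `w`, uniformly in `u`. -/
lemma norm_inner_le_gauge_mul {w u : Cn n} (hw : ‖w‖ < 1) (hu : ‖u‖ < 1) (x : Cn n) :
    ‖inner ℂ x u‖ ≤ 4 * bergmanGauge w x * ‖1 - inner ℂ w u‖ := by
  have hd := defect_pos hw
  have hN := bergmanGauge_nonneg hw x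
  set t := ‖1 - inner ℂ w u‖ with ht
  have ht0 : 0 ≤ t := norm_nonneg _
  have hdt : defect w ≤ 2 * t := defect_le_two_mul_norm hw hu
  -- `|u - w|² = |u|² + |w|² - 2 Re⟨u, w⟩ ≤ 2 Re(1 - ⟨u, w⟩)`.
  have h1 : ‖u - w‖ ^ 2 ≤ 2 * t := by
    have h := @norm_sub_sq ℂ _ _ _ _ u w
    simp only [RCLike.re_eq_complex_re] at h
    have h2 := Complex.re_le_norm (1 - inner ℂ w u)
    simp only [Complex.sub_re, Complex.one_re] at h2
    have h3 : (inner ℂ u w).re = (inner ℂ w u).re := by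
      rw [← inner_conj_symm, Complex.conj_re]
    rw [h, h3]
    nlinarith [norm_nonneg u, norm_nonneg w]
  have h2 : ‖u - w‖ * ‖x‖ ≤ 2 * t * bergmanGauge w x := by
    have h3 : (‖u - w‖ * ‖x‖) ^ 2 ≤ (2 * t * bergmanGauge w x) ^ 2 := by
      have := norm_sq_le_bergmanGauge hw x
      calc (‖u - w‖ * ‖x‖) ^ 2 = ‖u - w‖ ^ 2 * ‖x‖ ^ 2 := by ring
        _ ≤ (2 * t) * ((2 * t) * bergmanGauge w x ^ 2) := by
          gcongr
          exact this.trans (by gcongr)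
        _ = _ := by ring
    exact (sq_le_sq₀ (by positivity) (by positivity)).1 h3
  have h4 : ‖inner ℂ x w‖ ≤ 2 * t * bergmanGauge w x := by
    rw [← inner_conj_symm, RCLike.norm_conj]
    exact (norm_inner_le_bergmanGauge hw x).trans (by gcongr)
  calc ‖inner ℂ x u‖ = ‖inner ℂ x (u - w) + inner ℂ x w‖ := by rw [← inner_add_right, sub_add_cancel]
    _ ≤ ‖inner ℂ x (u - w)‖ + ‖inner ℂ x w‖ := norm_add_le _ _
    _ ≤ ‖u - w‖ * ‖x‖ + ‖inner ℂ x w‖ := by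
      gcongr; rw [mul_comm]; exact norm_inner_le_norm _ _
    _ ≤ _ := by linarith

/-- Clearing the denominator of `φ_z(w)` leaves the image of `z - w` under the map that is the
identity on `ℂ z` and scales its orthogonal complement by `√(1 - |z|²)`. -/
lemma one_sub_inner_smul_ballAut {z w : Cn n} (hz : ‖z‖ < 1) (hw : ‖w‖ < 1) :
    (1 - inner ℂ z w) • ballAut z w =
      (ℂ ∙ z).starProjection (z - w) +
        ((√(defect z) : ℝ) : ℂ) • ((z - w) - (ℂ ∙ z).starProjection (z - w)) := by
  have hz' : (ℂ ∙ z).starProjection z = z :=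
    Submodule.starProjection_eq_self_iff.2 (Submodule.mem_span_singleton_self z)
  unfold ballAut
  simp only
  rw [smul_smul, mul_inv_cancel₀ (one_sub_inner_ne_zero hz hw), one_smul, map_sub, hz', defect]
  module

/-- Points at small pseudo-hyperbolic distance differ by a vector of small gauge. -/
lemma bergmanGauge_le_pseudoHyp {z w : Cn n} (hz : ‖z‖ < 1) (hw : ‖w‖ < 1)
    (h : pseudoHyp z w ≤ 1 / 2) : bergmanGauge z (z - w) ≤ 4 * pseudoHyp z w := by
  have hd := defect_pos hz
  have hs := Real.sqrt_pos.2 hd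
  have hid := one_sub_inner_smul_ballAut hz hw
  set x := z - w with hx
  set P := (ℂ ∙ z).starProjection x with hP
  have hinner : inner ℂ z P = inner ℂ z x := by
    rw [hP, ← Submodule.inner_starProjection_left_eq_right,
      Submodule.starProjection_eq_self_iff.2 (Submodule.mem_span_singleton_self z)]
  have h1z : 1 - inner ℂ z w = (defect z : ℂ) + inner ℂ z x := by
    have : (inner ℂ z z : ℂ) = (‖z‖ : ℂ) ^ 2 := inner_self_eq_norm_sq_to_K z
    rw [hx, inner_sub_right, this, defect]; push_cast; ring
  rw [h1z] at hid
  have hρ0 : 0 ≤ pseudoHyp z w := norm_nonneg _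
  have hz1 : ‖(defect z : ℂ) + inner ℂ z x‖ ≤ defect z + ‖inner ℂ z x‖ := by
    refine (norm_add_le _ _).trans (le_of_eq ?_)
    rw [Complex.norm_real, Real.norm_of_nonneg hd.le]
  -- Taking the inner product with `z` kills the component orthogonal to `z`.
  have hA : ‖inner ℂ z x‖ ≤ 2 * pseudoHyp z w * defect z := by
    have h1 : inner ℂ z x = ((defect z : ℂ) + inner ℂ z x) * inner ℂ z (ballAut z w) := by
      rw [← inner_smul_right, hid, inner_add_right, inner_smul_right, inner_sub_right z x P, hinner]
      ring
    have h2 : ‖inner ℂ z x‖ ≤ (defect z + ‖inner ℂ z x‖) * pseudoHyp z w := by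
      calc ‖inner ℂ z x‖ = ‖(defect z : ℂ) + inner ℂ z x‖ * ‖inner ℂ z (ballAut z w)‖ := by
            rw [← norm_mul, ← h1]
        _ ≤ (defect z + ‖inner ℂ z x‖) * (‖z‖ * pseudoHyp z w) := by
            gcongr; exact norm_inner_le_norm _ _
        _ ≤ (defect z + ‖inner ℂ z x‖) * (1 * pseudoHyp z w) := by gcongr
        _ = _ := by ring
    nlinarith [norm_nonneg (inner ℂ z x)]
  have hB : √(defect z) * ‖x‖ ≤ 2 * defect z * pseudoHyp z w := by
    have horth : ‖P + ((√(defect z) : ℝ) : ℂ) • (x - P)‖ ^ 2 =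
        ‖P‖ ^ 2 + defect z * ‖x - P‖ ^ 2 := by
      have : inner ℂ P (((√(defect z) : ℝ) : ℂ) • (x - P)) = 0 := by
        rw [inner_smul_right, Submodule.inner_right_of_mem_orthogonal
          (K := (ℂ ∙ z)) (Submodule.starProjection_apply_mem _ _)
          (Submodule.sub_starProjection_mem_orthogonal _), mul_zero]
      have h3 := norm_add_sq_eq_norm_sq_add_norm_sq_of_inner_eq_zero _ _ this
      rw [pow_two, h3, norm_smul, Complex.norm_real, Real.norm_of_nonneg hs.le]
      nlinarith [Real.mul_self_sqrt hd.le]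
    have horth2 : ‖x‖ ^ 2 = ‖P‖ ^ 2 + ‖x - P‖ ^ 2 := by
      have : inner ℂ P (x - P) = 0 := Submodule.inner_right_of_mem_orthogonal
          (K := (ℂ ∙ z)) (Submodule.starProjection_apply_mem _ _)
          (Submodule.sub_starProjection_mem_orthogonal _)
      have h3 := norm_add_sq_eq_norm_sq_add_norm_sq_of_inner_eq_zero _ _ this
      rw [add_sub_cancel] at h3
      nlinarith
    have h1 : √(defect z) * ‖x‖ ≤ ‖P + ((√(defect z) : ℝ) : ℂ) • (x - P)‖ := by
      refine (sq_le_sq₀ (by positivity) (by positivity)).1 ?_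
      rw [mul_pow, Real.sq_sqrt hd.le, horth, horth2]
      nlinarith [sq_nonneg ‖P‖, defect_le_one z]
    refine h1.trans ?_
    rw [← hid, norm_smul]
    refine mul_le_mul (hz1.trans ?_) le_rfl (norm_nonneg _) (by positivity)
    nlinarith
  have hC : ‖x‖ / √(defect z) ≤ 2 * pseudoHyp z w := by
    rw [div_le_iff₀ hs]
    have : √(defect z) * ‖x‖ ≤ √(defect z) * (2 * pseudoHyp z w * √(defect z)) := by
      refine hB.trans (le_of_eq ?_)
      nlinarith [Real.mul_self_sqrt hd.le]
    exact le_of_mul_le_mul_left this hs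
  have hD : ‖inner ℂ z x‖ / defect z ≤ 2 * pseudoHyp z w := by
    rw [div_le_iff₀ hd]; exact hA
  unfold bergmanGauge; linarith

/-- Near a fixed point the pseudo-hyperbolic distance is controlled by the Euclidean one, so
functions in `𝒜` are continuous on the ball. -/
lemma pseudoHyp_le {z w : Cn n} (hz : ‖z‖ < 1) (hw : ‖w‖ < 1) :
    pseudoHyp z w ≤ 2 * ‖z - w‖ / (1 - ‖z‖) := by
  have h0 : 0 < 1 - ‖z‖ := by linarith
  have hid := one_sub_inner_smul_ballAut hz hw
  set x := z - w with hx
  have h1 : ‖(1 - inner ℂ z w) • ballAut z w‖ ≤ 2 * ‖x‖ := by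
    rw [hid]
    have hP : ‖(ℂ ∙ z).starProjection x‖ ≤ ‖x‖ := Submodule.norm_starProjection_apply_le _ _
    have hQ : ‖x - (ℂ ∙ z).starProjection x‖ ≤ ‖x‖ := by
      rw [← Submodule.starProjection_orthogonal_val]
      exact Submodule.norm_starProjection_apply_le _ _
    have hs : √(defect z) ≤ 1 := Real.sqrt_le_one.2 (defect_le_one z)
    refine (norm_add_le _ _).trans ?_
    rw [norm_smul, Complex.norm_real, Real.norm_of_nonneg (Real.sqrt_nonneg _)]
    nlinarith [norm_nonneg (x - (ℂ ∙ z).starProjection x), Real.sqrt_nonneg (defect z)]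
  rw [norm_smul] at h1
  rw [le_div_iff₀ h0]
  have h2 : 1 - ‖z‖ ≤ ‖1 - inner ℂ z w‖ := by
    have := one_sub_norm_le z hw.le
    rwa [← inner_conj_symm, ← map_one (starRingEnd ℂ), ← map_sub, RCLike.norm_conj] at this
  have h3 : 0 ≤ pseudoHyp z w := norm_nonneg _
  unfold pseudoHyp at *
  nlinarith

/-! ### The Forelli–Rudin estimate in the disc -/

lemma lintegral_Ioi_add_rpow {x c : ℝ} (hx : 0 < x) (hc : 1 < c) :
    ∫⁻ t in Set.Ioi (0 : ℝ), ENNReal.ofReal ((x + t) ^ (-c)) =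
      ENNReal.ofReal (x ^ (1 - c) / (c - 1)) := by
  have h1 : ∫⁻ t in Set.Ioi x, ENNReal.ofReal (t ^ (-c)) =
      ENNReal.ofReal (x ^ (1 - c) / (c - 1)) := by
    rw [← ofReal_integral_eq_lintegral_ofReal (integrableOn_Ioi_rpow_of_lt (by linarith) hx),
      integral_Ioi_rpow_of_lt (by linarith) hx]
    · congr 1
      rw [show -c + 1 = 1 - c by ring, ← neg_div_neg_eq]; congr 1 <;> ring
    · filter_upwards [ae_restrict_mem measurableSet_Ioi] with t ht
      exact Real.rpow_nonneg (hx.trans ht).le _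
  rw [← h1, ← lintegral_indicator measurableSet_Ioi, ← lintegral_indicator measurableSet_Ioi,
    ← lintegral_add_left_eq_self ((Set.Ioi x).indicator _) x]
  congr 1
  ext t
  simp [Set.indicator_apply]

lemma lintegral_add_abs_rpow_le {x c : ℝ} (hx : 0 < x) (hc : 1 < c) :
    ∫⁻ t : ℝ, ENNReal.ofReal ((x + |t|) ^ (-c)) ≤
      ENNReal.ofReal (2 * (x ^ (1 - c) / (c - 1))) := by
  set F : ℝ → ℝ≥0∞ := (Set.Ioi 0).indicator fun t => ENNReal.ofReal ((x + t) ^ (-c)) with hF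
  have hFm : Measurable F := by
    refine Measurable.indicator ?_ measurableSet_Ioi
    fun_prop
  have hle : ∀ᵐ t : ℝ, ENNReal.ofReal ((x + |t|) ^ (-c)) ≤ F t + F (-t) := by
    have : ∀ᵐ t : ℝ, t ≠ 0 := by simp [ae_iff]
    filter_upwards [this] with t ht
    rcases lt_or_gt_of_ne ht with h | h
    · simp [hF, Set.indicator_apply, h, abs_of_neg h]
    · simp [hF, Set.indicator_apply, h, abs_of_pos h]
  refine (lintegral_mono_ae hle).trans ?_
  rw [lintegral_add_left hFm, lintegral_neg_eq_self, ← two_mul, hF,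
    lintegral_indicator measurableSet_Ioi, lintegral_Ioi_add_rpow hx hc,
    ENNReal.ofReal_mul (by norm_num)]
  simp

/-- Splitting at `y = τ` reduces the integral to two pure powers. -/
lemma lintegral_rpow_mul_max_rpow_le {b s τ : ℝ} (hb : -1 < b) (hs : 0 < s) (hτ : 0 < τ) :
    ∫⁻ y in Set.Ioi (0 : ℝ), ENNReal.ofReal (y ^ b * (max τ y) ^ (-(b + 1 + s))) ≤
      ENNReal.ofReal ((1 / (b + 1) + 1 / s) * τ ^ (-s)) := by
  have hunion : Set.Ioi (0 : ℝ) = Set.Ioc 0 τ ∪ Set.Ioi τ := (Set.Ioc_union_Ioi_eq_Ioi hτ.le).symm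
  rw [hunion]
  refine (lintegral_union_le _ _ _).trans ?_
  have h1 : ∫⁻ y in Set.Ioc 0 τ, ENNReal.ofReal (y ^ b * (max τ y) ^ (-(b + 1 + s))) =
      ENNReal.ofReal (1 / (b + 1) * τ ^ (-s)) := by
    have e : ∀ y ∈ Set.Ioc 0 τ, ENNReal.ofReal (y ^ b * (max τ y) ^ (-(b + 1 + s))) =
        ENNReal.ofReal (τ ^ (-(b + 1 + s))) * ENNReal.ofReal (y ^ b) := fun y hy => by
      rw [max_eq_left hy.2, mul_comm, ENNReal.ofReal_mul (by positivity)]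
    rw [setLIntegral_congr_fun measurableSet_Ioc e, lintegral_const_mul _ (by fun_prop)]
    have hi := (intervalIntegrable_iff_integrableOn_Ioc_of_le hτ.le).1
      (intervalIntegral.intervalIntegrable_rpow' (a := 0) (b := τ) hb)
    rw [← ofReal_integral_eq_lintegral_ofReal hi, ← intervalIntegral.integral_of_le hτ.le,
      integral_rpow (Or.inl hb), Real.zero_rpow (by linarith), sub_zero,
      ← ENNReal.ofReal_mul (by positivity)]
    · congr 1
      rw [mul_div_assoc', ← Real.rpow_add hτ, mul_comm, mul_one_div]
      ring_nf
    · filter_upwards [ae_restrict_mem measurableSet_Ioc] with t ht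
      exact Real.rpow_nonneg ht.1.le _
  have h2 : ∫⁻ y in Set.Ioi τ, ENNReal.ofReal (y ^ b * (max τ y) ^ (-(b + 1 + s))) =
      ENNReal.ofReal (1 / s * τ ^ (-s)) := by
    have e : ∀ y ∈ Set.Ioi τ, ENNReal.ofReal (y ^ b * (max τ y) ^ (-(b + 1 + s))) =
        ENNReal.ofReal (y ^ (-1 - s)) := fun y hy => by
      rw [max_eq_right (le_of_lt hy), ← Real.rpow_add (hτ.trans hy)]; ring_nf
    rw [setLIntegral_congr_fun measurableSet_Ioi e,
      ← ofReal_integral_eq_lintegral_ofReal (integrableOn_Ioi_rpow_of_lt (by linarith) hτ),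
      integral_Ioi_rpow_of_lt (by linarith) hτ]
    · congr 1
      rw [show -1 - s + 1 = -s by ring, neg_div_neg_eq]; ring
    · filter_upwards [ae_restrict_mem measurableSet_Ioi] with t ht
      exact Real.rpow_nonneg (hτ.trans ht).le _
  have hb' : 0 < b + 1 := by linarith
  rw [h1, h2, ← ENNReal.ofReal_add (by positivity) (by positivity), ← add_mul]

/-- In polar coordinates `|1 - q e^{iθ}|` is bounded below by a multiple of `1 - q + |θ|`. -/
lemma norm_one_sub_polar_ge {q θ : ℝ} (hq : 0 ≤ q) (hq1 : q < 1) (hθ : |θ| ≤ Real.pi) :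
    (1 - q + |θ|) / 8 ≤ ‖1 - (q : ℂ) * (Real.cos θ + Real.sin θ * Complex.I)‖ := by
  have hsq : ‖1 - (q : ℂ) * (Real.cos θ + Real.sin θ * Complex.I)‖ ^ 2 =
      1 - 2 * q * Real.cos θ + q ^ 2 := by
    rw [Complex.sq_norm, Complex.normSq_apply]
    simp [-Complex.ofReal_cos, -Complex.ofReal_sin]
    nlinarith [Real.sin_sq_add_cos_sq θ]
  have hcos := Real.cos_le_one_sub_mul_cos_sq hθ
  have hpi : Real.pi < 3.15 := Real.pi_lt_d2
  have hpi0 := Real.pi_pos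
  have hc : 2 / Real.pi ^ 2 ≥ 1 / 5 := by
    rw [ge_iff_le, div_le_div_iff₀ (by norm_num) (by positivity)]; nlinarith
  have hc2 : 2 / Real.pi ^ 2 * θ ^ 2 ≥ 1 / 5 * θ ^ 2 := by gcongr
  have habs : |θ| ^ 2 = θ ^ 2 := sq_abs θ
  have h0 : 0 ≤ |θ| := abs_nonneg θ
  refine (sq_le_sq₀ (by positivity) (by positivity)).1 ?_
  rw [hsq]
  have hmain : (1 - q) ^ 2 + 2 * q * (1 / 5 * θ ^ 2) ≤ 1 - 2 * q * Real.cos θ + q ^ 2 := by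
    nlinarith
  refine le_trans ?_ hmain
  -- For `q ≤ 1 / 2` the term `1 - q` alone dominates, since `|θ| ≤ π`.
  rcases le_or_gt (1 / 2) q with h | h
  · nlinarith [sq_nonneg (1 - q - |θ|), sq_nonneg θ, sq_nonneg (1 - q)]
  · have h3 : |θ| ≤ 7 * (1 - q) := by linarith
    have h4 : (1 - q + |θ|) / 8 ≤ 1 - q := by linarith
    nlinarith [sq_nonneg θ, mul_nonneg hq (sq_nonneg θ)]

lemma one_sub_sq_rpow_le {r b : ℝ} (hr : 0 < r) (hr1 : r < 1) :
    (1 - r ^ 2) ^ b ≤ 2 ^ |b| * (1 - r) ^ b := by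
  have h1 : (1 - r ^ 2) = (1 + r) * (1 - r) := by ring
  rw [h1, Real.mul_rpow (by linarith) (by linarith)]
  have h2 : 0 ≤ (1 - r) ^ b := Real.rpow_nonneg (by linarith) _
  gcongr
  calc (1 + r) ^ b ≤ (1 + r) ^ |b| :=
        Real.rpow_le_rpow_of_exponent_le (by linarith) (le_abs_self b)
    _ ≤ 2 ^ |b| := Real.rpow_le_rpow (by linarith) (by linarith) (abs_nonneg b)

/-- The Forelli–Rudin estimate in the unit disc, for a real pole, by polar coordinates. -/
lemma exists_lintegral_disc_le {b s : ℝ} (hb : -1 < b) (hs : 0 < s) :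
    ∃ C : ℝ, 0 < C ∧ ∀ a : ℝ, 0 ≤ a → a < 1 →
      ∫⁻ w in Metric.ball (0 : ℂ) 1,
        ENNReal.ofReal ((1 - ‖w‖ ^ 2) ^ b * ‖1 - (a : ℂ) * w‖ ^ (-(b + 2 + s))) ≤
      ENNReal.ofReal (C * (1 - a ^ 2) ^ (-s)) := by
  set c := b + 2 + s with hc
  have hc1 : 1 < c := by linarith
  set A : ℝ := 2 ^ |b| * (8 ^ c * (2 / (c - 1))) with hA
  have hc1' : 0 < c - 1 := by linarith
  have hApos : 0 < A := by positivity
  have hb' : 0 < b + 1 := by linarith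
  refine ⟨A * ((1 / (b + 1) + 1 / s) * 2 ^ s), by positivity, fun a ha ha1 => ?_⟩
  have hτ : 0 < 1 - a := by linarith
  rw [← lintegral_indicator Metric.isOpen_ball.measurableSet,
    ← Complex.lintegral_comp_polarCoord_symm]
  set G : ℝ × ℝ → ℝ≥0∞ := fun q => (Set.Iio 1).indicator
    (fun r : ℝ => ENNReal.ofReal (2 ^ |b| * 8 ^ c * (1 - r) ^ b)) q.1 *
      ENNReal.ofReal ((1 - a * q.1 + |q.2|) ^ (-c)) with hG
  have hGm : Measurable G := by
    refine Measurable.mul ?_ (by fun_prop)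
    refine Measurable.comp (g := (Set.Iio 1).indicator
      (fun r : ℝ => ENNReal.ofReal (2 ^ |b| * 8 ^ c * (1 - r) ^ b))) ?_ measurable_fst
    exact Measurable.indicator (by fun_prop) measurableSet_Iio
  have hpt : ∀ q ∈ polarCoord.target, ENNReal.ofReal q.1 •
      (Metric.ball (0 : ℂ) 1).indicator (fun w => ENNReal.ofReal
        ((1 - ‖w‖ ^ 2) ^ b * ‖1 - (a : ℂ) * w‖ ^ (-c))) (Complex.polarCoord.symm q) ≤ G q := by
    rintro ⟨r, θ⟩ hq
    simp only [polarCoord_target, Set.mem_prod, Set.mem_Ioi, Set.mem_Ioo] at hq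
    obtain ⟨hr, hθ⟩ := hq
    have hn : ‖Complex.polarCoord.symm (r, θ)‖ = r := by
      rw [Complex.norm_polarCoord_symm, abs_of_pos hr]
    by_cases hr1 : r < 1
    · have hmem : Complex.polarCoord.symm (r, θ) ∈ Metric.ball (0 : ℂ) 1 := by
        simpa [hn, abs_of_pos hr] using hr1
      rw [Set.indicator_of_mem hmem, hn, smul_eq_mul, hG]
      simp only
      rw [Set.indicator_of_mem (show r ∈ Set.Iio 1 from hr1), ← ENNReal.ofReal_mul hr.le,
        ← ENNReal.ofReal_mul (by have : 0 < 1 - r := by linarith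
                                 positivity)]
      apply ENNReal.ofReal_le_ofReal
      have har : a * r < 1 := by nlinarith
      have hθ' : |θ| ≤ Real.pi := abs_le.2 ⟨hθ.1.le, hθ.2.le⟩
      have hlow := norm_one_sub_polar_ge (mul_nonneg ha hr.le) har hθ'
      have hx : 0 < 1 - a * r + |θ| := by have := abs_nonneg θ; linarith
      have heq : (1 : ℂ) - (a : ℂ) * Complex.polarCoord.symm (r, θ) =
          1 - ((a * r : ℝ) : ℂ) * (Real.cos θ + Real.sin θ * Complex.I) := by
        rw [Complex.polarCoord_symm_apply]; push_cast; ring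
      rw [heq]
      have h2 : ‖1 - ((a * r : ℝ) : ℂ) * (Real.cos θ + Real.sin θ * Complex.I)‖ ^ (-c) ≤
          8 ^ c * (1 - a * r + |θ|) ^ (-c) := by
        calc _ ≤ ((1 - a * r + |θ|) / 8) ^ (-c) :=
              Real.rpow_le_rpow_of_nonpos (by positivity) hlow (by linarith)
          _ = _ := by
              rw [Real.div_rpow hx.le (by norm_num), Real.rpow_neg (by norm_num : (0:ℝ) ≤ 8)]
              field_simp
      have h3 := one_sub_sq_rpow_le (b := b) hr hr1
      have h4 : 0 ≤ (1 - r ^ 2) ^ b := Real.rpow_nonneg (by nlinarith) _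
      calc r * ((1 - r ^ 2) ^ b *
            ‖1 - ((a * r : ℝ) : ℂ) * (Real.cos θ + Real.sin θ * Complex.I)‖ ^ (-c))
          ≤ 1 * ((2 ^ |b| * (1 - r) ^ b) * (8 ^ c * (1 - a * r + |θ|) ^ (-c))) := by
            gcongr
        _ = _ := by ring
    · have hmem : Complex.polarCoord.symm (r, θ) ∉ Metric.ball (0 : ℂ) 1 := by
        simpa [hn, abs_of_pos hr] using hr1
      rw [Set.indicator_of_notMem hmem]; simp
  refine (setLIntegral_mono' polarCoord.open_target.measurableSet hpt).trans ?_
  rw [polarCoord_target, Measure.volume_eq_prod, ← Measure.prod_restrict,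
    lintegral_prod _ hGm.aemeasurable]
  -- The angular integral gains one power of `1 - a r`.
  have hinner : ∀ r ∈ Set.Ioi (0 : ℝ), ∫⁻ θ in Set.Ioo (-Real.pi) Real.pi, G (r, θ) ≤
      (Set.Iio 1).indicator (fun r : ℝ => ENNReal.ofReal
        (A * ((1 - r) ^ b * (max (1 - a) (1 - r)) ^ (-(b + 1 + s))))) r := by
    intro r hr
    rw [hG]
    simp only
    by_cases hr1 : r < 1
    · have hr' : r ∈ Set.Iio (1 : ℝ) := hr1
      simp only [Set.indicator_of_mem hr']
      have hr0 : (0 : ℝ) < r := hr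
      have hx : 0 < 1 - a * r := by nlinarith
      have h1r : 0 ≤ (1 - r) ^ b := Real.rpow_nonneg (by linarith) _
      rw [lintegral_const_mul _ (by fun_prop)]
      calc _ ≤ ENNReal.ofReal (2 ^ |b| * 8 ^ c * (1 - r) ^ b) *
            ENNReal.ofReal (2 * ((1 - a * r) ^ (1 - c) / (c - 1))) := by
            gcongr
            exact (setLIntegral_le_lintegral _ _).trans (lintegral_add_abs_rpow_le hx hc1)
        _ = ENNReal.ofReal (A * ((1 - r) ^ b * (1 - a * r) ^ (1 - c))) := by
            rw [← ENNReal.ofReal_mul (by positivity)]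
            congr 1; rw [hA]; field_simp
        _ ≤ _ := by
            apply ENNReal.ofReal_le_ofReal
            gcongr
            rw [show -(b + 1 + s) = 1 - c by rw [hc]; ring]
            refine Real.rpow_le_rpow_of_nonpos (lt_max_of_lt_left hτ) ?_ (by linarith)
            apply max_le <;> nlinarith
    · simp [show r ∉ Set.Iio (1 : ℝ) from hr1]
  refine (setLIntegral_mono' measurableSet_Ioi hinner).trans ?_
  -- Substitute `y = 1 - r`.
  have hrefl : ∫⁻ r in Set.Ioi (0 : ℝ), (Set.Iio 1).indicator (fun r : ℝ => ENNReal.ofReal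
        (A * ((1 - r) ^ b * (max (1 - a) (1 - r)) ^ (-(b + 1 + s))))) r ≤
      ∫⁻ y in Set.Ioi (0 : ℝ), ENNReal.ofReal A *
        ENNReal.ofReal (y ^ b * (max (1 - a) y) ^ (-(b + 1 + s))) := by
    refine (setLIntegral_le_lintegral _ _).trans (le_of_eq ?_)
    rw [← lintegral_indicator measurableSet_Ioi, ← lintegral_sub_left_eq_self _ (1 : ℝ)]
    congr 1
    ext r
    simp only [Set.indicator_apply, Set.mem_Iio, Set.mem_Ioi,
      ENNReal.ofReal_mul hApos.le]
    simp [← ENNReal.ofReal_mul hApos.le]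
  refine hrefl.trans ?_
  rw [lintegral_const_mul _ (by fun_prop)]
  calc _ ≤ ENNReal.ofReal A * ENNReal.ofReal ((1 / (b + 1) + 1 / s) * (1 - a) ^ (-s)) := by
        gcongr; exact lintegral_rpow_mul_max_rpow_le hb hs hτ
    _ = ENNReal.ofReal (A * ((1 / (b + 1) + 1 / s) * (1 - a) ^ (-s))) := by
        rw [← ENNReal.ofReal_mul hApos.le]
    _ ≤ _ := by
        apply ENNReal.ofReal_le_ofReal
        have h5 : (1 - a) ^ (-s) ≤ 2 ^ s * (1 - a ^ 2) ^ (-s) := by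
          have h6 : 0 < 1 - a ^ 2 := by nlinarith
          have h7 : (1 - a) ^ (-s) ≤ ((1 - a ^ 2) / 2) ^ (-s) :=
            Real.rpow_le_rpow_of_nonpos (by positivity) (by nlinarith) (by linarith)
          refine h7.trans (le_of_eq ?_)
          rw [Real.div_rpow h6.le (by norm_num), Real.rpow_neg (by norm_num : (0:ℝ) ≤ 2)]
          field_simp
        calc _ ≤ A * ((1 / (b + 1) + 1 / s) * (2 ^ s * (1 - a ^ 2) ^ (-s))) := by gcongr
          _ = _ := by ring

/-! ### The Forelli–Rudin estimate in the ball -/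

/-- Splitting off the first coordinate of `ℂᵐ⁺¹`. -/
def consIsometry (m : ℕ) : Cn (m + 1) ≃ₗᵢ[ℂ] WithLp 2 (ℂ × Cn m) where
  toFun w := WithLp.toLp 2 (w 0, WithLp.toLp 2 (fun i => w i.succ))
  invFun q := WithLp.toLp 2 (Fin.cons q.fst (WithLp.ofLp q.snd))
  map_add' _ _ := rfl
  map_smul' _ _ := rfl
  left_inv w := by
    ext i; refine Fin.cases ?_ (fun j => ?_) i <;> simp
  right_inv q := rfl
  norm_map' w := by
    refine (sq_eq_sq₀ (norm_nonneg _) (norm_nonneg _)).1 ?_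
    change ‖(WithLp.toLp 2 (w 0, (WithLp.toLp 2 (fun i => w i.succ) : Cn m)) :
      WithLp 2 (ℂ × Cn m))‖ ^ 2 = _
    rw [WithLp.prod_norm_sq_eq_of_L2, EuclideanSpace.norm_sq_eq, EuclideanSpace.norm_sq_eq,
      Fin.sum_univ_succ]
    rfl

/-- Every unit vector is the first member of an orthonormal basis, so that `⟨·, e⟩` is the first
coordinate in suitable unitary coordinates. -/
lemma exists_isometry_fst_eq_inner {m : ℕ} {e : Cn (m + 1)} (he : ‖e‖ = 1) :
    ∃ Φ : Cn (m + 1) ≃ₗᵢ[ℂ] WithLp 2 (ℂ × Cn m), ∀ w, (Φ w).fst = inner ℂ e w := by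
  have hon : Orthonormal ℂ (({0} : Set (Fin (m + 1))).domRestrict fun _ => e) := by
    refine ⟨fun _ => he, fun i j hij => ?_⟩
    exact absurd (Subsingleton.elim i j) hij
  obtain ⟨b, hb⟩ := hon.exists_orthonormalBasis_extension_of_card_eq (ι := Fin (m + 1)) (by simp)
  refine ⟨b.repr.trans (consIsometry m), fun w => ?_⟩
  rw [← hb 0 rfl, ← b.repr_apply_apply]
  rfl

lemma measurePreserving_isometry_prod {m : ℕ} (Φ : Cn (m + 1) ≃ₗᵢ[ℂ] WithLp 2 (ℂ × Cn m)) :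
    MeasurePreserving (fun w => WithLp.ofLp (Φ w)) (volume : Measure (Cn (m + 1)))
      ((volume : Measure ℂ).prod (volume : Measure (Cn m))) := by
  let e : Cn (m + 1) ≃ₗᵢ[ℝ] WithLp 2 (ℂ × Cn m) :=
    { Φ.toLinearEquiv.restrictScalars ℝ with norm_map' := Φ.norm_map }
  have h1 : MeasurePreserving e volume volume := e.measurePreserving
  exact (WithLp.volume_preserving_ofLp ℂ (Cn m)).comp h1

lemma finrank_real_Cn (m : ℕ) : Module.finrank ℝ (Cn m) = 2 * m := by
  rw [← Module.finrank_mul_finrank ℝ ℂ (Cn m), Complex.finrank_real_complex, finrank_euclideanSpace,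
    Fintype.card_fin]

/-- Scaling evaluates the integral of a power of `ρ² - |v|²` over the ball of radius `ρ`. -/
lemma lintegral_ball_sub_sq_rpow (m : ℕ) (b : ℝ) {ρ : ℝ} (hρ : 0 < ρ) :
    ∫⁻ v in Metric.ball (0 : Cn m) ρ, ENNReal.ofReal ((ρ ^ 2 - ‖v‖ ^ 2) ^ b) =
      ENNReal.ofReal ((ρ ^ 2) ^ (b + m)) *
        ∫⁻ v in Metric.ball (0 : Cn m) 1, ENNReal.ofReal (defect v ^ b) := by
  set G : Cn m → ℝ≥0∞ := (Metric.ball (0 : Cn m) 1).indicator fun v => ENNReal.ofReal (defect v ^ b)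
    with hG
  have hGm : Measurable G := by
    refine Measurable.indicator ?_ Metric.isOpen_ball.measurableSet
    exact (continuous_defect.measurable.pow_const b).ennreal_ofReal
  have h1 : ∀ v, (Metric.ball (0 : Cn m) ρ).indicator
      (fun v => ENNReal.ofReal ((ρ ^ 2 - ‖v‖ ^ 2) ^ b)) v =
      ENNReal.ofReal ((ρ ^ 2) ^ b) * G (ρ⁻¹ • v) := by
    intro v
    have hmem : v ∈ Metric.ball (0 : Cn m) ρ ↔ ρ⁻¹ • v ∈ Metric.ball (0 : Cn m) 1 := by
      simp only [mem_ball_zero_iff, norm_smul, norm_inv, Real.norm_of_nonneg hρ.le]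
      rw [inv_mul_lt_iff₀ hρ, mul_one]
    by_cases hv : v ∈ Metric.ball (0 : Cn m) ρ
    · have hv' := hmem.1 hv
      have hd : 0 < defect (ρ⁻¹ • v) := defect_pos (by simpa using hv')
      rw [Set.indicator_of_mem hv, hG]
      rw [Set.indicator_of_mem hv', ← ENNReal.ofReal_mul (by positivity),
        ← Real.mul_rpow (by positivity) hd.le]
      congr 2
      simp only [defect, norm_smul, norm_inv, Real.norm_of_nonneg hρ.le]
      field_simp
    · have hv' := fun h => hv (hmem.2 h)
      rw [Set.indicator_of_notMem hv, hG]
      rw [Set.indicator_of_notMem hv', mul_zero]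
  rw [← lintegral_indicator Metric.isOpen_ball.measurableSet,
    ← lintegral_indicator Metric.isOpen_ball.measurableSet, lintegral_congr h1,
    lintegral_const_mul _ (by fun_prop)]
  have h2 : ∫⁻ v : Cn m, G (ρ⁻¹ • v) = ENNReal.ofReal (ρ ^ (2 * m)) * ∫⁻ v, G v := by
    rw [← lintegral_map hGm (measurable_const_smul _),
      Measure.map_addHaar_smul _ (inv_ne_zero hρ.ne'), lintegral_smul_measure, finrank_real_Cn,
      inv_pow, inv_inv, abs_of_pos (by positivity), smul_eq_mul]
  rw [h2, ← mul_assoc, ← ENNReal.ofReal_mul (by positivity)]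
  congr 2
  rw [Real.rpow_add (by positivity), Real.rpow_natCast, ← pow_mul]

/-- Fubini reduces the estimate in `𝔹ₘ₊₁` to the one in the disc with the weight `b + m`. -/
lemma exists_lintegral_ball_succ_le {m : ℕ} {b s : ℝ} (hb : -1 < b) (hs : 0 < s)
    (hfin : ∫⁻ v in Metric.ball (0 : Cn m) 1, ENNReal.ofReal (defect v ^ b) < ⊤) :
    ∃ C : ℝ, 0 < C ∧ ∀ z : Cn (m + 1), ‖z‖ < 1 →
      ∫⁻ w in Metric.ball (0 : Cn (m + 1)) 1,
        ENNReal.ofReal (defect w ^ b * ‖1 - inner ℂ w z‖ ^ (-((m + 1 : ℕ) + 1 + b + s))) ≤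
      ENNReal.ofReal (C * defect z ^ (-s)) := by
  obtain ⟨C, hC, hdisc⟩ := exists_lintegral_disc_le (b := b + m) (s := s)
    (by have : (0 : ℝ) ≤ m := by positivity
        linarith) hs
  set I := ∫⁻ v in Metric.ball (0 : Cn m) 1, ENNReal.ofReal (defect v ^ b) with hI
  refine ⟨C * (I.toReal + 1), by positivity, fun z hz => ?_⟩
  -- By unitary invariance the pole may be assumed to lie on the first coordinate axis.
  obtain ⟨e, he, hze⟩ : ∃ e : Cn (m + 1), ‖e‖ = 1 ∧ z = (‖z‖ : ℂ) • e := by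
    rcases eq_or_ne z 0 with rfl | h
    · exact ⟨EuclideanSpace.single 0 1, by simp, by simp⟩
    · refine ⟨(‖z‖ : ℂ)⁻¹ • z, ?_, ?_⟩
      · simp [norm_smul, h]
      · rw [smul_smul, mul_inv_cancel₀ (by simpa using h), one_smul]
  obtain ⟨Φ, hΦ⟩ := exists_isometry_fst_eq_inner he
  set a := ‖z‖ with ha
  set c : ℝ := (m + 1 : ℕ) + 1 + b + s with hc
  have hc' : c = b + m + 2 + s := by rw [hc]; push_cast; ring
  set G : ℂ × Cn m → ℝ≥0∞ := {q | ‖q.1‖ ^ 2 + ‖q.2‖ ^ 2 < 1}.indicator fun q =>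
    ENNReal.ofReal ((1 - ‖q.1‖ ^ 2 - ‖q.2‖ ^ 2) ^ b * ‖1 - (a : ℂ) * q.1‖ ^ (-c)) with hG
  have hGm : Measurable G := by
    refine Measurable.indicator (by fun_prop) ?_
    exact measurableSet_lt (by fun_prop) measurable_const
  have h1 : ∀ w, (Metric.ball (0 : Cn (m + 1)) 1).indicator (fun w =>
      ENNReal.ofReal (defect w ^ b * ‖1 - inner ℂ w z‖ ^ (-c))) w = G (WithLp.ofLp (Φ w)) := by
    intro w
    have hn : ‖w‖ ^ 2 = ‖(Φ w).fst‖ ^ 2 + ‖(Φ w).snd‖ ^ 2 := by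
      rw [← WithLp.prod_norm_sq_eq_of_L2, Φ.norm_map]
    have hmem : w ∈ Metric.ball (0 : Cn (m + 1)) 1 ↔
        WithLp.ofLp (Φ w) ∈ {q : ℂ × Cn m | ‖q.1‖ ^ 2 + ‖q.2‖ ^ 2 < 1} := by
      have : ‖w‖ < 1 ↔ ‖w‖ ^ 2 < 1 := by
        rw [sq_lt_one_iff₀ (norm_nonneg w)]
      rw [mem_ball_zero_iff, this, hn]; rfl
    have hin : ‖1 - inner ℂ w z‖ = ‖1 - (a : ℂ) * (Φ w).fst‖ := by
      rw [hΦ, hze, inner_smul_right, ← inner_conj_symm, ← RCLike.norm_conj]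
      simp
    by_cases hw : w ∈ Metric.ball (0 : Cn (m + 1)) 1
    · rw [Set.indicator_of_mem hw, hG]
      rw [Set.indicator_of_mem (hmem.1 hw), hin, defect, hn]
      congr 3; ring_nf; rfl
    · rw [Set.indicator_of_notMem hw, hG]
      rw [Set.indicator_of_notMem (fun h => hw (hmem.2 h))]
  rw [← lintegral_indicator Metric.isOpen_ball.measurableSet, lintegral_congr h1,
    (measurePreserving_isometry_prod Φ).lintegral_comp hGm, lintegral_prod _ hGm.aemeasurable]
  -- The slice over `u` is a ball of radius `√(1 - |u|²)`, which contributes `(1 - |u|²)^{b + m}`.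
  have h2 : ∀ u : ℂ, ∫⁻ v, G (u, v) = (Metric.ball (0 : ℂ) 1).indicator (fun u =>
      I * ENNReal.ofReal ((1 - ‖u‖ ^ 2) ^ (b + m) * ‖1 - (a : ℂ) * u‖ ^ (-c))) u := by
    intro u
    by_cases hu : u ∈ Metric.ball (0 : ℂ) 1
    · rw [Set.indicator_of_mem hu]
      rw [mem_ball_zero_iff] at hu
      have hρ : 0 < 1 - ‖u‖ ^ 2 := by nlinarith [norm_nonneg u]
      have hsq : √(1 - ‖u‖ ^ 2) ^ 2 = 1 - ‖u‖ ^ 2 := Real.sq_sqrt hρ.le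
      have hball := lintegral_ball_sub_sq_rpow m b (Real.sqrt_pos.2 hρ)
      rw [hsq, ← hI] at hball
      rw [ENNReal.ofReal_mul (by positivity), ← mul_assoc, mul_comm I, ← hball,
        ← lintegral_mul_const _ (by fun_prop),
        ← lintegral_indicator Metric.isOpen_ball.measurableSet]
      refine lintegral_congr fun v => ?_
      have hmem : (u, v) ∈ {q : ℂ × Cn m | ‖q.1‖ ^ 2 + ‖q.2‖ ^ 2 < 1} ↔
          v ∈ Metric.ball (0 : Cn m) √(1 - ‖u‖ ^ 2) := by
        rw [mem_ball_zero_iff, Real.lt_sqrt (norm_nonneg v), Set.mem_ofPred_eq]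
        constructor <;> intro h <;> linarith
      by_cases hv : v ∈ Metric.ball (0 : Cn m) √(1 - ‖u‖ ^ 2)
      · have hv' := hmem.2 hv
        have : 0 ≤ 1 - ‖u‖ ^ 2 - ‖v‖ ^ 2 := by
          have : ‖u‖ ^ 2 + ‖v‖ ^ 2 < 1 := hv'
          linarith
        rw [Set.indicator_of_mem hv, hG]
        rw [Set.indicator_of_mem hv', ENNReal.ofReal_mul (by positivity)]
      · rw [Set.indicator_of_notMem hv, hG]
        rw [Set.indicator_of_notMem (fun h => hv (hmem.1 h))]
    · rw [Set.indicator_of_notMem hu]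
      rw [mem_ball_zero_iff, not_lt] at hu
      rw [← lintegral_zero]
      refine lintegral_congr fun v => ?_
      rw [hG]
      refine Set.indicator_of_notMem ?_ _
      simp only [Set.mem_ofPred_eq, not_lt]
      nlinarith [sq_nonneg ‖v‖]
  rw [lintegral_congr h2, lintegral_indicator Metric.isOpen_ball.measurableSet,
    lintegral_const_mul _ (by fun_prop), hc']
  calc _ ≤ I * ENNReal.ofReal (C * (1 - a ^ 2) ^ (-s)) := by
        gcongr; exact hdisc a (norm_nonneg z) hz
    _ ≤ ENNReal.ofReal (I.toReal + 1) * ENNReal.ofReal (C * (1 - a ^ 2) ^ (-s)) := by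
        gcongr
        refine (ENNReal.le_ofReal_iff_toReal_le hfin.ne (by positivity)).2 (by linarith)
    _ = _ := by
        rw [← ENNReal.ofReal_mul (by positivity)]
        congr 1
        rw [defect]; ring

/-- Finiteness follows from the Forelli–Rudin bound at the pole `0`, by induction on the dimension.
-/
lemma lintegral_defect_rpow_lt_top (n : ℕ) {b : ℝ} (hb : -1 < b) :
    ∫⁻ w in Metric.ball (0 : Cn n) 1, ENNReal.ofReal (defect w ^ b) < ⊤ := by
  induction n with
  | zero =>
    have : ∀ w : Cn 0, ENNReal.ofReal (defect w ^ b) = 1 := fun w => by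
      simp [defect, Subsingleton.elim w 0]
    simp only [this, lintegral_const, one_mul, Measure.restrict_apply_univ]
    exact measure_ball_lt_top
  | succ m ih =>
    obtain ⟨C, -, h⟩ := exists_lintegral_ball_succ_le (s := 1) hb one_pos ih
    have := (h 0 (by simp)).trans_lt ENNReal.ofReal_lt_top
    simpa using this

/-- **Forelli–Rudin estimate.** -/
theorem exists_forelliRudin {n : ℕ} (hn : 1 ≤ n) {b s : ℝ} (hb : -1 < b) (hs : 0 < s) :
    ∃ C : ℝ, 0 < C ∧ ∀ z : Cn n, ‖z‖ < 1 →
      ∫⁻ w in Metric.ball (0 : Cn n) 1,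
        ENNReal.ofReal (defect w ^ b * ‖1 - inner ℂ w z‖ ^ (-(n + 1 + b + s))) ≤
      ENNReal.ofReal (C * defect z ^ (-s)) := by
  obtain ⟨m, rfl⟩ := Nat.exists_eq_add_of_le' hn
  exact exists_lintegral_ball_succ_le hb hs (lintegral_defect_rpow_lt_top m hb)

variable {α : ℝ}

/-! ### The measure `v_α` -/

/-- The normalizing constant `c_α` of `vMeasure`. -/
def normConst (n : ℕ) (α : ℝ) : ℝ≥0∞ := (weightedVolume n α Set.univ)⁻¹

lemma measurable_defect_rpow (α : ℝ) :
    Measurable fun z : Cn n => ENNReal.ofReal (defect z ^ α) :=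
  (continuous_defect.measurable.pow_const α).ennreal_ofReal

lemma lintegral_weightedVolume (f : Cn n → ℝ≥0∞) :
    ∫⁻ z, f z ∂(weightedVolume n α) =
      ∫⁻ z in Metric.ball (0 : Cn n) 1, ENNReal.ofReal (defect z ^ α) * f z := by
  change ∫⁻ z, f z ∂((volume.restrict (Metric.ball (0 : Cn n) 1)).withDensity
    fun z => ENNReal.ofReal (defect z ^ α)) = _
  rw [lintegral_withDensity_eq_lintegral_mul_non_measurable _
    (measurable_defect_rpow α) (Filter.Eventually.of_forall fun _ => ENNReal.ofReal_lt_top)]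
  rfl

lemma lintegral_vMeasure (f : Cn n → ℝ≥0∞) :
    ∫⁻ z, f z ∂(vMeasure n α) = normConst n α *
      ∫⁻ z in Metric.ball (0 : Cn n) 1, ENNReal.ofReal (defect z ^ α) * f z := by
  rw [vMeasure, lintegral_smul_measure, lintegral_weightedVolume, smul_eq_mul, normConst]

lemma weightedVolume_univ_lt_top (hα : -1 < α) : weightedVolume n α Set.univ < ⊤ := by
  rw [← lintegral_one, lintegral_weightedVolume]
  simpa using lintegral_defect_rpow_lt_top n hα

lemma weightedVolume_univ_ne_zero : weightedVolume n α Set.univ ≠ 0 := by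
  rw [← lintegral_one, lintegral_weightedVolume]
  simp only [mul_one]
  rw [← pos_iff_ne_zero, setLIntegral_pos_iff (measurable_defect_rpow α)]
  refine (Metric.isOpen_ball.measure_pos volume ⟨(0 : Cn n), by simp⟩).trans_le
    (measure_mono fun z hz => ⟨?_, hz⟩)
  have := defect_pos (mem_ball_zero_iff.1 hz)
  rw [Function.mem_support]
  exact (ENNReal.ofReal_pos.2 (by positivity)).ne'

lemma normConst_ne_zero (hα : -1 < α) : normConst n α ≠ 0 :=
  ENNReal.inv_ne_zero.2 (weightedVolume_univ_lt_top hα).ne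

lemma normConst_ne_top : normConst n α ≠ ⊤ :=
  ENNReal.inv_ne_top.2 weightedVolume_univ_ne_zero

lemma isProbabilityMeasure_vMeasure (hα : -1 < α) : IsProbabilityMeasure (vMeasure n α) :=
  ⟨by
    rw [vMeasure, Measure.smul_apply, smul_eq_mul]
    exact ENNReal.inv_mul_cancel weightedVolume_univ_ne_zero (weightedVolume_univ_lt_top hα).ne⟩

lemma vMeasure_absolutelyContinuous :
    vMeasure n α ≪ volume.restrict (Metric.ball (0 : Cn n) 1) :=
  Measure.AbsolutelyContinuous.trans Measure.smul_absolutelyContinuous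
    (withDensity_absolutelyContinuous _ _)

lemma ae_norm_lt_one : ∀ᵐ z ∂(vMeasure n α), ‖z‖ < 1 := by
  have h : ∀ᵐ z ∂(volume.restrict (Metric.ball (0 : Cn n) 1)), ‖z‖ < 1 := by
    filter_upwards [ae_restrict_mem Metric.isOpen_ball.measurableSet] with z hz
    simpa using hz
  exact vMeasure_absolutelyContinuous.ae_le h

/-! ### Gauge balls and doubling -/

/-- The set of points `z` with `z - w` of gauge less than `r` at `w`; a substitute for the
pseudo-hyperbolic ball. -/
def gaugeBall (w : Cn n) (r : ℝ) : Set (Cn n) := {z | bergmanGauge w (z - w) < r}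

lemma mem_gaugeBall {w z : Cn n} {r : ℝ} : z ∈ gaugeBall w r ↔ bergmanGauge w (z - w) < r :=
  Iff.rfl

lemma isOpen_gaugeBall (w : Cn n) (r : ℝ) : IsOpen (gaugeBall w r) :=
  isOpen_lt ((continuous_bergmanGauge w).comp (continuous_id.sub continuous_const))
    continuous_const

lemma measurableSet_gaugeBall (w : Cn n) (r : ℝ) : MeasurableSet (gaugeBall w r) :=
  (isOpen_gaugeBall w r).measurableSet

lemma self_mem_gaugeBall (w : Cn n) {r : ℝ} (hr : 0 < r) : w ∈ gaugeBall w r := by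
  simpa [gaugeBall, bergmanGauge_zero] using hr

lemma gaugeBall_mono (w : Cn n) {r s : ℝ} (h : r ≤ s) : gaugeBall w r ⊆ gaugeBall w s :=
  fun _ hz => lt_of_lt_of_le hz h

lemma defect_bounds_of_mem_gaugeBall {w z : Cn n} {r : ℝ} (hw : ‖w‖ < 1) (hr : r ≤ 1 / 8)
    (hz : z ∈ gaugeBall w r) : defect w / 2 ≤ defect z ∧ defect z ≤ 2 * defect w := by
  have := defect_add_bounds hw ((mem_gaugeBall.1 hz).le.trans hr)
  simpa using this

lemma norm_lt_one_of_mem_gaugeBall {w z : Cn n} {r : ℝ} (hw : ‖w‖ < 1) (hr : r ≤ 1 / 8)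
    (hz : z ∈ gaugeBall w r) : ‖z‖ < 1 := by
  have := norm_add_lt_one hw ((mem_gaugeBall.1 hz).le.trans hr)
  simpa using this

/-- The gauge ball of radius `r` at `w`, translated to the origin. -/
def gaugeDisc (w : Cn n) (r : ℝ) : Set (Cn n) := {x | bergmanGauge w x < r}

lemma isOpen_gaugeDisc (w : Cn n) (r : ℝ) : IsOpen (gaugeDisc w r) :=
  isOpen_lt (continuous_bergmanGauge w) continuous_const

lemma volume_gaugeBall (w : Cn n) (r : ℝ) : volume (gaugeBall w r) = volume (gaugeDisc w r) := by
  have : gaugeBall w r = (fun z => z - w) ⁻¹' gaugeDisc w r := rfl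
  rw [this]
  simp only [sub_eq_add_neg]
  rw [measure_preimage_add_right]

open scoped Pointwise in
lemma volume_gaugeDisc_mul (w : Cn n) (r : ℝ) {t : ℝ} (ht : 0 < t) :
    volume (gaugeDisc w (t * r)) = ENNReal.ofReal (t ^ (2 * n)) * volume (gaugeDisc w r) := by
  have : gaugeDisc w (t * r) = t • gaugeDisc w r := by
    ext x
    rw [Set.mem_smul_set_iff_inv_smul_mem₀ ht.ne']
    have h : t⁻¹ • x = ((t⁻¹ : ℝ) : ℂ) • x := rfl
    simp only [gaugeDisc, Set.mem_ofPred_eq]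
    rw [h, bergmanGauge_smul, Complex.norm_real, norm_inv, Real.norm_of_nonneg ht.le,
      inv_mul_lt_iff₀ ht]
  rw [this, Measure.addHaar_smul, finrank_real_Cn, abs_of_pos (by positivity)]

/-- Quantities comparable up to a factor two have comparable powers, of either sign. -/
lemma rpow_le_two_rpow_abs_mul {x y : ℝ} (α : ℝ) (hx : 0 < x) (hy : 0 < y) (h1 : x ≤ 2 * y)
    (h2 : y ≤ 2 * x) : x ^ α ≤ 2 ^ |α| * y ^ α := by
  have hq : 0 < x / y := by positivity
  have h3 : (x / y) ^ α ≤ 2 ^ |α| := by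
    rcases le_total 0 α with h | h
    · rw [abs_of_nonneg h]
      exact Real.rpow_le_rpow hq.le (by rw [div_le_iff₀ hy]; linarith) h
    · have h4 : (2 : ℝ) ^ (-α) = (2⁻¹) ^ α := by
        rw [Real.rpow_neg (by norm_num), Real.inv_rpow (by norm_num)]
      rw [abs_of_nonpos h, h4]
      exact Real.rpow_le_rpow_of_nonpos (by norm_num)
        (by rw [le_div_iff₀ hy]; linarith) h
  rw [Real.div_rpow hx.le hy.le, div_le_iff₀ (by positivity)] at h3
  exact h3

lemma setLIntegral_vMeasure {A : Set (Cn n)} (hA : MeasurableSet A)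
    (hAb : A ⊆ Metric.ball (0 : Cn n) 1) (f : Cn n → ℝ≥0∞) :
    ∫⁻ z in A, f z ∂(vMeasure n α) = normConst n α *
      ∫⁻ z in A, ENNReal.ofReal (defect z ^ α) * f z := by
  rw [← lintegral_indicator hA, lintegral_vMeasure, ← lintegral_indicator hA,
    ← lintegral_indicator Metric.isOpen_ball.measurableSet]
  congr 1
  refine lintegral_congr fun z => ?_
  by_cases hz : z ∈ A
  · simp [hz, hAb hz, -Metric.mem_ball]
  · simp [hz]

/-- On a small gauge ball the measure `v_α` is comparable with a multiple of Lebesgue measure. -/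
lemma setLIntegral_gaugeBall_le {w : Cn n} {r : ℝ} (hw : ‖w‖ < 1) (hr : r ≤ 1 / 8)
    (f : Cn n → ℝ≥0∞) :
    ∫⁻ z in gaugeBall w r, f z ∂(vMeasure n α) ≤
      normConst n α * (ENNReal.ofReal (2 ^ |α| * defect w ^ α) * ∫⁻ z in gaugeBall w r, f z) := by
  have hd := defect_pos hw
  rw [setLIntegral_vMeasure (measurableSet_gaugeBall w r)
    (fun z hz => by simpa using norm_lt_one_of_mem_gaugeBall hw hr hz),
    ← lintegral_const_mul' _ _ ENNReal.ofReal_ne_top]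
  gcongr 1
  refine setLIntegral_mono' (measurableSet_gaugeBall w r) fun z hz => ?_
  obtain ⟨h1, h2⟩ := defect_bounds_of_mem_gaugeBall hw hr hz
  gcongr
  exact rpow_le_two_rpow_abs_mul α (by linarith) hd h2 (by linarith)

lemma le_setLIntegral_gaugeBall {w : Cn n} {r : ℝ} (hw : ‖w‖ < 1) (hr : r ≤ 1 / 8)
    (f : Cn n → ℝ≥0∞) :
    normConst n α * (ENNReal.ofReal (defect w ^ α) * ∫⁻ z in gaugeBall w r, f z) ≤
      ENNReal.ofReal (2 ^ |α|) * ∫⁻ z in gaugeBall w r, f z ∂(vMeasure n α) := by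
  have hd := defect_pos hw
  rw [setLIntegral_vMeasure (measurableSet_gaugeBall w r)
    (fun z hz => by simpa using norm_lt_one_of_mem_gaugeBall hw hr hz),
    mul_left_comm (ENNReal.ofReal (2 ^ |α|)),
    ← lintegral_const_mul' _ _ ENNReal.ofReal_ne_top,
    ← lintegral_const_mul' _ _ ENNReal.ofReal_ne_top]
  gcongr 1
  refine setLIntegral_mono' (measurableSet_gaugeBall w r) fun z hz => ?_
  obtain ⟨h1, h2⟩ := defect_bounds_of_mem_gaugeBall hw hr hz
  rw [← mul_assoc, ← ENNReal.ofReal_mul (by positivity)]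
  gcongr
  exact rpow_le_two_rpow_abs_mul α hd (by linarith) (by linarith) h2

lemma vMeasure_gaugeBall_le {w : Cn n} {r : ℝ} (hw : ‖w‖ < 1) (hr : r ≤ 1 / 8) :
    vMeasure n α (gaugeBall w r) ≤
      normConst n α * (ENNReal.ofReal (2 ^ |α| * defect w ^ α) * volume (gaugeBall w r)) := by
  simpa using setLIntegral_gaugeBall_le (α := α) hw hr 1

lemma le_vMeasure_gaugeBall {w : Cn n} {r : ℝ} (hw : ‖w‖ < 1) (hr : r ≤ 1 / 8) :
    normConst n α * (ENNReal.ofReal (defect w ^ α) * volume (gaugeBall w r)) ≤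
      ENNReal.ofReal (2 ^ |α|) * vMeasure n α (gaugeBall w r) := by
  simpa using le_setLIntegral_gaugeBall (α := α) hw hr 1

/-- The doubling property of `v_α` on small gauge balls. -/
lemma vMeasure_gaugeBall_mul_le {w : Cn n} {r t : ℝ} (hw : ‖w‖ < 1) (hr : 0 < r) (ht : 1 ≤ t)
    (htr : t * r ≤ 1 / 8) :
    vMeasure n α (gaugeBall w (t * r)) ≤
      ENNReal.ofReal (4 ^ |α| * t ^ (2 * n)) * vMeasure n α (gaugeBall w r) := by
  have hd := defect_pos hw
  have hr' : r ≤ 1 / 8 := by nlinarith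
  calc vMeasure n α (gaugeBall w (t * r))
      ≤ normConst n α * (ENNReal.ofReal (2 ^ |α| * defect w ^ α) *
          volume (gaugeBall w (t * r))) := vMeasure_gaugeBall_le hw htr
    _ = ENNReal.ofReal (2 ^ |α| * t ^ (2 * n)) * (normConst n α *
          (ENNReal.ofReal (defect w ^ α) * volume (gaugeBall w r))) := by
        rw [volume_gaugeBall, volume_gaugeDisc_mul _ _ (by linarith), ← volume_gaugeBall,
          ENNReal.ofReal_mul (by positivity), ENNReal.ofReal_mul (by positivity)]
        ring
    _ ≤ ENNReal.ofReal (2 ^ |α| * t ^ (2 * n)) * (ENNReal.ofReal (2 ^ |α|) *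
          vMeasure n α (gaugeBall w r)) := by
        gcongr _ * ?_; exact le_vMeasure_gaugeBall hw hr'
    _ = _ := by
        rw [← mul_assoc, ← ENNReal.ofReal_mul (by positivity)]
        congr 2
        rw [show (4 : ℝ) = 2 * 2 by norm_num, Real.mul_rpow (by norm_num) (by norm_num)]
        ring

lemma vMeasure_gaugeBall_pos (hα : -1 < α) {w : Cn n} {r : ℝ} (hw : ‖w‖ < 1) (hr : 0 < r)
    (hr' : r ≤ 1 / 8) : 0 < vMeasure n α (gaugeBall w r) := by
  have hd := defect_pos hw
  have h := le_vMeasure_gaugeBall (α := α) hw hr'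
  rw [pos_iff_ne_zero]
  intro h0
  rw [h0, mul_zero, nonpos_iff_eq_zero] at h
  have hv : volume (gaugeBall w r) ≠ 0 :=
    ((isOpen_gaugeBall w r).measure_pos volume ⟨w, self_mem_gaugeBall w hr⟩).ne'
  have hd' : ENNReal.ofReal (defect w ^ α) ≠ 0 := (ENNReal.ofReal_pos.2 (by positivity)).ne'
  exact mul_ne_zero (normConst_ne_zero hα) (mul_ne_zero hd' hv) h

/-! ### Mean values and oscillation of holomorphic functions -/

/-- Mean value inequality over a balanced open set: average the one-variable mean value property
over all complex lines through the centre. -/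
lemma enorm_mul_volume_le_lintegral {f : Cn n → ℂ} {y : Cn n} {U : Set (Cn n)} (hU : IsOpen U)
    (hbal : ∀ x ∈ U, ∀ c : ℂ, ‖c‖ ≤ 1 → c • x ∈ U)
    (hf : DifferentiableOn ℂ f ((fun x => y + x) '' U)) :
    ‖f y‖ₑ * volume U ≤ ∫⁻ x in U, ‖f (y + x)‖ₑ := by
  set g : Cn n → ℝ≥0∞ := U.indicator fun x => ‖f (y + x)‖ₑ with hg
  have hfU : DifferentiableOn ℂ (fun x => f (y + x)) U :=
    hf.comp (by fun_prop) (fun x hx => ⟨x, hx, rfl⟩)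
  have hgm : Measurable g := by
    classical
    rw [hg, ← Set.piecewise_eq_indicator]
    exact ContinuousOn.measurable_piecewise (hfU.continuousOn.enorm) continuousOn_const
      hU.measurableSet
  have hrot : ∀ θ : ℝ, ∫⁻ x, g (circleMap 0 1 θ • x) = ∫⁻ x, g x := by
    intro θ
    have hn : ‖circleMap 0 1 θ‖ = 1 := by simp
    have hne : circleMap 0 1 θ ≠ 0 := by rw [← norm_ne_zero_iff, hn]; exact one_ne_zero
    let e : Cn n ≃ₗᵢ[ℝ] Cn n :=
      { (LinearEquiv.smulOfNeZero ℂ (Cn n) _ hne).restrictScalars ℝ with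
        norm_map' := fun x => by
          change ‖circleMap 0 1 θ • x‖ = ‖x‖
          rw [norm_smul, hn, one_mul] }
    exact e.measurePreserving.lintegral_comp hgm
  have hpt : ∀ x ∈ U, ‖f y‖ₑ ≤ ENNReal.ofReal (2 * Real.pi)⁻¹ *
      ∫⁻ θ in Set.Ioc 0 (2 * Real.pi), g (circleMap 0 1 θ • x) := by
    intro x hx
    have hd : DifferentiableOn ℂ (fun c : ℂ => f (y + c • x)) (Metric.closedBall 0 1) := by
      refine hfU.comp (g := fun x => f (y + x)) (f := fun c : ℂ => c • x) (by fun_prop)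
        fun c hc => hbal x hx c ?_
      simpa using hc
    have havg := (hd.diffContOnCl_ball (c := (0 : ℂ)) (R := |1|) (by simp)).circleAverage
    simp only [zero_smul, add_zero] at havg
    rw [← havg, Real.circleAverage_def, enorm_smul, intervalIntegral.integral_of_le
      (by positivity), ← ofReal_norm (2 * Real.pi)⁻¹,
      Real.norm_of_nonneg (by positivity)]
    gcongr
    refine (enorm_integral_le_lintegral_enorm _).trans (lintegral_mono fun θ => ?_)
    have : circleMap 0 1 θ • x ∈ U := hbal x hx _ (by simp)
    rw [hg, Set.indicator_of_mem this]
  have hswap : ∫⁻ x, ∫⁻ θ in Set.Ioc 0 (2 * Real.pi), g (circleMap 0 1 θ • x) =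
      ∫⁻ θ in Set.Ioc 0 (2 * Real.pi), ∫⁻ x, g (circleMap 0 1 θ • x) := by
    refine lintegral_lintegral_swap (Measurable.aemeasurable ?_)
    refine hgm.comp ?_
    exact (((continuous_circleMap 0 1).comp continuous_snd).smul continuous_fst).measurable
  calc ‖f y‖ₑ * volume U = ∫⁻ _ in U, ‖f y‖ₑ := by rw [setLIntegral_const]
    _ ≤ ∫⁻ x in U, ENNReal.ofReal (2 * Real.pi)⁻¹ *
          ∫⁻ θ in Set.Ioc 0 (2 * Real.pi), g (circleMap 0 1 θ • x) :=
        setLIntegral_mono' hU.measurableSet hpt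
    _ ≤ ∫⁻ x, ENNReal.ofReal (2 * Real.pi)⁻¹ *
          ∫⁻ θ in Set.Ioc 0 (2 * Real.pi), g (circleMap 0 1 θ • x) :=
        setLIntegral_le_lintegral _ _
    _ = ENNReal.ofReal (2 * Real.pi)⁻¹ * (ENNReal.ofReal (2 * Real.pi) * ∫⁻ x, g x) := by
        rw [lintegral_const_mul' _ _ ENNReal.ofReal_ne_top, hswap]
        simp only [hrot]
        rw [setLIntegral_const, Real.volume_Ioc, sub_zero, mul_comm (∫⁻ x, g x)]
    _ = ∫⁻ x in U, ‖f (y + x)‖ₑ := by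
        rw [← mul_assoc, ← ENNReal.ofReal_mul (by positivity),
          inv_mul_cancel₀ (by positivity), ENNReal.ofReal_one, one_mul, hg,
          lintegral_indicator hU.measurableSet]

/-- The average of `|f|` over a gauge ball with respect to `v_α`. -/
def gaugeAverage (α r : ℝ) (f : Cn n → ℂ) (w : Cn n) : ℝ≥0∞ :=
  (vMeasure n α (gaugeBall w r))⁻¹ * ∫⁻ z in gaugeBall w r, ‖f z‖ₑ ∂(vMeasure n α)

/-- Holomorphic functions are bounded by their averages over gauge balls. -/
lemma enorm_le_gaugeAverage (hα : -1 < α) {f : Cn n → ℂ}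
    (hf : DifferentiableOn ℂ f (Metric.ball 0 1)) {w y : Cn n} {r : ℝ} (hw : ‖w‖ < 1)
    (hr : 0 < r) (hr' : r ≤ 1 / 8) (hy : y ∈ gaugeBall w (r / 2)) :
    ‖f y‖ₑ ≤ ENNReal.ofReal (4 ^ |α| * 2 ^ (2 * n)) * gaugeAverage α r f w := by
  have := isProbabilityMeasure_vMeasure (n := n) hα
  have hd := defect_pos hw
  have hsub : (fun x => y + x) '' gaugeDisc w (r / 2) ⊆ gaugeBall w r := by
    rintro _ ⟨x, hx, rfl⟩
    have h1 := bergmanGauge_add_le hw (y - w) x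
    have h2 : bergmanGauge w x < r / 2 := hx
    have h3 := mem_gaugeBall.1 hy
    rw [mem_gaugeBall, show y + x - w = (y - w) + x by abel]
    linarith
  have hball : gaugeBall w r ⊆ Metric.ball 0 1 := fun z hz => by
    simpa using norm_lt_one_of_mem_gaugeBall hw hr' hz
  have hmean := enorm_mul_volume_le_lintegral (f := f) (y := y) (isOpen_gaugeDisc w (r / 2))
    (fun x hx c hc => by
      have h2 : bergmanGauge w x < r / 2 := hx
      have h0 := bergmanGauge_nonneg hw x
      change bergmanGauge w (c • x) < r / 2
      rw [bergmanGauge_smul]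
      nlinarith) (hf.mono (hsub.trans hball))
  have htrans : ∫⁻ x in gaugeDisc w (r / 2), ‖f (y + x)‖ₑ ≤ ∫⁻ z in gaugeBall w r, ‖f z‖ₑ := by
    rw [← lintegral_indicator (isOpen_gaugeDisc w (r / 2)).measurableSet,
      ← lintegral_indicator (measurableSet_gaugeBall w r),
      ← lintegral_add_left_eq_self ((gaugeBall w r).indicator _) y]
    refine lintegral_mono fun x => ?_
    by_cases hx : x ∈ gaugeDisc w (r / 2)
    · rw [Set.indicator_of_mem hx, Set.indicator_of_mem (hsub ⟨x, hx, rfl⟩)]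
    · simp [hx]
  have hvol : volume (gaugeBall w r) =
      ENNReal.ofReal (2 ^ (2 * n)) * volume (gaugeDisc w (r / 2)) := by
    rw [volume_gaugeBall, ← volume_gaugeDisc_mul _ _ two_pos, mul_div_cancel₀ _ two_ne_zero]
  have hmain : ‖f y‖ₑ * vMeasure n α (gaugeBall w r) ≤
      ENNReal.ofReal (4 ^ |α| * 2 ^ (2 * n)) *
        ∫⁻ z in gaugeBall w r, ‖f z‖ₑ ∂(vMeasure n α) := by
    calc ‖f y‖ₑ * vMeasure n α (gaugeBall w r)
        ≤ ‖f y‖ₑ * (normConst n α * (ENNReal.ofReal (2 ^ |α| * defect w ^ α) *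
          (ENNReal.ofReal (2 ^ (2 * n)) * volume (gaugeDisc w (r / 2))))) := by
          rw [← hvol]; gcongr; exact vMeasure_gaugeBall_le hw hr'
      _ = ENNReal.ofReal (2 ^ |α| * 2 ^ (2 * n)) * (normConst n α *
          (ENNReal.ofReal (defect w ^ α) * (‖f y‖ₑ * volume (gaugeDisc w (r / 2))))) := by
          rw [ENNReal.ofReal_mul (by positivity), ENNReal.ofReal_mul (by positivity)]; ring
      _ ≤ ENNReal.ofReal (2 ^ |α| * 2 ^ (2 * n)) * (ENNReal.ofReal (2 ^ |α|) *
          ∫⁻ z in gaugeBall w r, ‖f z‖ₑ ∂(vMeasure n α)) := by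
          gcongr _ * ?_
          refine le_trans ?_ (le_setLIntegral_gaugeBall hw hr' _)
          gcongr
          exact hmean.trans htrans
      _ = _ := by
          rw [← mul_assoc, ← ENNReal.ofReal_mul (by positivity)]
          congr 2
          rw [show (4 : ℝ) = 2 * 2 by norm_num, Real.mul_rpow (by norm_num) (by norm_num)]
          ring
  have hpos := vMeasure_gaugeBall_pos hα hw hr hr'
  rw [gaugeAverage, mul_left_comm, mul_comm _⁻¹, ← div_eq_mul_inv,
    ENNReal.le_div_iff_mul_le (Or.inl hpos.ne') (Or.inl (measure_ne_top _ _))]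
  exact hmain

/-- The Schwarz lemma on complex lines turns the mean value bound into an oscillation bound. -/
lemma enorm_sub_le_gaugeAverage (hα : -1 < α) {f : Cn n → ℂ}
    (hf : DifferentiableOn ℂ f (Metric.ball 0 1)) {w z : Cn n} {r : ℝ} (hw : ‖w‖ < 1)
    (hr : 0 < r) (hr' : r ≤ 1 / 8) (hz : z ∈ gaugeBall w (r / 2))
    (hfin : gaugeAverage α r f w ≠ ⊤) :
    ‖f z - f w‖ₑ ≤ ENNReal.ofReal (4 / r * (4 ^ |α| * 2 ^ (2 * n)) * bergmanGauge w (z - w)) *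
      gaugeAverage α r f w := by
  set K : ℝ := 4 ^ |α| * 2 ^ (2 * n) with hK
  have hKpos : 0 < K := by positivity
  set t := bergmanGauge w (z - w) with ht
  have ht0 : 0 ≤ t := bergmanGauge_nonneg hw _
  have htr : t < r / 2 := hz
  set M := (gaugeAverage α r f w).toReal with hM
  have hM0 : 0 ≤ M := ENNReal.toReal_nonneg
  have hbound : ∀ y ∈ gaugeBall w (r / 2), ‖f y‖ ≤ K * M := fun y hy => by
    have h := enorm_le_gaugeAverage hα hf hw hr hr' hy
    rw [← ENNReal.ofReal_toReal hfin, ← ENNReal.ofReal_mul hKpos.le, ← ofReal_norm] at h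
    exact (ENNReal.ofReal_le_ofReal_iff (by positivity)).1 h
  rw [← ENNReal.ofReal_toReal hfin, ← ENNReal.ofReal_mul (by positivity), ← ofReal_norm]
  apply ENNReal.ofReal_le_ofReal
  -- For `z ≠ w` rescale the line through `w` and `z` so that the unit disc maps into the gauge ball
  -- of radius `r / 2`; then `z` is the image of the parameter `t / (r / 2)`.
  rcases ht0.eq_or_lt with h0 | hpos
  · have : ‖z - w‖ ≤ 0 := by
      have := norm_le_bergmanGauge hw (z - w)
      rwa [← ht, ← h0, mul_zero] at this
    have : z = w := sub_eq_zero.1 (norm_le_zero_iff.1 this)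
    rw [this, sub_self, norm_zero]; positivity
  · set q : ℂ := ((r / 2 / t : ℝ) : ℂ) with hq
    have hqn : ‖q‖ = r / 2 / t := by
      rw [hq, Complex.norm_real, Real.norm_of_nonneg (by positivity)]
    have hmem : ∀ c : ℂ, c ∈ Metric.ball (0 : ℂ) 1 →
        w + c • q • (z - w) ∈ gaugeBall w (r / 2) := fun c hc => by
      rw [mem_gaugeBall, add_sub_cancel_left, bergmanGauge_smul, bergmanGauge_smul, hqn, ← ht,
        div_mul_cancel₀ _ hpos.ne']
      have : ‖c‖ < 1 := by simpa using hc
      nlinarith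
    have hdiff : DifferentiableOn ℂ (fun c : ℂ => f (w + c • q • (z - w)))
        (Metric.ball (0 : ℂ) 1) := by
      refine hf.comp (by fun_prop) fun c hc => ?_
      have := norm_lt_one_of_mem_gaugeBall hw (by linarith) (hmem c hc)
      simpa using this
    have hs := Complex.dist_le_div_mul_dist_of_mapsTo_ball (R₂ := 2 * (K * M))
      (z := ((t / (r / 2) : ℝ) : ℂ)) hdiff (fun c hc => by
        have h1 := hbound _ (hmem c hc)
        have h2 := hbound _ (hmem 0 (by simp))
        rw [Metric.mem_closedBall, dist_eq_norm]
        exact (norm_sub_le _ _).trans (by linarith)) (by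
        rw [mem_ball_zero_iff, Complex.norm_real, Real.norm_of_nonneg (by positivity),
          div_lt_one (by positivity)]
        exact htr)
    have hz' : w + ((t / (r / 2) : ℝ) : ℂ) • q • (z - w) = z := by
      rw [smul_smul, hq, ← Complex.ofReal_mul, div_mul_div_cancel₀ (by positivity),
        div_self hpos.ne', Complex.ofReal_one, one_smul, add_sub_cancel]
    simp only [hz', zero_smul, add_zero, dist_zero_right, Complex.norm_real] at hs
    rw [Real.norm_of_nonneg (by positivity), dist_eq_norm] at hs
    refine hs.trans (le_of_eq ?_)
    field_simp
    ring

/-! ### Averaging over gauge balls -/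

lemma gauge_sub_comm_le {w z : Cn n} {r : ℝ} (hw : ‖w‖ < 1) (hr : r ≤ 1 / 8)
    (hz : z ∈ gaugeBall w r) (y : Cn n) : bergmanGauge z y ≤ 2 * bergmanGauge w y := by
  have := bergmanGauge_add_le_two_mul hw ((mem_gaugeBall.1 hz).le.trans hr) y
  simpa using this

lemma gauge_le_of_mem_gaugeBall {w z : Cn n} {r : ℝ} (hw : ‖w‖ < 1) (hr : r ≤ 1 / 16)
    (hz : z ∈ gaugeBall w r) (y : Cn n) : bergmanGauge w y ≤ 2 * bergmanGauge z y := by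
  have := bergmanGauge_le_two_mul_add hw ((mem_gaugeBall.1 hz).le.trans hr) y
  simpa using this

/-- Engulfing: two gauge balls of comparable radii that meet have comparable measures. -/
lemma vMeasure_gaugeBall_le_of_mem {w z : Cn n} {r : ℝ} (hw : ‖w‖ < 1) (hr0 : 0 < r)
    (hr : r ≤ 1 / 40) (hz : z ∈ gaugeBall w r) :
    vMeasure n α (gaugeBall z (2 * r)) ≤
      ENNReal.ofReal (4 ^ |α| * 10 ^ (2 * n)) * vMeasure n α (gaugeBall w (r / 2)) := by
  refine (measure_mono fun y hy => ?_).trans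
    (vMeasure_gaugeBall_mul_le hw (by linarith) (by norm_num : (1 : ℝ) ≤ 10) (by linarith))
  have h1 := bergmanGauge_add_le hw (y - z) (z - w)
  have h2 := gauge_le_of_mem_gaugeBall hw (by linarith) hz (y - z)
  have h3 := mem_gaugeBall.1 hy
  have h4 := mem_gaugeBall.1 hz
  rw [sub_add_sub_cancel] at h1
  rw [mem_gaugeBall]; linarith

lemma measurableSet_gaugeBall_prod (r : ℝ) :
    MeasurableSet {q : Cn n × Cn n | q.2 ∈ gaugeBall q.1 r} := by
  have h : Measurable fun q : Cn n × Cn n => (q.1, q.2 - q.1) := by fun_prop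
  have h' := (measurable_bergmanGauge (n := n)).comp h
  exact measurableSet_lt h' measurable_const

lemma measurable_vMeasure_gaugeBall (hα : -1 < α) (r : ℝ) :
    Measurable fun w : Cn n => vMeasure n α (gaugeBall w r) := by
  have := isProbabilityMeasure_vMeasure (n := n) hα
  exact measurable_measure_prodMk_left (measurableSet_gaugeBall_prod r)

/-- The reciprocal masses of the gauge balls containing `z`, integrated over their centres, are
bounded independently of `z` and of the radius; this is dual to averaging over gauge balls. -/
lemma lintegral_inv_vMeasure_gaugeBall_le (hα : -1 < α) {z : Cn n} (hz : ‖z‖ < 1) {r : ℝ}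
    (hr0 : 0 < r) (hr : r ≤ 1 / 40) :
    ∫⁻ w, {w | z ∈ gaugeBall w r}.indicator
      (fun w => (vMeasure n α (gaugeBall w (r / 2)))⁻¹) w ∂(vMeasure n α) ≤
        ENNReal.ofReal (4 ^ |α| * 10 ^ (2 * n)) := by
  have := isProbabilityMeasure_vMeasure (n := n) hα
  set D := ENNReal.ofReal (4 ^ |α| * 10 ^ (2 * n)) with hD
  have hA := vMeasure_gaugeBall_pos hα hz (by linarith : 0 < 2 * r) (by linarith)
  have hle : ∀ᵐ w ∂(vMeasure n α), {w | z ∈ gaugeBall w r}.indicator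
      (fun w => (vMeasure n α (gaugeBall w (r / 2)))⁻¹) w ≤
      (gaugeBall z (2 * r)).indicator
        (fun _ => D * (vMeasure n α (gaugeBall z (2 * r)))⁻¹) w := by
    filter_upwards [ae_norm_lt_one] with w hw
    by_cases h : z ∈ gaugeBall w r
    · have hwz : w ∈ gaugeBall z (2 * r) := by
        have h1 := gauge_sub_comm_le hw (by linarith) h (z - w)
        have h2 := mem_gaugeBall.1 h
        rw [mem_gaugeBall, bergmanGauge_sub_comm]; linarith
      have hB := vMeasure_gaugeBall_pos hα hw (by linarith : 0 < r / 2) (by linarith)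
      rw [Set.indicator_of_mem (show w ∈ {w | z ∈ gaugeBall w r} from h),
        Set.indicator_of_mem hwz, ← div_eq_mul_inv D,
        ENNReal.le_div_iff_mul_le (Or.inl hA.ne') (Or.inl (measure_ne_top _ _)),
        mul_comm, ← div_eq_mul_inv]
      exact ENNReal.div_le_of_le_mul (vMeasure_gaugeBall_le_of_mem hw hr0 hr h)
    · rw [Set.indicator_of_notMem (show w ∉ {w | z ∈ gaugeBall w r} from h)]
      exact zero_le
  refine (lintegral_mono_ae hle).trans ?_
  rw [lintegral_indicator (measurableSet_gaugeBall _ _), setLIntegral_const, mul_assoc,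
    ENNReal.inv_mul_cancel hA.ne' (measure_ne_top _ _), mul_one]

/-! ### Smoothing kernels -/

/-- A bump function of `z`, Lipschitz for the gauge at `w` and supported in the gauge ball of radius
`r` at `w`. -/
def bump (r : ℝ) (z w : Cn n) : ℝ := max 0 (1 - bergmanGauge w (z - w) / r)

/-- The `v_α`-integral of the bump at `w`. -/
def bumpMass (α r : ℝ) (w : Cn n) : ℝ := ∫ z, bump r z w ∂(vMeasure n α)

/-- The bump functions, normalized to have integral one in the first variable. -/
def smoothingKernel (α r : ℝ) (z w : Cn n) : ℝ := bump r z w / bumpMass α r w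

/-- The average of the symbol `φ` at scale `r` of the Bergman metric. -/
def smoothing (α r : ℝ) (φ : Cn n → ℂ) (z : Cn n) : ℂ :=
  ∫ w, φ w * (smoothingKernel α r z w : ℂ) ∂(vMeasure n α)

lemma bump_nonneg (r : ℝ) (z w : Cn n) : 0 ≤ bump r z w := le_max_left _ _

lemma bump_le_one {r : ℝ} (hr : 0 < r) (z : Cn n) {w : Cn n} (hw : ‖w‖ < 1) : bump r z w ≤ 1 := by
  have := bergmanGauge_nonneg hw (z - w)
  exact max_le zero_le_one (by have : 0 ≤ bergmanGauge w (z - w) / r := by positivity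
                               linarith)

lemma bump_eq_zero {r : ℝ} (hr : 0 < r) {z w : Cn n} (h : z ∉ gaugeBall w r) : bump r z w = 0 := by
  rw [mem_gaugeBall, not_lt] at h
  refine max_eq_left ?_
  have : 1 ≤ bergmanGauge w (z - w) / r := by rwa [le_div_iff₀ hr, one_mul]
  linarith

lemma half_le_bump {r : ℝ} (hr : 0 < r) {z w : Cn n} (h : z ∈ gaugeBall w (r / 2)) :
    1 / 2 ≤ bump r z w := by
  rw [mem_gaugeBall] at h
  refine le_max_of_le_right ?_
  have : bergmanGauge w (z - w) / r ≤ 1 / 2 := by rw [div_le_iff₀ hr]; linarith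
  linarith

lemma abs_bump_sub_le {r : ℝ} (hr : 0 < r) {w : Cn n} (hw : ‖w‖ < 1) (z z' : Cn n) :
    |bump r z w - bump r z' w| ≤ bergmanGauge w (z - z') / r := by
  have h1 := bergmanGauge_add_le hw (z - z') (z' - w)
  have h2 := bergmanGauge_add_le hw (z' - z) (z - w)
  rw [sub_add_sub_cancel] at h1 h2
  rw [bergmanGauge_sub_comm w z' z] at h2
  unfold bump
  rw [max_comm 0, max_comm 0]
  refine (abs_max_sub_max_le_abs _ _ 0).trans ?_
  rw [show 1 - bergmanGauge w (z - w) / r - (1 - bergmanGauge w (z' - w) / r) =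
    (bergmanGauge w (z' - w) - bergmanGauge w (z - w)) / r by ring, abs_div, abs_of_pos hr]
  gcongr
  exact abs_le.2 ⟨by linarith, by linarith⟩

lemma measurable_bump (r : ℝ) : Measurable fun q : Cn n × Cn n => bump r q.1 q.2 := by
  have h : Measurable fun q : Cn n × Cn n => (q.2, q.1 - q.2) := by fun_prop
  have h' := (measurable_bergmanGauge (n := n)).comp h
  exact measurable_const.max (measurable_const.sub (h'.div_const r))

lemma measurable_bump_left (r : ℝ) (w : Cn n) : Measurable fun z : Cn n => bump r z w := by
  have h := (measurable_bump (n := n) r).comp (measurable_prodMk_right (y := w))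
  exact h

lemma integrable_bump (hα : -1 < α) {r : ℝ} (hr : 0 < r) {w : Cn n} (hw : ‖w‖ < 1) :
    Integrable (fun z : Cn n => bump r z w) (vMeasure n α) := by
  have := isProbabilityMeasure_vMeasure (n := n) hα
  refine Integrable.of_bound (measurable_bump_left r w).aestronglyMeasurable 1
    (Filter.Eventually.of_forall fun z => ?_)
  rw [Real.norm_of_nonneg (bump_nonneg r z w)]
  exact bump_le_one hr z hw

lemma vMeasure_gaugeBall_le_bumpMass (hα : -1 < α) {r : ℝ} (hr : 0 < r) {w : Cn n}
    (hw : ‖w‖ < 1) :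
    vMeasure n α (gaugeBall w (r / 2)) ≤ 2 * ENNReal.ofReal (bumpMass α r w) := by
  rw [bumpMass, ofReal_integral_eq_lintegral_ofReal (integrable_bump hα hr hw)
    (Filter.Eventually.of_forall fun z => bump_nonneg r z w),
    ← lintegral_const_mul' _ _ (by simp), ← setLIntegral_one]
  refine le_trans ?_ (setLIntegral_le_lintegral (gaugeBall w (r / 2)) _)
  refine setLIntegral_mono' (measurableSet_gaugeBall _ _) fun z hz => ?_
  rw [← ENNReal.ofReal_ofNat 2, ← ENNReal.ofReal_mul (by norm_num), ← ENNReal.ofReal_one]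
  exact ENNReal.ofReal_le_ofReal (by linarith [half_le_bump hr hz])

lemma bumpMass_pos (hα : -1 < α) {r : ℝ} (hr : 0 < r) (hr' : r ≤ 1 / 8) {w : Cn n}
    (hw : ‖w‖ < 1) : 0 < bumpMass α r w := by
  have h1 := vMeasure_gaugeBall_pos hα hw (by linarith : 0 < r / 2) (by linarith)
  have h2 := h1.trans_le (vMeasure_gaugeBall_le_bumpMass hα hr hw)
  by_contra h
  rw [ENNReal.ofReal_of_nonpos (not_lt.1 h), mul_zero] at h2
  exact lt_irrefl _ h2

lemma measurable_bumpMass (hα : -1 < α) (r : ℝ) :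
    Measurable (bumpMass α r : Cn n → ℝ) := by
  have := isProbabilityMeasure_vMeasure (n := n) hα
  exact ((measurable_bump r).stronglyMeasurable.integral_prod_left').measurable

lemma measurable_smoothingKernel (hα : -1 < α) (r : ℝ) :
    Measurable fun q : Cn n × Cn n => smoothingKernel α r q.1 q.2 :=
  (measurable_bump r).div ((measurable_bumpMass hα r).comp measurable_snd)

lemma smoothingKernel_nonneg (α r : ℝ) (z w : Cn n) : 0 ≤ smoothingKernel α r z w :=
  div_nonneg (bump_nonneg r z w) (integral_nonneg fun z => bump_nonneg r z w)

lemma integral_smoothingKernel (hα : -1 < α) {r : ℝ} (hr : 0 < r) (hr' : r ≤ 1 / 8) {w : Cn n}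
    (hw : ‖w‖ < 1) : ∫ z, smoothingKernel α r z w ∂(vMeasure n α) = 1 := by
  unfold smoothingKernel
  rw [integral_div]
  exact div_self (bumpMass_pos hα hr hr' hw).ne'

/-- A bump is at least `1 / 2` on the gauge ball of half its radius. -/
lemma inv_bumpMass_le (hα : -1 < α) {r : ℝ} (hr : 0 < r) (hr' : r ≤ 1 / 8) {w : Cn n}
    (hw : ‖w‖ < 1) :
    ENNReal.ofReal (bumpMass α r w)⁻¹ ≤ 2 * (vMeasure n α (gaugeBall w (r / 2)))⁻¹ := by
  have := isProbabilityMeasure_vMeasure (n := n) hα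
  have h1 := vMeasure_gaugeBall_pos hα hw (by linarith : 0 < r / 2) (by linarith)
  have hm := bumpMass_pos hα hr hr' hw
  rw [ENNReal.ofReal_inv_of_pos hm, ← div_eq_mul_inv,
    ENNReal.le_div_iff_mul_le (Or.inl h1.ne') (Or.inl (measure_ne_top _ _)), mul_comm,
    ← div_eq_mul_inv]
  exact ENNReal.div_le_of_le_mul (vMeasure_gaugeBall_le_bumpMass hα hr hw)

lemma ofReal_smoothingKernel_le (hα : -1 < α) {r : ℝ} (hr : 0 < r) (hr' : r ≤ 1 / 8) (z : Cn n)
    {w : Cn n} (hw : ‖w‖ < 1) :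
    ENNReal.ofReal (smoothingKernel α r z w) ≤ 2 * {w | z ∈ gaugeBall w r}.indicator
      (fun w => (vMeasure n α (gaugeBall w (r / 2)))⁻¹) w := by
  by_cases h : z ∈ gaugeBall w r
  · rw [Set.indicator_of_mem (show w ∈ {w | z ∈ gaugeBall w r} from h)]
    refine le_trans ?_ (inv_bumpMass_le hα hr hr' hw)
    rw [smoothingKernel, div_eq_mul_inv]
    refine ENNReal.ofReal_le_ofReal (mul_le_of_le_one_left ?_ (bump_le_one hr z hw))
    exact inv_nonneg.2 (bumpMass_pos hα hr hr' hw).le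
  · rw [smoothingKernel, bump_eq_zero hr h]; simp

lemma lintegral_smoothingKernel_le (hα : -1 < α) {r : ℝ} (hr : 0 < r) (hr' : r ≤ 1 / 40)
    {z : Cn n} (hz : ‖z‖ < 1) :
    ∫⁻ w, ENNReal.ofReal (smoothingKernel α r z w) ∂(vMeasure n α) ≤
      2 * ENNReal.ofReal (4 ^ |α| * 10 ^ (2 * n)) := by
  have hle : ∀ᵐ w ∂(vMeasure n α), ENNReal.ofReal (smoothingKernel α r z w) ≤
      2 * {w | z ∈ gaugeBall w r}.indicator
        (fun w => (vMeasure n α (gaugeBall w (r / 2)))⁻¹) w := by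
    filter_upwards [ae_norm_lt_one] with w hw
    exact ofReal_smoothingKernel_le hα hr (by linarith) z hw
  refine (lintegral_mono_ae hle).trans ?_
  rw [lintegral_const_mul' _ _ (by simp)]
  gcongr
  exact lintegral_inv_vMeasure_gaugeBall_le hα hz hr hr'

/-- The smoothing kernel is Lipschitz in the first variable for the pseudo-hyperbolic metric. -/
lemma abs_smoothingKernel_sub_le (hα : -1 < α) {r : ℝ} (hr : 0 < r) (hr' : r ≤ 1 / 40)
    {z z' w : Cn n} (hz : ‖z‖ < 1) (hz' : ‖z'‖ < 1) (hw : ‖w‖ < 1)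
    (hρ : pseudoHyp z z' ≤ 1 / 32) :
    ENNReal.ofReal |smoothingKernel α r z w - smoothingKernel α r z' w| ≤
      ENNReal.ofReal (32 * pseudoHyp z z' / r) *
        ({w | z ∈ gaugeBall w r}.indicator
          (fun w => (vMeasure n α (gaugeBall w (r / 2)))⁻¹) w +
        {w | z' ∈ gaugeBall w r}.indicator
          (fun w => (vMeasure n α (gaugeBall w (r / 2)))⁻¹) w) := by
  have hg := bergmanGauge_le_pseudoHyp hz hz' (hρ.trans (by norm_num))
  have hρ0 : 0 ≤ pseudoHyp z z' := norm_nonneg _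
  have hm := bumpMass_pos hα hr (by linarith) hw
  have key : z ∈ gaugeBall w r ∨ z' ∈ gaugeBall w r →
      ENNReal.ofReal |smoothingKernel α r z w - smoothingKernel α r z' w| ≤
      ENNReal.ofReal (32 * pseudoHyp z z' / r) * (vMeasure n α (gaugeBall w (r / 2)))⁻¹ := by
    intro h
    have h1 : bergmanGauge w (z - z') ≤ 16 * pseudoHyp z z' := by
      rcases h with h | h
      · have := gauge_le_of_mem_gaugeBall hw (by linarith) h (z - z')
        linarith
      · have h2 := gauge_le_of_mem_gaugeBall hw (by linarith) h (z - z')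
        have h3 := bergmanGauge_add_le_two_mul hz (x := z' - z)
          (by rw [bergmanGauge_sub_comm]; linarith) (z - z')
        rw [add_sub_cancel] at h3
        linarith
    have h2 : |smoothingKernel α r z w - smoothingKernel α r z' w| ≤
        (16 * pseudoHyp z z' / r) * (bumpMass α r w)⁻¹ := by
      rw [smoothingKernel, smoothingKernel, ← sub_div, abs_div, abs_of_pos hm, div_eq_mul_inv]
      gcongr
      exact (abs_bump_sub_le hr hw z z').trans (by gcongr)
    refine (ENNReal.ofReal_le_ofReal h2).trans ?_
    rw [ENNReal.ofReal_mul (by positivity)]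
    refine (mul_le_mul_right (inv_bumpMass_le hα hr (by linarith) hw) _).trans ?_
    rw [show 32 * pseudoHyp z z' / r = 16 * pseudoHyp z z' / r * 2 by ring,
      ENNReal.ofReal_mul (by positivity), ENNReal.ofReal_ofNat, mul_assoc]
  -- If neither point is in the gauge ball at `w`, both kernels vanish.
  by_cases h : z ∈ gaugeBall w r
  · refine (key (Or.inl h)).trans ?_
    gcongr
    rw [Set.indicator_of_mem (show w ∈ {w | z ∈ gaugeBall w r} from h)]
    exact le_self_add
  by_cases h' : z' ∈ gaugeBall w r
  · refine (key (Or.inr h')).trans ?_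
    gcongr
    rw [Set.indicator_of_mem (show w ∈ {w | z' ∈ gaugeBall w r} from h')]
    exact le_add_self
  · rw [smoothingKernel, smoothingKernel, bump_eq_zero hr h, bump_eq_zero hr h']; simp

lemma integrable_mul_smoothingKernel (hα : -1 < α) {r : ℝ} (hr : 0 < r) (hr' : r ≤ 1 / 40)
    {φ : Cn n → ℂ} (hφ : MemLp φ ∞ (vMeasure n α)) {z : Cn n} (hz : ‖z‖ < 1) :
    Integrable (fun w => φ w * (smoothingKernel α r z w : ℂ)) (vMeasure n α) := by
  have hH : Integrable (fun w => (smoothingKernel α r z w : ℂ)) (vMeasure n α) := by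
    have hm : Measurable fun w => smoothingKernel α r z w := by
      have h := (measurable_smoothingKernel (n := n) hα r).comp (measurable_prodMk_left (x := z))
      exact h
    have hi : HasFiniteIntegral (fun w => smoothingKernel α r z w) (vMeasure n α) := by
      rw [hasFiniteIntegral_iff_ofReal
        (Filter.Eventually.of_forall fun w => smoothingKernel_nonneg α r z w)]
      exact (lintegral_smoothingKernel_le hα hr hr' hz).trans_lt
        (ENNReal.mul_lt_top (by simp) ENNReal.ofReal_lt_top)
    have hi' : Integrable (fun w => smoothingKernel α r z w) (vMeasure n α) :=
      ⟨hm.aestronglyMeasurable, hi⟩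
    exact hi'.ofReal
  exact hH.mul_of_top_right hφ

/-- Smoothing a bounded symbol gives a function that is bounded and uniformly continuous for the
pseudo-hyperbolic metric. -/
lemma isBUC_smoothing (hα : -1 < α) {r : ℝ} (hr : 0 < r) (hr' : r ≤ 1 / 40)
    {φ : Cn n → ℂ} (hφ : MemLp φ ∞ (vMeasure n α)) : IsBUC (smoothing α r φ) := by
  set B := eLpNorm φ ∞ (vMeasure n α) with hB
  have hBtop : B ≠ ⊤ := hφ.2.ne
  have hφB : ∀ᵐ w ∂(vMeasure n α), ‖φ w‖ₑ ≤ B := by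
    rw [hB, eLpNorm_exponent_top]
    exact ae_le_eLpNormEssSup
  set D := ENNReal.ofReal (4 ^ |α| * 10 ^ (2 * n)) with hD
  have hDtop : D ≠ ⊤ := ENNReal.ofReal_ne_top
  constructor
  · refine ⟨(B * (2 * D)).toReal, fun z hz => ?_⟩
    rw [mem_ball_zero_iff] at hz
    have h : ‖smoothing α r φ z‖ₑ ≤ B * (2 * D) := by
      refine (enorm_integral_le_lintegral_enorm _).trans ?_
      calc _ ≤ ∫⁻ w, B * ENNReal.ofReal (smoothingKernel α r z w) ∂(vMeasure n α) := by
            refine lintegral_mono_ae ?_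
            filter_upwards [hφB] with w hw
            rw [enorm_mul, ← ofReal_norm (smoothingKernel α r z w : ℂ), Complex.norm_real,
              Real.norm_of_nonneg (smoothingKernel_nonneg α r z w)]
            gcongr
        _ ≤ _ := by
            rw [lintegral_const_mul' _ _ hBtop]
            gcongr
            exact lintegral_smoothingKernel_le hα hr hr' hz
    have htop : B * (2 * D) ≠ ⊤ := ENNReal.mul_ne_top hBtop (ENNReal.mul_ne_top (by simp) hDtop)
    rw [← toReal_enorm]
    exact ENNReal.toReal_mono htop h
  · intro ε hε
    set Q : ℝ := (B * (2 * D)).toReal with hQ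
    have hQ0 : 0 ≤ Q := ENNReal.toReal_nonneg
    have htop : B * (2 * D) ≠ ⊤ := ENNReal.mul_ne_top hBtop (ENNReal.mul_ne_top (by simp) hDtop)
    refine ⟨min (1 / 32) (ε * r / (32 * (Q + 1))), by positivity, fun z hz z' hz' hρ => ?_⟩
    rw [mem_ball_zero_iff] at hz hz'
    have hρ1 : pseudoHyp z z' ≤ 1 / 32 := hρ.le.trans (min_le_left _ _)
    have hρ2 : pseudoHyp z z' < ε * r / (32 * (Q + 1)) := hρ.trans_le (min_le_right _ _)
    have hρ0 : 0 ≤ pseudoHyp z z' := norm_nonneg _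
    have h : ‖smoothing α r φ z - smoothing α r φ z'‖ₑ ≤
        ENNReal.ofReal (32 * pseudoHyp z z' / r) * (B * (2 * D)) := by
      rw [smoothing, smoothing, ← integral_sub (integrable_mul_smoothingKernel hα hr hr' hφ hz)
        (integrable_mul_smoothingKernel hα hr hr' hφ hz')]
      refine (enorm_integral_le_lintegral_enorm _).trans ?_
      set I : Cn n → Cn n → ℝ≥0∞ := fun z w => {w | z ∈ gaugeBall w r}.indicator
        (fun w => (vMeasure n α (gaugeBall w (r / 2)))⁻¹) w with hI
      have hIm : ∀ z, Measurable (I z) := fun z =>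
        ((measurable_vMeasure_gaugeBall hα (r / 2)).inv).indicator
          (measurable_prodMk_right (measurableSet_gaugeBall_prod r))
      calc _ ≤ ∫⁻ w, B * (ENNReal.ofReal (32 * pseudoHyp z z' / r) *
              (I z w + I z' w)) ∂(vMeasure n α) := by
            refine lintegral_mono_ae ?_
            filter_upwards [hφB, ae_norm_lt_one] with w hw hw1
            rw [← mul_sub, enorm_mul, ← Complex.ofReal_sub, ← ofReal_norm (Complex.ofReal _),
              Complex.norm_real, Real.norm_eq_abs]
            gcongr
            exact abs_smoothingKernel_sub_le hα hr hr' hz hz' hw1 hρ1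
        _ = B * (ENNReal.ofReal (32 * pseudoHyp z z' / r) *
              (∫⁻ w, I z w ∂(vMeasure n α) + ∫⁻ w, I z' w ∂(vMeasure n α))) := by
            rw [lintegral_const_mul' _ _ hBtop, lintegral_const_mul' _ _ ENNReal.ofReal_ne_top,
              lintegral_add_left (hIm z)]
        _ ≤ B * (ENNReal.ofReal (32 * pseudoHyp z z' / r) * (D + D)) := by
            gcongr
            · exact lintegral_inv_vMeasure_gaugeBall_le hα hz hr hr'
            · exact lintegral_inv_vMeasure_gaugeBall_le hα hz' hr hr'
        _ = _ := by ring
    have h2 : ‖smoothing α r φ z - smoothing α r φ z'‖ ≤ 32 * pseudoHyp z z' / r * Q := by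
      rw [← toReal_enorm, hQ, ← ENNReal.toReal_ofReal
        (by positivity : 0 ≤ 32 * pseudoHyp z z' / r), ← ENNReal.toReal_mul]
      exact ENNReal.toReal_mono (ENNReal.mul_ne_top ENNReal.ofReal_ne_top htop) h
    refine h2.trans_lt ?_
    rw [lt_div_iff₀ (by positivity)] at hρ2
    rw [div_mul_eq_mul_div, div_lt_iff₀ hr]
    nlinarith

/-! ### The Bergman kernel -/

lemma norm_bergmanKernel (z w : Cn n) :
    ‖bergmanKernel n α z w‖ = ‖1 - inner ℂ w z‖ ^ (-((n : ℝ) + 1 + α)) := by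
  rw [bergmanKernel, norm_div, norm_one, Complex.norm_cpow_real, Real.rpow_neg (norm_nonneg _),
    one_div]

lemma norm_bergmanKernel_comm (z w : Cn n) :
    ‖bergmanKernel n α z w‖ = ‖bergmanKernel n α w z‖ := by
  rw [norm_bergmanKernel, norm_bergmanKernel, ← inner_conj_symm, ← RCLike.norm_conj]
  simp

lemma measurable_bergmanKernel :
    Measurable fun q : Cn n × Cn n => bergmanKernel n α q.1 q.2 := by
  have h : Measurable fun q : Cn n × Cn n => 1 - inner ℂ q.2 q.1 :=
    (continuous_const.sub (continuous_snd.inner continuous_fst)).measurable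
  exact measurable_const.div (h.pow_const _)

lemma measurable_bergmanKernel_right (z : Cn n) :
    Measurable fun w : Cn n => bergmanKernel n α z w := by
  have h := (measurable_bergmanKernel (n := n) (α := α)).comp (measurable_prodMk_left (x := z))
  exact h

lemma norm_bergmanKernel_le (hα : -1 < α) {z w : Cn n} (hz : ‖z‖ < 1) (hw : ‖w‖ < 1) :
    ‖bergmanKernel n α z w‖ ≤ (1 - ‖z‖) ^ (-((n : ℝ) + 1 + α)) := by
  rw [norm_bergmanKernel]
  refine Real.rpow_le_rpow_of_nonpos (by linarith) (one_sub_norm_le z hw.le) ?_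
  have : (0 : ℝ) ≤ n := by positivity
  linarith

/-- The principal power is multiplicative on the right half-plane, as the arguments add up to less
than `π` in absolute value. -/
lemma cpow_mul_of_re_pos {a b : ℂ} (ha : 0 < a.re) (hb : 0 < b.re) (c : ℂ) :
    (a * b) ^ c = a ^ c * b ^ c := by
  have ha0 : a ≠ 0 := fun h => by simp [h] at ha
  have hb0 : b ≠ 0 := fun h => by simp [h] at hb
  have h1 := abs_lt.1 (Complex.abs_arg_lt_pi_div_two_iff.2 (Or.inl ha))
  have h2 := abs_lt.1 (Complex.abs_arg_lt_pi_div_two_iff.2 (Or.inl hb))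
  rw [Complex.cpow_def_of_ne_zero (mul_ne_zero ha0 hb0), Complex.cpow_def_of_ne_zero ha0,
    Complex.cpow_def_of_ne_zero hb0, Complex.log_mul ha0 hb0 ⟨by linarith, by linarith⟩,
    add_mul, Complex.exp_add]

/-- The kernel `K(u, ·)` is nearly constant, in the multiplicative sense and uniformly in `u`, on
gauge balls of small radius. -/
lemma exists_norm_bergmanKernel_sub_le (n : ℕ) (α : ℝ) {ε : ℝ} (hε : 0 < ε) :
    ∃ r : ℝ, 0 < r ∧ ∀ u w z : Cn n, ‖u‖ < 1 → ‖w‖ < 1 → z ∈ gaugeBall w r →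
      ‖bergmanKernel n α u z - bergmanKernel n α u w‖ ≤ ε * ‖bergmanKernel n α u w‖ := by
  set c : ℂ := (((n : ℝ) + 1 + α : ℝ) : ℂ) with hc
  have hcont : ContinuousAt (fun η : ℂ => 1 / (1 + η) ^ c) 0 := by
    have h1 : ContinuousAt (fun η : ℂ => (1 + η) ^ c) 0 :=
      (continuousAt_const.add continuousAt_id).cpow continuousAt_const (by simp)
    exact continuousAt_const.div h1 (by simp)
  obtain ⟨δ, hδ, hball⟩ := Metric.continuousAt_iff.1 hcont ε hε
  refine ⟨min (δ / 4) (1 / 8), by positivity, fun u w z hu hw hz => ?_⟩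
  have hN : bergmanGauge w (z - w) < min (δ / 4) (1 / 8) := hz
  have hN1 := hN.trans_le (min_le_left _ _)
  have hN2 := hN.trans_le (min_le_right _ _)
  have hne := one_sub_inner_ne_zero hw hu
  have hpos : 0 < ‖1 - inner ℂ w u‖ := norm_pos_iff.2 hne
  set η : ℂ := -inner ℂ (z - w) u / (1 - inner ℂ w u) with hη
  have hηn : ‖η‖ ≤ 4 * bergmanGauge w (z - w) := by
    rw [hη, norm_div, norm_neg, div_le_iff₀ hpos]
    exact norm_inner_le_gauge_mul hw hu (z - w)
  have hfac : 1 - inner ℂ z u = (1 - inner ℂ w u) * (1 + η) := by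
    rw [hη, mul_add, mul_div_cancel₀ _ hne, inner_sub_left]; ring
  have hre : 0 < (1 + η).re := by
    have := abs_le.1 (Complex.abs_re_le_norm η)
    simp only [Complex.add_re, Complex.one_re]; linarith
  have hclose := hball (x := η) (by rw [dist_zero_right]; linarith)
  rw [add_zero, Complex.one_cpow, dist_eq_norm, div_one] at hclose
  have hK : bergmanKernel n α u z - bergmanKernel n α u w =
      bergmanKernel n α u w * (1 / (1 + η) ^ c - 1) := by
    rw [bergmanKernel, bergmanKernel, hfac, cpow_mul_of_re_pos (one_sub_re_inner_pos hw hu) hre,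
      ← hc, one_div, mul_inv]
    ring
  rw [hK, norm_mul, mul_comm]
  gcongr

/-- Averaging over gauge balls of radius `R` is harmless after integration against the kernel. -/
lemma lintegral_bergmanKernel_mul_gaugeAverage_le (hα : -1 < α) {R : ℝ} (hR : 0 < R)
    (hR' : R ≤ 1 / 40) (hK : ∀ u w z : Cn n, ‖u‖ < 1 → ‖w‖ < 1 → z ∈ gaugeBall w R →
      ‖bergmanKernel n α u z - bergmanKernel n α u w‖ ≤ (1 / 2) * ‖bergmanKernel n α u w‖)
    {f : Cn n → ℂ} (hf : AEStronglyMeasurable f (vMeasure n α)) {u : Cn n} (hu : ‖u‖ < 1) :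
    ∫⁻ w, ‖bergmanKernel n α u w‖ₑ * gaugeAverage α R f w ∂(vMeasure n α) ≤
      2 * ENNReal.ofReal (4 ^ |α| * 10 ^ (2 * n)) *
        ∫⁻ z, ‖bergmanKernel n α u z‖ₑ * ‖f z‖ₑ ∂(vMeasure n α) := by
  have := isProbabilityMeasure_vMeasure (n := n) hα
  set μ := vMeasure n α with hμ
  set D := ENNReal.ofReal (4 ^ |α| * 10 ^ (2 * n)) with hD
  set S : Set (Cn n × Cn n) := {q | q.2 ∈ gaugeBall q.1 R} with hS
  have hSm : MeasurableSet S := measurableSet_gaugeBall_prod R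
  set J : Cn n → ℝ≥0∞ := fun w => ‖bergmanKernel n α u w‖ₑ * (μ (gaugeBall w R))⁻¹ with hJ
  have hJm : Measurable J :=
    (measurable_bergmanKernel_right u).enorm.mul (measurable_vMeasure_gaugeBall hα R).inv
  -- After Tonelli the weight of `|f z|` is the integral of `J` over the centres `w` whose gauge
  -- ball contains `z`.
  have h1 : ∀ w, ‖bergmanKernel n α u w‖ₑ * gaugeAverage α R f w =
      ∫⁻ z, S.indicator (fun q => J q.1 * ‖f q.2‖ₑ) (w, z) ∂μ := by
    intro w
    rw [gaugeAverage, ← mul_assoc, ← lintegral_indicator (measurableSet_gaugeBall w R),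
      ← lintegral_const_mul'' _ (hf.enorm.indicator (measurableSet_gaugeBall w R))]
    refine lintegral_congr fun z => ?_
    by_cases h : z ∈ gaugeBall w R
    · rw [Set.indicator_of_mem h, Set.indicator_of_mem (show (w, z) ∈ S from h)]
    · rw [Set.indicator_of_notMem h, Set.indicator_of_notMem (show (w, z) ∉ S from h), mul_zero]
  have hm : AEMeasurable (fun q : Cn n × Cn n => S.indicator (fun q => J q.1 * ‖f q.2‖ₑ) q)
      (μ.prod μ) := by
    refine AEMeasurable.indicator ?_ hSm
    exact (hJm.comp measurable_fst).aemeasurable.mul hf.comp_snd.enorm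
  have hKf : AEMeasurable (fun z => ‖bergmanKernel n α u z‖ₑ * ‖f z‖ₑ) μ :=
    (measurable_bergmanKernel_right u).enorm.aemeasurable.mul hf.enorm
  rw [lintegral_congr h1, lintegral_lintegral_swap hm, ← lintegral_const_mul'' _ hKf]
  refine lintegral_mono_ae ?_
  filter_upwards [ae_norm_lt_one] with z hz
  have h2 : ∀ᵐ w ∂μ, S.indicator (fun q => J q.1 * ‖f q.2‖ₑ) (w, z) ≤
      (2 * ‖bergmanKernel n α u z‖ₑ * ‖f z‖ₑ) * {w | z ∈ gaugeBall w R}.indicator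
        (fun w => (μ (gaugeBall w (R / 2)))⁻¹) w := by
    filter_upwards [ae_norm_lt_one] with w hw
    by_cases h : z ∈ gaugeBall w R
    · rw [Set.indicator_of_mem (show (w, z) ∈ S from h),
        Set.indicator_of_mem (show w ∈ {w | z ∈ gaugeBall w R} from h), hJ]
      have h3 : ‖bergmanKernel n α u w‖ₑ ≤ 2 * ‖bergmanKernel n α u z‖ₑ := by
        rw [← ofReal_norm, ← ofReal_norm, ← ENNReal.ofReal_ofNat 2,
          ← ENNReal.ofReal_mul (by norm_num)]
        refine ENNReal.ofReal_le_ofReal ?_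
        have h4 := hK u w z hu hw h
        have h5 := norm_sub_norm_le (bergmanKernel n α u w) (bergmanKernel n α u z)
        rw [norm_sub_rev] at h5
        linarith
      have h6 : (μ (gaugeBall w R))⁻¹ ≤ (μ (gaugeBall w (R / 2)))⁻¹ :=
        ENNReal.inv_le_inv.2 (measure_mono (gaugeBall_mono w (by linarith)))
      calc ‖bergmanKernel n α u w‖ₑ * (μ (gaugeBall w R))⁻¹ * ‖f z‖ₑ
          ≤ (2 * ‖bergmanKernel n α u z‖ₑ) * (μ (gaugeBall w (R / 2)))⁻¹ * ‖f z‖ₑ := by gcongr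
        _ = _ := by ring
    · rw [Set.indicator_of_notMem (show (w, z) ∉ S from h)]
      exact zero_le
  refine (lintegral_mono_ae h2).trans ?_
  have hIm : Measurable ({w | z ∈ gaugeBall w R}.indicator
        (fun w => (μ (gaugeBall w (R / 2)))⁻¹)) :=
    ((measurable_vMeasure_gaugeBall hα (R / 2)).inv).indicator
      (measurable_prodMk_right (measurableSet_gaugeBall_prod R))
  rw [lintegral_const_mul _ hIm]
  calc _ ≤ 2 * ‖bergmanKernel n α u z‖ₑ * ‖f z‖ₑ * D := by
        gcongr
        exact lintegral_inv_vMeasure_gaugeBall_le hα hz hR hR'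
    _ = _ := by ring

lemma integrable_bergmanKernel_smul {E : Type*} [NormedAddCommGroup E] [NormedSpace ℂ E]
    (hα : -1 < α) {F : Cn n → E} (hF : Integrable F (vMeasure n α)) {z : Cn n} (hz : ‖z‖ < 1) :
    Integrable (fun w => bergmanKernel n α z w • F w) (vMeasure n α) := by
  have hb : ∀ᵐ w ∂(vMeasure n α),
      ‖bergmanKernel n α z w‖ ≤ (1 - ‖z‖) ^ (-((n : ℝ) + 1 + α)) := by
    filter_upwards [ae_norm_lt_one] with w hw
    exact norm_bergmanKernel_le hα hz hw
  have h := hF.bdd_smul _ (measurable_bergmanKernel_right z).aestronglyMeasurable hb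
  exact h

lemma integrable_bergmanKernel_mul (hα : -1 < α) {f : Cn n → ℂ}
    (hf : Integrable f (vMeasure n α)) {u : Cn n} (hu : ‖u‖ < 1) :
    Integrable (fun w => bergmanKernel n α u w * f w) (vMeasure n α) :=
  integrable_bergmanKernel_smul hα hf hu

lemma gaugeAverage_ne_top (hα : -1 < α) {f : Cn n → ℂ} (hf : Integrable f (vMeasure n α))
    {w : Cn n} (hw : ‖w‖ < 1) {r : ℝ} (hr : 0 < r) (hr' : r ≤ 1 / 8) :
    gaugeAverage α r f w ≠ ⊤ :=
  ENNReal.mul_ne_top (ENNReal.inv_ne_top.2 (vMeasure_gaugeBall_pos hα hw hr hr').ne')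
    ((setLIntegral_le_lintegral _ _).trans_lt hf.2).ne

/-- Oscillation of `K(u, ·) f` over a gauge ball of small radius `r`, in terms of an average of `f`
over a gauge ball of fixed radius `R`. -/
lemma enorm_kernel_mul_sub_le (hα : -1 < α) {R r ε : ℝ} (hR : 0 < R) (hR' : R ≤ 1 / 40)
    (hrR : r ≤ R / 2) (hε : 0 < ε) (hrε : 4 / R * (4 ^ |α| * 2 ^ (2 * n)) * r ≤ ε)
    (hK : ∀ u w z : Cn n, ‖u‖ < 1 → ‖w‖ < 1 → z ∈ gaugeBall w r →
      ‖bergmanKernel n α u z - bergmanKernel n α u w‖ ≤ ε * ‖bergmanKernel n α u w‖)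
    {f : Cn n → ℂ} (hf : DifferentiableOn ℂ f (Metric.ball 0 1))
    (hfi : Integrable f (vMeasure n α)) {u w z : Cn n} (hu : ‖u‖ < 1) (hw : ‖w‖ < 1)
    (hz : z ∈ gaugeBall w r) :
    ‖bergmanKernel n α u w * f w - bergmanKernel n α u z * f z‖ₑ ≤
      ENNReal.ofReal (ε * (1 + 4 ^ |α| * 2 ^ (2 * n))) *
        (‖bergmanKernel n α u w‖ₑ * gaugeAverage α R f w) := by
  set K₀ : ℝ := 4 ^ |α| * 2 ^ (2 * n) with hK₀
  have hK₀pos : 0 < K₀ := by positivity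
  have hzR : z ∈ gaugeBall w (R / 2) := gaugeBall_mono w hrR hz
  have hfin := gaugeAverage_ne_top hα hfi hw hR (by linarith)
  have h1 := enorm_le_gaugeAverage hα hf hw hR (by linarith) hzR
  have h2 := enorm_sub_le_gaugeAverage hα hf hw hR (by linarith) hzR hfin
  have h3 : ‖f z - f w‖ₑ ≤ ENNReal.ofReal ε * gaugeAverage α R f w := by
    refine h2.trans ?_
    gcongr
    refine le_trans ?_ hrε
    gcongr
    exact (mem_gaugeBall.1 hz).le
  have h4 : ‖bergmanKernel n α u z - bergmanKernel n α u w‖ₑ ≤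
      ENNReal.ofReal ε * ‖bergmanKernel n α u w‖ₑ := by
    rw [← ofReal_norm, ← ofReal_norm, ← ENNReal.ofReal_mul hε.le]
    exact ENNReal.ofReal_le_ofReal (hK u w z hu hw hz)
  have h5 : bergmanKernel n α u w * f w - bergmanKernel n α u z * f z =
      -((bergmanKernel n α u z - bergmanKernel n α u w) * f z +
        bergmanKernel n α u w * (f z - f w)) := by ring
  rw [h5, enorm_neg]
  refine (enorm_add_le _ _).trans ?_
  rw [enorm_mul, enorm_mul]
  calc _ ≤ (ENNReal.ofReal ε * ‖bergmanKernel n α u w‖ₑ) *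
          (ENNReal.ofReal K₀ * gaugeAverage α R f w) +
        ‖bergmanKernel n α u w‖ₑ * (ENNReal.ofReal ε * gaugeAverage α R f w) := by gcongr
    _ = _ := by
        rw [ENNReal.ofReal_mul hε.le, ENNReal.ofReal_add zero_le_one hK₀pos.le,
          ENNReal.ofReal_one]
        ring

/-! ### Approximation of scalar symbols -/

/-- Joint integrability, which allows the smoothing to be moved from the symbol to `G` by Fubini. -/
lemma integrable_prod_smoothing (hα : -1 < α) {r : ℝ} (hr : 0 < r) (hr' : r ≤ 1 / 40)
    {φ : Cn n → ℂ} (hφ : MemLp φ ∞ (vMeasure n α)) {G : Cn n → ℂ}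
    (hG : Integrable G (vMeasure n α)) :
    Integrable (fun q : Cn n × Cn n => G q.1 * (φ q.2 * (smoothingKernel α r q.1 q.2 : ℂ)))
      ((vMeasure n α).prod (vMeasure n α)) := by
  have := isProbabilityMeasure_vMeasure (n := n) hα
  set μ := vMeasure n α with hμ
  have hHm : AEStronglyMeasurable (fun q : Cn n × Cn n => (smoothingKernel α r q.1 q.2 : ℂ))
      (μ.prod μ) :=
    (Complex.measurable_ofReal.comp (measurable_smoothingKernel hα r)).aestronglyMeasurable
  have hm : AEStronglyMeasurable
      (fun q : Cn n × Cn n => G q.1 * (φ q.2 * (smoothingKernel α r q.1 q.2 : ℂ))) (μ.prod μ) :=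
    hG.1.comp_fst.mul (hφ.1.comp_snd.mul hHm)
  rw [integrable_prod_iff hm]
  have hint : ∀ᵐ z ∂μ, Integrable (fun w => φ w * (smoothingKernel α r z w : ℂ)) μ := by
    filter_upwards [ae_norm_lt_one] with z hz
    exact integrable_mul_smoothingKernel hα hr hr' hφ hz
  refine ⟨by filter_upwards [hint] with z hz using hz.const_mul _, ?_⟩
  set B := eLpNorm φ ∞ μ with hB
  have hBtop : B ≠ ⊤ := hφ.2.ne
  have hφB : ∀ᵐ w ∂μ, ‖φ w‖ₑ ≤ B := by
    rw [hB, eLpNorm_exponent_top]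
    exact ae_le_eLpNormEssSup
  set Q := B * (2 * ENNReal.ofReal (4 ^ |α| * 10 ^ (2 * n))) with hQ
  have hQtop : Q ≠ ⊤ :=
    ENNReal.mul_ne_top hBtop (ENNReal.mul_ne_top (by simp) ENNReal.ofReal_ne_top)
  refine (hG.norm.mul_const Q.toReal).mono' hm.norm.integral_prod_right' ?_
  filter_upwards [ae_norm_lt_one, hint] with z hz hzi
  rw [Real.norm_of_nonneg (integral_nonneg fun _ => norm_nonneg _)]
  simp only [norm_mul (G z)]
  rw [integral_const_mul]
  gcongr
  rw [integral_norm_eq_lintegral_enorm hzi.1]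
  refine ENNReal.toReal_mono hQtop ?_
  calc _ ≤ ∫⁻ w, B * ENNReal.ofReal (smoothingKernel α r z w) ∂μ := by
        refine lintegral_mono_ae ?_
        filter_upwards [hφB] with w hw
        rw [enorm_mul, ← ofReal_norm (smoothingKernel α r z w : ℂ), Complex.norm_real,
          Real.norm_of_nonneg (smoothingKernel_nonneg α r z w)]
        gcongr
    _ ≤ Q := by
        rw [hQ, lintegral_const_mul' _ _ hBtop]
        gcongr
        exact lintegral_smoothingKernel_le hα hr hr' hz

/-- If `G` oscillates by at most `E w` over the gauge ball of radius `r` at `w`, then replacing a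
symbol by its smoothing at scale `r` changes the integral against `G` by at most the supremum norm
of the symbol times the integral of `E`. -/
lemma enorm_integral_sub_smoothing_le (hα : -1 < α) {r : ℝ} (hr : 0 < r) (hr' : r ≤ 1 / 40)
    {φ : Cn n → ℂ} (hφ : MemLp φ ∞ (vMeasure n α)) {G : Cn n → ℂ}
    (hG : Integrable G (vMeasure n α)) {E : Cn n → ℝ≥0∞}
    (hE : ∀ w z, ‖w‖ < 1 → z ∈ gaugeBall w r → ‖G w - G z‖ₑ ≤ E w) :
    ‖∫ w, φ w * G w ∂(vMeasure n α) - ∫ z, smoothing α r φ z * G z ∂(vMeasure n α)‖ₑ ≤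
      eLpNorm φ ∞ (vMeasure n α) * ∫⁻ w, E w ∂(vMeasure n α) := by
  have := isProbabilityMeasure_vMeasure (n := n) hα
  set μ := vMeasure n α with hμ
  set B := eLpNorm φ ∞ μ with hB
  have hBtop : B ≠ ⊤ := hφ.2.ne
  have hφB : ∀ᵐ w ∂μ, ‖φ w‖ₑ ≤ B := by
    rw [hB, eLpNorm_exponent_top]
    exact ae_le_eLpNormEssSup
  have hF := integrable_prod_smoothing hα hr hr' hφ hG
  have h1 : ∫ z, smoothing α r φ z * G z ∂μ =
      ∫ w, ∫ z, G z * (φ w * (smoothingKernel α r z w : ℂ)) ∂μ ∂μ := by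
    rw [← integral_integral_swap hF]
    refine integral_congr_ae (Filter.Eventually.of_forall fun z => ?_)
    simp only [smoothing]
    rw [mul_comm, ← integral_const_mul]
  have hφG : Integrable (fun w => φ w * G w) μ := hG.mul_of_top_right hφ
  have hFr : Integrable (fun w => ∫ z, G z * (φ w * (smoothingKernel α r z w : ℂ)) ∂μ) μ :=
    hF.integral_prod_right
  rw [h1, ← integral_sub hφG hFr]
  refine (enorm_integral_le_lintegral_enorm _).trans ?_
  rw [← lintegral_const_mul' _ _ hBtop]
  refine lintegral_mono_ae ?_
  filter_upwards [ae_norm_lt_one, hφB, hF.prod_left_ae] with w hw hφw hFw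
  have hH1 := integral_smoothingKernel hα hr (by linarith) hw
  -- A function whose Bochner integral is nonzero is integrable.
  have hHi : Integrable (fun z => smoothingKernel α r z w) μ := by
    by_contra h
    rw [integral_undef h] at hH1
    exact zero_ne_one hH1
  -- The kernel has integral one in `z`, so `φ w * G w` can be written as an integral over `z`.
  have h2 : φ w * G w = ∫ z, φ w * G w * (smoothingKernel α r z w : ℂ) ∂μ := by
    rw [integral_const_mul, integral_complex_ofReal, hH1]; simp
  have h3 : Integrable (fun z => φ w * G w * (smoothingKernel α r z w : ℂ)) μ :=
    hHi.ofReal.const_mul _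
  rw [h2, ← integral_sub h3 hFw]
  refine (enorm_integral_le_lintegral_enorm _).trans ?_
  have h4 : ∀ z, ‖φ w * G w * (smoothingKernel α r z w : ℂ) -
      G z * (φ w * (smoothingKernel α r z w : ℂ))‖ₑ ≤
        (B * E w) * ENNReal.ofReal (smoothingKernel α r z w) := by
    intro z
    by_cases hz : z ∈ gaugeBall w r
    · rw [show φ w * G w * (smoothingKernel α r z w : ℂ) -
          G z * (φ w * (smoothingKernel α r z w : ℂ)) =
          φ w * (G w - G z) * (smoothingKernel α r z w : ℂ) by ring, enorm_mul, enorm_mul,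
        ← ofReal_norm (smoothingKernel α r z w : ℂ), Complex.norm_real,
        Real.norm_of_nonneg (smoothingKernel_nonneg α r z w)]
      gcongr
      exact hE w z hw hz
    · have : smoothingKernel α r z w = 0 := by
        rw [smoothingKernel, bump_eq_zero hr hz, zero_div]
      simp [this]
  refine (lintegral_mono h4).trans ?_
  have hHm : Measurable fun z => smoothingKernel α r z w := by
    have h := (measurable_smoothingKernel (n := n) hα r).comp (measurable_prodMk_right (y := w))
    exact h
  rw [lintegral_const_mul _ hHm.ennreal_ofReal, ← ofReal_integral_eq_lintegral_ofReal hHi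
    (Filter.Eventually.of_forall fun z => smoothingKernel_nonneg α r z w), hH1]
  simp

/-- Every bounded scalar symbol can be replaced by one in `𝒜`, up to an error that is small compared
with the positive kernel operator `|f| ↦ ∫ |K(u, w)| |f(w)| dv_α(w)`. -/
theorem exists_isBUC_enorm_sub_le (hα : -1 < α) {φ : Cn n → ℂ}
    (hφ : MemLp φ ∞ (vMeasure n α)) {ε : ℝ} (hε : 0 < ε) :
    ∃ a : Cn n → ℂ, IsBUC a ∧ ∀ f : Cn n → ℂ, DifferentiableOn ℂ f (Metric.ball 0 1) →
      Integrable f (vMeasure n α) → ∀ u : Cn n, ‖u‖ < 1 →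
      ‖∫ w, φ w * (bergmanKernel n α u w * f w) ∂(vMeasure n α) -
        ∫ w, a w * (bergmanKernel n α u w * f w) ∂(vMeasure n α)‖ₑ ≤
      ENNReal.ofReal ε * ∫⁻ w, ‖bergmanKernel n α u w‖ₑ * ‖f w‖ₑ ∂(vMeasure n α) := by
  set B := eLpNorm φ ∞ (vMeasure n α) with hB
  have hBtop : B ≠ ⊤ := hφ.2.ne
  set K₀ : ℝ := 4 ^ |α| * 2 ^ (2 * n) with hK₀
  have hK₀pos : 0 < K₀ := by positivity
  set D₀ : ℝ := 4 ^ |α| * 10 ^ (2 * n) with hD₀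
  have hD₀pos : 0 < D₀ := by positivity
  have hB0 : 0 ≤ B.toReal := ENNReal.toReal_nonneg
  -- The final error is `B * ε' * (1 + K₀) * (2 * D₀)`: the sup norm of `φ`, the oscillation of `K
  -- f`, and the cost of averaging.
  set ε' : ℝ := ε / ((B.toReal + 1) * (1 + K₀) * (2 * D₀)) with hε'
  have hε'pos : 0 < ε' := by positivity
  -- The averages of `f` use a fixed radius `R`, while the smoothing radius `r` depends on `ε`.
  obtain ⟨R₁, hR₁, hKR⟩ := exists_norm_bergmanKernel_sub_le n α (ε := 1 / 2) (by norm_num)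
  obtain ⟨r₁, hr₁, hKr⟩ := exists_norm_bergmanKernel_sub_le n α hε'pos
  set R := min R₁ (1 / 40) with hR
  have hRpos : 0 < R := by positivity
  have hR' : R ≤ 1 / 40 := min_le_right _ _
  set r := min (min r₁ (R / 2)) (ε' / (4 / R * K₀)) with hr
  have hrpos : 0 < r := by positivity
  have hrr : r ≤ r₁ := (min_le_left _ _).trans (min_le_left _ _)
  have hrR : r ≤ R / 2 := (min_le_left _ _).trans (min_le_right _ _)
  have hrε : 4 / R * K₀ * r ≤ ε' := by
    have : r ≤ ε' / (4 / R * K₀) := min_le_right _ _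
    rwa [le_div_iff₀ (by positivity), mul_comm] at this
  refine ⟨smoothing α r φ, isBUC_smoothing hα hrpos (by linarith) hφ, fun f hf hfi u hu => ?_⟩
  refine (enorm_integral_sub_smoothing_le hα hrpos (by linarith) hφ
    (integrable_bergmanKernel_mul hα hfi hu) (E := fun w => ENNReal.ofReal (ε' * (1 + K₀)) *
      (‖bergmanKernel n α u w‖ₑ * gaugeAverage α R f w)) fun w z hw hz => ?_).trans ?_
  · exact enorm_kernel_mul_sub_le hα hRpos hR' hrR hε'pos hrε
      (fun u w z hu hw hz => hKr u w z hu hw (gaugeBall_mono w hrr hz)) hf hfi hu hw hz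
  · rw [lintegral_const_mul' _ _ ENNReal.ofReal_ne_top]
    have h1 := lintegral_bergmanKernel_mul_gaugeAverage_le hα hRpos hR'
      (fun u w z hu hw hz => hKR u w z hu hw (gaugeBall_mono w (min_le_left _ _) hz)) hfi.1 hu
    calc _ ≤ ENNReal.ofReal (B.toReal + 1) * (ENNReal.ofReal (ε' * (1 + K₀)) *
          (2 * ENNReal.ofReal D₀ *
            ∫⁻ z, ‖bergmanKernel n α u z‖ₑ * ‖f z‖ₑ ∂(vMeasure n α))) := by
          refine mul_le_mul' ?_ (mul_le_mul' le_rfl h1)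
          exact (ENNReal.le_ofReal_iff_toReal_le hBtop (by positivity)).2 (by linarith)
      _ = ENNReal.ofReal ((B.toReal + 1) * (ε' * (1 + K₀)) * (2 * D₀)) *
            ∫⁻ z, ‖bergmanKernel n α u z‖ₑ * ‖f z‖ₑ ∂(vMeasure n α) := by
          have h2 : ENNReal.ofReal ((B.toReal + 1) * (ε' * (1 + K₀)) * (2 * D₀)) =
              ENNReal.ofReal (B.toReal + 1) * ENNReal.ofReal (ε' * (1 + K₀)) *
                (2 * ENNReal.ofReal D₀) := by
            rw [ENNReal.ofReal_mul (by positivity), ENNReal.ofReal_mul (by positivity),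
              ENNReal.ofReal_mul (by norm_num : (0 : ℝ) ≤ 2), ENNReal.ofReal_ofNat]
          rw [h2]; ring
      _ = _ := by
          congr 2
          rw [hε']; field_simp

/-! ### The Schur test and boundedness of the positive Bergman operator -/

/-- **Schur test** with test function `h`: split `k = k^{1/p} k^{1/q}`, insert `h⁻¹ h`, and use
Hölder. -/
theorem lintegral_rpow_kernel_le {X : Type*} [MeasurableSpace X] {μ : Measure X} [SFinite μ]
    {p q : ℝ} (hpq : p.HolderConjugate q) {k : X → X → ℝ≥0∞} (hk : Measurable (Function.uncurry k))
    {h : X → ℝ≥0∞} (hh : Measurable h) (h0 : ∀ᵐ x ∂μ, h x ≠ 0) (htop : ∀ᵐ x ∂μ, h x ≠ ⊤)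
    {C : ℝ≥0∞} (hleft : ∀ᵐ z ∂μ, ∫⁻ w, k z w * h w ^ q ∂μ ≤ C * h z ^ q)
    (hright : ∀ᵐ w ∂μ, ∫⁻ z, k z w * h z ^ p ∂μ ≤ C * h w ^ p)
    {F : X → ℝ≥0∞} (hF : AEMeasurable F μ) :
    ∫⁻ z, (∫⁻ w, k z w * F w ∂μ) ^ p ∂μ ≤ C ^ p * ∫⁻ w, F w ^ p ∂μ := by
  have hp := hpq.pos
  have hq := hpq.symm.pos
  have hkz : ∀ z, Measurable (k z) := fun z => hk.comp measurable_prodMk_left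
  set Φ : X → ℝ≥0∞ := fun w => (h w)⁻¹ ^ p * F w ^ p with hΦ
  have hΦm : AEMeasurable Φ μ := (hh.inv.pow_const p).aemeasurable.mul (hF.pow_const p)
  have hstep : ∀ᵐ z ∂μ, (∫⁻ w, k z w * F w ∂μ) ^ p ≤
      C ^ (p / q) * (h z ^ p * ∫⁻ w, k z w * Φ w ∂μ) := by
    filter_upwards [hleft] with z hz
    have h1 : ∫⁻ w, k z w * F w ∂μ =
        ∫⁻ w, ((fun w => k z w ^ (1 / p) * ((h w)⁻¹ * F w)) * fun w => k z w ^ (1 / q) * h w) w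
          ∂μ := by
      refine lintegral_congr_ae ?_
      filter_upwards [h0, htop] with w hw0 hwtop
      simp only [Pi.mul_apply]
      have h2 : k z w ^ (1 / p) * k z w ^ (1 / q) = k z w := by
        rw [← ENNReal.rpow_add_of_nonneg _ _ (by positivity) (by positivity)]
        have : 1 / p + 1 / q = 1 := by simpa using hpq.inv_add_inv_eq_one
        rw [this, ENNReal.rpow_one]
      calc k z w * F w = (k z w ^ (1 / p) * k z w ^ (1 / q)) * ((h w)⁻¹ * h w) * F w := by
            rw [h2, ENNReal.inv_mul_cancel hw0 hwtop, mul_one]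
        _ = _ := by ring
    have h3 := ENNReal.lintegral_mul_le_Lp_mul_Lq μ hpq
      (f := fun w => k z w ^ (1 / p) * ((h w)⁻¹ * F w)) (g := fun w => k z w ^ (1 / q) * h w)
      (((hkz z).pow_const _).aemeasurable.mul (hh.inv.aemeasurable.mul hF))
      (((hkz z).pow_const _).mul hh).aemeasurable
    have h4 : ∀ w, (k z w ^ (1 / p) * ((h w)⁻¹ * F w)) ^ p = k z w * Φ w := fun w => by
      rw [ENNReal.mul_rpow_of_nonneg _ _ hp.le, ENNReal.mul_rpow_of_nonneg _ _ hp.le,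
        ← ENNReal.rpow_mul, one_div_mul_cancel hp.ne', ENNReal.rpow_one]
    have h5 : ∀ w, (k z w ^ (1 / q) * h w) ^ q = k z w * h w ^ q := fun w => by
      rw [ENNReal.mul_rpow_of_nonneg _ _ hq.le, ← ENNReal.rpow_mul, one_div_mul_cancel hq.ne',
        ENNReal.rpow_one]
    simp only [h4, h5] at h3
    calc (∫⁻ w, k z w * F w ∂μ) ^ p
        ≤ ((∫⁻ w, k z w * Φ w ∂μ) ^ (1 / p) * (C * h z ^ q) ^ (1 / q)) ^ p := by
          rw [h1]
          refine ENNReal.rpow_le_rpow (h3.trans ?_) hp.le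
          gcongr
      _ = _ := by
          rw [ENNReal.mul_rpow_of_nonneg _ _ hp.le, ← ENNReal.rpow_mul, ← ENNReal.rpow_mul,
            one_div_mul_cancel hp.ne', ENNReal.rpow_one, one_div_mul_eq_div,
            ENNReal.mul_rpow_of_nonneg _ _ (by positivity), ← ENNReal.rpow_mul,
            mul_div_cancel₀ _ hq.ne']
          ring
  have hint : AEMeasurable (Function.uncurry fun z w => h z ^ p * (k z w * Φ w)) (μ.prod μ) :=
    ((hh.comp measurable_fst).pow_const p).aemeasurable.mul
      (hk.aemeasurable.mul hΦm.comp_snd)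
  calc ∫⁻ z, (∫⁻ w, k z w * F w ∂μ) ^ p ∂μ
      ≤ ∫⁻ z, C ^ (p / q) * (h z ^ p * ∫⁻ w, k z w * Φ w ∂μ) ∂μ := lintegral_mono_ae hstep
    _ = ∫⁻ z, ∫⁻ w, C ^ (p / q) * (h z ^ p * (k z w * Φ w)) ∂μ ∂μ := by
        refine lintegral_congr fun z => ?_
        have hm : AEMeasurable (fun w => k z w * Φ w) μ := (hkz z).aemeasurable.mul hΦm
        rw [← lintegral_const_mul'' _ hm, ← lintegral_const_mul'' _ (hm.const_mul _)]
    _ = ∫⁻ w, ∫⁻ z, C ^ (p / q) * (h z ^ p * (k z w * Φ w)) ∂μ ∂μ :=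
        lintegral_lintegral_swap (hint.const_mul _)
    _ ≤ ∫⁻ w, C ^ p * F w ^ p ∂μ := by
        refine lintegral_mono_ae ?_
        filter_upwards [hright, h0, htop] with w hw hw0 hwtop
        have hkw : Measurable fun z => k z w := hk.comp measurable_prodMk_right
        have hm : Measurable fun z => k z w * h z ^ p := hkw.mul (hh.pow_const p)
        calc ∫⁻ z, C ^ (p / q) * (h z ^ p * (k z w * Φ w)) ∂μ
            = C ^ (p / q) * Φ w * ∫⁻ z, k z w * h z ^ p ∂μ := by
              rw [← lintegral_const_mul _ hm]
              refine lintegral_congr fun z => ?_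
              ring
          _ ≤ C ^ (p / q) * Φ w * (C * h w ^ p) := by gcongr
          _ = (C ^ (p / q) * C ^ (1 : ℝ)) * ((h w)⁻¹ ^ p * h w ^ p) * F w ^ p := by
              rw [ENNReal.rpow_one, hΦ]; ring
          _ = C ^ p * F w ^ p := by
              rw [← ENNReal.mul_rpow_of_nonneg _ _ hp.le, ENNReal.inv_mul_cancel hw0 hwtop,
                ENNReal.one_rpow, mul_one,
                ← ENNReal.rpow_add_of_nonneg _ _ (by positivity) zero_le_one]
              congr 2
              have := hpq.sub_one_mul_conj
              have h6 : p / q = p - 1 := by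
                rw [div_eq_iff hq.ne']; linarith
              rw [h6]; ring
    _ = C ^ p * ∫⁻ w, F w ^ p ∂μ := lintegral_const_mul'' _ (hF.pow_const p)

/-- The Forelli–Rudin estimate for `|K|` against powers of `1 - |w|²`. -/
lemma exists_lintegral_bergmanKernel_rpow_le (hn : 1 ≤ n) {s : ℝ} (hs : 0 < s)
    (hs' : s < 1 + α) :
    ∃ C : ℝ≥0∞, C ≠ ⊤ ∧ ∀ z : Cn n, ‖z‖ < 1 →
      ∫⁻ w, ‖bergmanKernel n α z w‖ₑ * ENNReal.ofReal (defect w ^ (-s)) ∂(vMeasure n α) ≤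
        C * ENNReal.ofReal (defect z ^ (-s)) := by
  obtain ⟨C, hC, h⟩ := exists_forelliRudin hn (b := α - s) (by linarith) hs
  refine ⟨normConst n α * ENNReal.ofReal C,
    ENNReal.mul_ne_top normConst_ne_top ENNReal.ofReal_ne_top, fun z hz => ?_⟩
  rw [lintegral_vMeasure, mul_assoc, ← ENNReal.ofReal_mul hC.le]
  gcongr
  refine le_trans (le_of_eq ?_) (h z hz)
  refine setLIntegral_congr_fun Metric.isOpen_ball.measurableSet fun w hw => ?_
  have hd := defect_pos (mem_ball_zero_iff.1 hw)
  have h1 : defect w ^ (α - s) = defect w ^ α * defect w ^ (-s) := by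
    rw [sub_eq_add_neg, Real.rpow_add hd]
  rw [← ofReal_norm, norm_bergmanKernel, ← ENNReal.ofReal_mul (by positivity),
    ← ENNReal.ofReal_mul (by positivity), show (n : ℝ) + 1 + (α - s) + s = n + 1 + α by ring, h1]
  congr 1
  ring

/-- The operator `F ↦ ∫ |K(·, w)| F(w) dv_α(w)` is bounded on `L^p(v_α)` for `1 < p < ∞`: by the
Forelli–Rudin estimate a small negative power of `1 - |w|²` is a Schur test function. -/
theorem exists_lintegral_rpow_bergmanKernel_le (hn : 1 ≤ n) (hα : -1 < α) {p : ℝ} (hp : 1 < p) :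
    ∃ C : ℝ≥0∞, C ≠ ⊤ ∧ ∀ F : Cn n → ℝ≥0∞, AEMeasurable F (vMeasure n α) →
      ∫⁻ z, (∫⁻ w, ‖bergmanKernel n α z w‖ₑ * F w ∂(vMeasure n α)) ^ p ∂(vMeasure n α) ≤
        C ^ p * ∫⁻ w, F w ^ p ∂(vMeasure n α) := by
  have := isProbabilityMeasure_vMeasure (n := n) hα
  have hpq : p.HolderConjugate p.conjExponent := Real.HolderConjugate.conjExponent hp
  set q := p.conjExponent
  have hp0 := hpq.pos
  have hq0 := hpq.symm.pos
  have hα' : 0 < 1 + α := by linarith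
  -- Both `t * p` and `t * q` lie strictly between `0` and `1 + α`.
  set t : ℝ := (1 + α) / (p + q) with ht
  have ht0 : 0 < t := by positivity
  have htp : t * p < 1 + α := by
    rw [ht, div_mul_eq_mul_div, div_lt_iff₀ (by positivity)]; nlinarith
  have htq : t * q < 1 + α := by
    rw [ht, div_mul_eq_mul_div, div_lt_iff₀ (by positivity)]; nlinarith
  obtain ⟨C₁, hC₁, h₁⟩ := exists_lintegral_bergmanKernel_rpow_le hn (s := t * q)
    (by positivity) htq
  obtain ⟨C₂, hC₂, h₂⟩ := exists_lintegral_bergmanKernel_rpow_le hn (s := t * p)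
    (by positivity) htp
  set h : Cn n → ℝ≥0∞ := fun w => ENNReal.ofReal (defect w ^ (-t)) with hh
  have hpow : ∀ w : Cn n, ‖w‖ < 1 → ∀ e : ℝ, 0 < e →
      h w ^ e = ENNReal.ofReal (defect w ^ (-(t * e))) := fun w hw e he => by
    have hd := defect_pos hw
    rw [hh, ENNReal.ofReal_rpow_of_nonneg (by positivity) he.le, ← Real.rpow_mul hd.le, neg_mul]
  refine ⟨max C₁ C₂, (max_lt hC₁.lt_top hC₂.lt_top).ne, fun F hF => ?_⟩
  refine lintegral_rpow_kernel_le (k := fun z w => ‖bergmanKernel n α z w‖ₑ) hpq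
    (measurable_bergmanKernel.enorm) (h := h) (measurable_defect_rpow (-t)) ?_ ?_ ?_ ?_ hF
  · filter_upwards [ae_norm_lt_one] with w hw
    have hd := defect_pos hw
    exact (ENNReal.ofReal_pos.2 (by positivity)).ne'
  · exact Filter.Eventually.of_forall fun _ => ENNReal.ofReal_ne_top
  · filter_upwards [ae_norm_lt_one] with z hz
    rw [hpow z hz q hq0]
    refine le_trans (le_of_eq (lintegral_congr_ae ?_)) ((h₁ z hz).trans ?_)
    · filter_upwards [ae_norm_lt_one] with w hw
      rw [hpow w hw q hq0]
    · gcongr; exact le_max_left _ _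
  · filter_upwards [ae_norm_lt_one] with w hw
    rw [hpow w hw p hp0]
    refine le_trans (le_of_eq (lintegral_congr_ae ?_)) ((h₂ w hw).trans ?_)
    · filter_upwards [ae_norm_lt_one] with z hz
      rw [hpow z hz p hp0, ← ofReal_norm, norm_bergmanKernel_comm, ofReal_norm]
    · gcongr; exact le_max_right _ _

/-- Pointwise domination by the positive Bergman operator gives a norm bound. -/
theorem exists_eLpNorm_le (hn : 1 ≤ n) (hα : -1 < α) {p : ℝ≥0∞} (hp : 1 < p) (hp' : p < ⊤) :
    ∃ C : ℝ, 0 ≤ C ∧ ∀ (E : Type) [NormedAddCommGroup E] (G F : Cn n → E) (c : ℝ), 0 ≤ c →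
      AEStronglyMeasurable F (vMeasure n α) →
      (∀ᵐ u ∂(vMeasure n α), ‖G u‖ₑ ≤ ENNReal.ofReal c *
        ∫⁻ w, ‖bergmanKernel n α u w‖ₑ * ‖F w‖ₑ ∂(vMeasure n α)) →
      eLpNorm G p (vMeasure n α) ≤ ENNReal.ofReal (c * C) * eLpNorm F p (vMeasure n α) := by
  have hp1 : 1 < p.toReal := by
    rw [← ENNReal.toReal_one]
    exact (ENNReal.toReal_lt_toReal (by simp) hp'.ne).2 hp
  have hp0 : 0 < p.toReal := by linarith
  obtain ⟨C, hC, h⟩ := exists_lintegral_rpow_bergmanKernel_le hn hα hp1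
  refine ⟨C.toReal, ENNReal.toReal_nonneg, fun E _ G F c hc hF hG => ?_⟩
  have hpne : p ≠ 0 := (zero_lt_one.trans hp).ne'
  rw [eLpNorm_eq_lintegral_rpow_enorm_toReal hpne hp'.ne,
    eLpNorm_eq_lintegral_rpow_enorm_toReal hpne hp'.ne]
  have h1 : ∫⁻ u, ‖G u‖ₑ ^ p.toReal ∂(vMeasure n α) ≤
      (ENNReal.ofReal (c * C.toReal)) ^ p.toReal * ∫⁻ w, ‖F w‖ₑ ^ p.toReal ∂(vMeasure n α) := by
    calc _ ≤ ∫⁻ u, ENNReal.ofReal c ^ p.toReal *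
          (∫⁻ w, ‖bergmanKernel n α u w‖ₑ * ‖F w‖ₑ ∂(vMeasure n α)) ^ p.toReal
            ∂(vMeasure n α) := by
          refine lintegral_mono_ae ?_
          filter_upwards [hG] with u hu
          rw [← ENNReal.mul_rpow_of_nonneg _ _ hp0.le]
          exact ENNReal.rpow_le_rpow hu hp0.le
      _ ≤ ENNReal.ofReal c ^ p.toReal *
          (C ^ p.toReal * ∫⁻ w, ‖F w‖ₑ ^ p.toReal ∂(vMeasure n α)) := by
          rw [lintegral_const_mul' _ _ (ENNReal.rpow_ne_top_of_nonneg hp0.le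
            ENNReal.ofReal_ne_top)]
          gcongr
          exact h _ hF.enorm
      _ = _ := by
          rw [ENNReal.ofReal_mul hc, ENNReal.ofReal_toReal hC,
            ENNReal.mul_rpow_of_nonneg _ _ hp0.le, mul_assoc]
  refine (ENNReal.rpow_le_rpow h1 (by positivity)).trans (le_of_eq ?_)
  rw [ENNReal.mul_rpow_of_nonneg _ _ (by positivity), ← ENNReal.rpow_mul,
    mul_one_div_cancel hp0.ne', ENNReal.rpow_one]

/-! ### Holomorphy of Bergman projections -/

lemma hasFDerivAt_bergmanKernel {z w : Cn n} (hz : ‖z‖ < 1) (hw : ‖w‖ < 1) :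
    HasFDerivAt (fun z => bergmanKernel n α z w)
      (((((n : ℝ) + 1 + α : ℝ) : ℂ) *
        (1 - inner ℂ w z) ^ (-(((n : ℝ) + 1 + α : ℝ) : ℂ) - 1)) • innerSL ℂ w) z := by
  set c : ℂ := (((n : ℝ) + 1 + α : ℝ) : ℂ) with hc
  have hf : HasFDerivAt (fun z => 1 - inner ℂ w z) (-innerSL ℂ w) z :=
    ((innerSL ℂ w).hasFDerivAt).const_sub 1
  have hd : HasDerivAt (fun x : ℂ => x ^ (-c)) (-c * (1 - inner ℂ w z) ^ (-c - 1))
      (1 - inner ℂ w z) :=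
    (Complex.hasStrictDerivAt_cpow_const
      (Or.inl (one_sub_re_inner_pos hw hz))).hasDerivAt
  have h := hd.comp_hasFDerivAt z hf
  have he : (fun z => bergmanKernel n α z w) = (fun x : ℂ => x ^ (-c)) ∘ fun z => 1 - inner ℂ w z := by
    funext z
    simp only [Function.comp, bergmanKernel]
    rw [Complex.cpow_neg, one_div]
  have hs : (-c * (1 - inner ℂ w z) ^ (-c - 1)) • -(innerSL ℂ) w =
      (c * (1 - inner ℂ w z) ^ (-c - 1)) • (innerSL ℂ) w := by
    rw [smul_neg, neg_mul, neg_smul, neg_neg]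
  rw [hs] at h
  rw [he]
  exact h

lemma differentiableOn_bergmanProj {d : ℕ} {p : ℝ≥0∞} [Fact (1 ≤ p)] (hα : -1 < α)
    {F : Cn n → Cd d p} (hF : Integrable F (vMeasure n α)) :
    DifferentiableOn ℂ (bergmanProj n d p α F) (Metric.ball 0 1) := by
  intro z₀ hz₀
  rw [mem_ball_zero_iff] at hz₀
  set c : ℂ := (((n : ℝ) + 1 + α : ℝ) : ℂ) with hc
  set δ : ℝ := (1 - ‖z₀‖) / 2 with hδ
  have hδ0 : 0 < δ := by rw [hδ]; linarith
  have hnear : ∀ z ∈ Metric.ball z₀ δ, ‖z‖ < 1 ∧ δ ≤ 1 - ‖z‖ := fun z hz => by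
    have h1 : ‖z - z₀‖ < δ := by simpa [dist_eq_norm] using hz
    have h2 := norm_le_norm_add_norm_sub' z z₀
    constructor <;> linarith
  have hc0 : 0 < (n : ℝ) + 1 + α := by
    have : (0 : ℝ) ≤ n := by positivity
    linarith
  set F' : Cn n → Cn n → (Cn n →L[ℂ] Cd d p) := fun z w =>
    ContinuousLinearMap.smulRightL ℂ (Cn n) (Cd d p)
      ((c * (1 - inner ℂ w z) ^ (-c - 1)) • innerSL ℂ w) (F w) with hF'
  have hmeas : ∀ z, AEStronglyMeasurable (fun w => bergmanKernel n α z w • F w) (vMeasure n α) :=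
    fun z => (measurable_bergmanKernel_right z).aestronglyMeasurable.smul hF.1
  have hF'm : AEStronglyMeasurable (F' z₀) (vMeasure n α) := by
    have h1 : Measurable fun w : Cn n => c * (1 - inner ℂ w z₀) ^ (-c - 1) := by
      have : Measurable fun w : Cn n => 1 - inner ℂ w z₀ :=
        (continuous_const.sub (continuous_id.inner continuous_const)).measurable
      exact measurable_const.mul (this.pow_const _)
    have h2 : AEStronglyMeasurable (fun w : Cn n => innerSL ℂ w) (vMeasure n α) :=
      (innerSL ℂ).continuous.aestronglyMeasurable
    have h3 := (ContinuousLinearMap.smulRightL ℂ (Cn n) (Cd d p)).aestronglyMeasurable_comp₂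
      (h1.aestronglyMeasurable.smul h2) hF.1
    exact h3
  have h := hasFDerivAt_integral_of_dominated_of_fderiv_le (μ := vMeasure n α) (𝕜 := ℂ)
    (F := fun z w => bergmanKernel n α z w • F w) (F' := F') (x₀ := z₀)
    (bound := fun w => ‖c‖ * δ ^ (-((n : ℝ) + 1 + α) - 1) * ‖F w‖)
    (Metric.ball_mem_nhds z₀ hδ0) (Filter.Eventually.of_forall hmeas) ?_ ?_ ?_ ?_ ?_
  · exact h.differentiableAt.differentiableWithinAt
  · exact integrable_bergmanKernel_smul hα hF hz₀
  · exact hF'm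
  · filter_upwards [ae_norm_lt_one] with w hw z hz
    obtain ⟨hz1, hz2⟩ := hnear z hz
    have h2 : F' z w = ((c * (1 - inner ℂ w z) ^ (-c - 1)) • innerSL ℂ w).smulRight (F w) := rfl
    rw [h2, ContinuousLinearMap.norm_smulRight_apply, norm_smul, norm_mul]
    have h3 : ‖(1 - inner ℂ w z) ^ (-c - 1)‖ ≤ δ ^ (-((n : ℝ) + 1 + α) - 1) := by
      have : -c - 1 = ((-((n : ℝ) + 1 + α) - 1 : ℝ) : ℂ) := by rw [hc]; push_cast; ring
      rw [this, Complex.norm_cpow_real]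
      exact Real.rpow_le_rpow_of_nonpos hδ0 (hz2.trans (one_sub_norm_le z hw.le)) (by linarith)
    have h4 : ‖innerSL ℂ w‖ ≤ 1 := by rw [innerSL_apply_norm]; exact hw.le
    calc ‖c‖ * ‖(1 - inner ℂ w z) ^ (-c - 1)‖ * ‖innerSL ℂ w‖ * ‖F w‖
        ≤ ‖c‖ * δ ^ (-((n : ℝ) + 1 + α) - 1) * 1 * ‖F w‖ := by gcongr
      _ = _ := by ring
  · exact hF.norm.const_mul _
  · filter_upwards [ae_norm_lt_one] with w hw z hz
    exact (hasFDerivAt_bergmanKernel (hnear z hz).1 hw).smul_const (F w)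

lemma aestronglyMeasurable_of_differentiableOn {E : Type*} [NormedAddCommGroup E]
    [NormedSpace ℂ E] {f : Cn n → E} (hf : DifferentiableOn ℂ f (Metric.ball 0 1)) :
    AEStronglyMeasurable f (vMeasure n α) :=
  (hf.continuousOn.aestronglyMeasurable Metric.isOpen_ball.measurableSet).mono_ac
    vMeasure_absolutelyContinuous

/-! ### Matrix symbols -/

variable {d : ℕ} {p : ℝ≥0∞}

lemma eq_sum_smul_single (v : Cd d p) : v = ∑ i, v i • PiLp.single p i (1 : ℂ) := by
  ext k
  simp [WithLp.ofLp_sum, Finset.sum_apply, Pi.single_apply]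

lemma matMul_eq_sum (φ : Cn n → Matrix (Fin d) (Fin d) ℂ) (f : Cn n → Cd d p) (w : Cn n) :
    matMul φ f w = ∑ i, ∑ j, (φ w i j * f w j) • PiLp.single p i (1 : ℂ) := by
  rw [eq_sum_smul_single (matMul φ f w)]
  refine Finset.sum_congr rfl fun i _ => ?_
  rw [← Finset.sum_smul]
  rfl

lemma aestronglyMeasurable_apply {f : Cn n → Cd d p} {μ : Measure (Cn n)}
    (hf : AEStronglyMeasurable f μ) (j : Fin d) : AEStronglyMeasurable (fun w => f w j) μ :=
  (PiLp.proj p (fun _ : Fin d => ℂ) j (𝕜 := ℂ)).continuous.comp_aestronglyMeasurable hf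

lemma matMul_congr (φ : Cn n → Matrix (Fin d) (Fin d) ℂ) {f g : Cn n → Cd d p}
    (h : f =ᵐ[vMeasure n α] g) : matMul φ f =ᵐ[vMeasure n α] matMul φ g := by
  filter_upwards [h] with w hw
  simp only [matMul, hw]

variable [Fact (1 ≤ p)]

lemma norm_sum_sum_smul_single_le (c : Fin d → Fin d → ℂ) :
    ‖∑ i, ∑ j, c i j • (PiLp.single p i (1 : ℂ) : Cd d p)‖ ≤ ∑ i, ∑ j, ‖c i j‖ := by
  refine (norm_sum_le _ _).trans (Finset.sum_le_sum fun i _ => ?_)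
  refine (norm_sum_le _ _).trans (Finset.sum_le_sum fun j _ => ?_)
  rw [norm_smul, PiLp.norm_single, norm_one, mul_one]

lemma norm_matMul_le (φ : Cn n → Matrix (Fin d) (Fin d) ℂ) (f : Cn n → Cd d p) (w : Cn n) :
    ‖matMul φ f w‖ ≤ (∑ i, ∑ j, ‖φ w i j‖) * ‖f w‖ := by
  rw [matMul_eq_sum, Finset.sum_mul]
  refine (norm_sum_sum_smul_single_le _).trans (Finset.sum_le_sum fun i _ => ?_)
  rw [Finset.sum_mul]
  refine Finset.sum_le_sum fun j _ => ?_
  rw [norm_mul]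
  gcongr
  exact PiLp.norm_apply_le _ _

lemma integrable_apply {f : Cn n → Cd d p} {μ : Measure (Cn n)}
    (hf : Integrable f μ) (j : Fin d) : Integrable (fun w => f w j) μ :=
  hf.mono (aestronglyMeasurable_apply hf.1 j)
    (Filter.Eventually.of_forall fun w => PiLp.norm_apply_le (f w) j)

lemma IsBoundedSymbol.aestronglyMeasurable_matMul {φ : Cn n → Matrix (Fin d) (Fin d) ℂ}
    (hφ : IsBoundedSymbol n d α φ) {f : Cn n → Cd d p}
    (hf : AEStronglyMeasurable f (vMeasure n α)) :
    AEStronglyMeasurable (matMul φ f) (vMeasure n α) := by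
  have h : matMul φ f = fun w => ∑ i, ∑ j, (φ w i j * f w j) • PiLp.single p i (1 : ℂ) :=
    funext fun w => matMul_eq_sum φ f w
  rw [h]
  refine Finset.aestronglyMeasurable_fun_sum _ fun i _ =>
    Finset.aestronglyMeasurable_fun_sum _ fun j _ => ?_
  exact ((hφ i j).1.mul (aestronglyMeasurable_apply hf j)).smul_const _

lemma IsBoundedSymbol.exists_norm_matMul_le {φ : Cn n → Matrix (Fin d) (Fin d) ℂ}
    (hφ : IsBoundedSymbol n d α φ) :
    ∃ B : ℝ, 0 ≤ B ∧ ∀ᵐ w ∂(vMeasure n α), ∀ f : Cn n → Cd d p,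
      ‖matMul φ f w‖ ≤ B * ‖f w‖ := by
  have hb : ∀ᵐ w ∂(vMeasure n α), ∀ i j,
      ‖φ w i j‖ ≤ (eLpNorm (fun z => φ z i j) ∞ (vMeasure n α)).toReal := by
    rw [ae_all_iff]; intro i
    rw [ae_all_iff]; intro j
    have : ∀ᵐ w ∂(vMeasure n α), ‖φ w i j‖ₑ ≤ eLpNorm (fun z => φ z i j) ∞ (vMeasure n α) := by
      rw [eLpNorm_exponent_top]
      exact ae_le_eLpNormEssSup
    filter_upwards [this] with w hw
    rw [← toReal_enorm]
    exact ENNReal.toReal_mono (hφ i j).2.ne hw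
  refine ⟨∑ i, ∑ j, (eLpNorm (fun z => φ z i j) ∞ (vMeasure n α)).toReal,
    Finset.sum_nonneg fun i _ => Finset.sum_nonneg fun j _ => ENNReal.toReal_nonneg, ?_⟩
  filter_upwards [hb] with w hw f
  refine (norm_matMul_le φ f w).trans ?_
  gcongr with i _ j _
  exact hw i j

lemma IsBoundedSymbol.integrable_matMul {φ : Cn n → Matrix (Fin d) (Fin d) ℂ}
    (hφ : IsBoundedSymbol n d α φ) {f : Cn n → Cd d p} (hf : Integrable f (vMeasure n α)) :
    Integrable (matMul φ f) (vMeasure n α) := by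
  obtain ⟨B, -, hB⟩ := hφ.exists_norm_matMul_le (p := p)
  refine (hf.norm.const_mul B).mono' (hφ.aestronglyMeasurable_matMul hf.1) ?_
  filter_upwards [hB] with w hw using hw f

lemma bergmanProj_congr {F G : Cn n → Cd d p} (h : F =ᵐ[vMeasure n α] G) (u : Cn n) :
    bergmanProj n d p α F u = bergmanProj n d p α G u := by
  refine integral_congr_ae ?_
  filter_upwards [h] with w hw
  rw [hw]

/-- The entries of a matrix Toeplitz operator are scalar Toeplitz operators. -/
lemma bergmanProj_matMul_eq_sum (hα : -1 < α) {φ : Cn n → Matrix (Fin d) (Fin d) ℂ}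
    (hφ : IsBoundedSymbol n d α φ) {f : Cn n → Cd d p} (hf : Integrable f (vMeasure n α))
    {u : Cn n} (hu : ‖u‖ < 1) :
    bergmanProj n d p α (matMul φ f) u =
      ∑ i, ∑ j, (∫ w, φ w i j * (bergmanKernel n α u w * f w j) ∂(vMeasure n α)) •
        PiLp.single p i (1 : ℂ) := by
  have hint : ∀ i j, Integrable (fun w => φ w i j * (bergmanKernel n α u w * f w j))
      (vMeasure n α) := fun i j =>
    (integrable_bergmanKernel_mul hα (integrable_apply hf j) hu).mul_of_top_right (hφ i j)
  have h : ∀ w, bergmanKernel n α u w • matMul φ f w =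
      ∑ i, ∑ j, (φ w i j * (bergmanKernel n α u w * f w j)) • PiLp.single p i (1 : ℂ) := by
    intro w
    rw [matMul_eq_sum, Finset.smul_sum]
    refine Finset.sum_congr rfl fun i _ => ?_
    rw [Finset.smul_sum]
    refine Finset.sum_congr rfl fun j _ => ?_
    rw [smul_smul]; congr 1; ring
  rw [bergmanProj, integral_congr_ae (Filter.Eventually.of_forall h), integral_finsetSum _
    fun i _ => integrable_finsetSum _ fun j _ => (hint i j).smul_const _]
  refine Finset.sum_congr rfl fun i _ => ?_
  rw [integral_finsetSum _ fun j _ => (hint i j).smul_const _]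
  refine Finset.sum_congr rfl fun j _ => ?_
  rw [integral_smul_const]

lemma enorm_bergmanProj_le {F f : Cn n → Cd d p} {B : ℝ} (hB : 0 ≤ B)
    (h : ∀ᵐ w ∂(vMeasure n α), ‖F w‖ ≤ B * ‖f w‖) (u : Cn n) :
    ‖bergmanProj n d p α F u‖ₑ ≤
      ENNReal.ofReal B * ∫⁻ w, ‖bergmanKernel n α u w‖ₑ * ‖f w‖ₑ ∂(vMeasure n α) := by
  refine (enorm_integral_le_lintegral_enorm _).trans ?_
  rw [← lintegral_const_mul' _ _ ENNReal.ofReal_ne_top]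
  refine lintegral_mono_ae ?_
  filter_upwards [h] with w hw
  rw [enorm_smul, mul_left_comm, ← ofReal_norm (F w), ← ofReal_norm (f w),
    ← ENNReal.ofReal_mul hB]
  gcongr

/-! ### Toeplitz operators -/

lemma integrable_bergmanSpace (hα : -1 < α) (f : bergmanSpace n d p α) :
    Integrable ((f : LpAlpha n d p α) : Cn n → Cd d p) (vMeasure n α) := by
  have := isProbabilityMeasure_vMeasure (n := n) hα
  exact (Lp.memLp (f : LpAlpha n d p α)).integrable Fact.out

/-- Operators whose difference is dominated by the positive Bergman operator are close in norm. -/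
lemma exists_opNorm_sub_le (hn : 1 ≤ n) (hα : -1 < α) (hp : 1 < p) (hp' : p < ⊤) :
    ∃ C : ℝ, 0 ≤ C ∧ ∀ (φ ψ : Cn n → Matrix (Fin d) (Fin d) ℂ) (T S : BergmanOp n d p α)
      (c : ℝ), 0 ≤ c → IsToeplitz φ T → IsToeplitz ψ S →
      (∀ (f : bergmanSpace n d p α) (u : Cn n), ‖u‖ < 1 →
        ‖bergmanProj n d p α (matMul φ ((f : LpAlpha n d p α) : Cn n → Cd d p)) u -
          bergmanProj n d p α (matMul ψ ((f : LpAlpha n d p α) : Cn n → Cd d p)) u‖ₑ ≤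
        ENNReal.ofReal c * ∫⁻ w, ‖bergmanKernel n α u w‖ₑ *
          ‖((f : LpAlpha n d p α) : Cn n → Cd d p) w‖ₑ ∂(vMeasure n α)) →
      ‖T - S‖ ≤ c * C := by
  obtain ⟨C, hC, h⟩ := exists_eLpNorm_le hn hα hp hp'
  refine ⟨C, hC, fun φ ψ T S c hc hT hS hTS => ?_⟩
  refine ContinuousLinearMap.opNorm_le_bound _ (by positivity) fun f => ?_
  have h1 : eLpNorm (((T - S) f : LpAlpha n d p α) : Cn n → Cd d p) p (vMeasure n α) ≤
      ENNReal.ofReal (c * C) *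
        eLpNorm ((f : LpAlpha n d p α) : Cn n → Cd d p) p (vMeasure n α) := by
    refine h _ _ _ c hc (Lp.aestronglyMeasurable _) ?_
    have hsub : (((T - S) f : LpAlpha n d p α) : Cn n → Cd d p) =ᵐ[vMeasure n α]
        ((T f : LpAlpha n d p α) : Cn n → Cd d p) - ((S f : LpAlpha n d p α) : Cn n → Cd d p) :=
      Lp.coeFn_sub (T f : LpAlpha n d p α) (S f : LpAlpha n d p α)
    filter_upwards [hsub, hT f, hS f, ae_norm_lt_one] with u h1 h2 h3 hu
    rw [h1, Pi.sub_apply, h2, h3]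
    exact hTS f u hu
  have h2 : ‖(T - S) f‖ = (eLpNorm (((T - S) f : LpAlpha n d p α) : Cn n → Cd d p) p
      (vMeasure n α)).toReal := Lp.norm_def _
  have h3 : ‖f‖ = (eLpNorm ((f : LpAlpha n d p α) : Cn n → Cd d p) p (vMeasure n α)).toReal :=
    Lp.norm_def _
  rw [h2, h3, ← ENNReal.toReal_ofReal (by positivity : 0 ≤ c * C), ← ENNReal.toReal_mul]
  exact ENNReal.toReal_mono (ENNReal.mul_ne_top ENNReal.ofReal_ne_top (Lp.eLpNorm_ne_top _)) h1

/-- The integral formula defines an operator on `A^p_α`: its values are holomorphic by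
differentiation under the integral sign, and it is dominated by the positive Bergman operator. -/
theorem exists_isToeplitz (hn : 1 ≤ n) (hα : -1 < α) (hp : 1 < p) (hp' : p < ⊤)
    {φ : Cn n → Matrix (Fin d) (Fin d) ℂ} (hφ : IsBoundedSymbol n d α φ) :
    ∃ T : BergmanOp n d p α, IsToeplitz φ T := by
  obtain ⟨C, hC, hbound⟩ := exists_eLpNorm_le hn hα hp hp'
  obtain ⟨B, hB, hφB⟩ := hφ.exists_norm_matMul_le (p := p)
  set A : bergmanSpace n d p α → Cn n → Cd d p := fun f =>
    bergmanProj n d p α (matMul φ ((f : LpAlpha n d p α) : Cn n → Cd d p)) with hA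
  have hint : ∀ f : bergmanSpace n d p α,
      Integrable (matMul φ ((f : LpAlpha n d p α) : Cn n → Cd d p)) (vMeasure n α) := fun f =>
    hφ.integrable_matMul (integrable_bergmanSpace hα f)
  have hdiff : ∀ f, DifferentiableOn ℂ (A f) (Metric.ball 0 1) := fun f =>
    differentiableOn_bergmanProj hα (hint f)
  have hle : ∀ f, eLpNorm (A f) p (vMeasure n α) ≤ ENNReal.ofReal (B * C) *
      eLpNorm ((f : LpAlpha n d p α) : Cn n → Cd d p) p (vMeasure n α) := fun f => by
    refine hbound _ _ _ B hB (Lp.aestronglyMeasurable _) (Filter.Eventually.of_forall fun u => ?_)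
    refine enorm_bergmanProj_le hB ?_ u
    filter_upwards [hφB] with w hw using hw _
  have hmem : ∀ f, MemLp (A f) p (vMeasure n α) := fun f =>
    ⟨aestronglyMeasurable_of_differentiableOn (hdiff f), (hle f).trans_lt
      (ENNReal.mul_lt_top ENNReal.ofReal_lt_top (Lp.eLpNorm_lt_top _))⟩
  have hadd : ∀ f g, A (f + g) =ᵐ[vMeasure n α] A f + A g := fun f g => by
    filter_upwards [ae_norm_lt_one] with u hu
    have h1 : matMul φ (((f + g : bergmanSpace n d p α) : LpAlpha n d p α) : Cn n → Cd d p)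
        =ᵐ[vMeasure n α] fun w => matMul φ ((f : LpAlpha n d p α) : Cn n → Cd d p) w +
          matMul φ ((g : LpAlpha n d p α) : Cn n → Cd d p) w := by
      filter_upwards [Lp.coeFn_add (f : LpAlpha n d p α) (g : LpAlpha n d p α)] with w hw
      rw [Submodule.coe_add, matMul, hw]
      simp only [matMul, Pi.add_apply, WithLp.ofLp_add, Matrix.mulVec_add, WithLp.toLp_add]
    rw [Pi.add_apply]
    simp only [hA]
    rw [bergmanProj_congr h1, bergmanProj, bergmanProj, bergmanProj,
      ← integral_add (integrable_bergmanKernel_smul hα (hint f) hu)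
        (integrable_bergmanKernel_smul hα (hint g) hu)]
    simp only [smul_add]
  have hsmul : ∀ (c : ℂ) f, A (c • f) =ᵐ[vMeasure n α] c • A f := fun c f => by
    refine Filter.Eventually.of_forall fun u => ?_
    have h1 : matMul φ (((c • f : bergmanSpace n d p α) : LpAlpha n d p α) : Cn n → Cd d p)
        =ᵐ[vMeasure n α] fun w => c • matMul φ ((f : LpAlpha n d p α) : Cn n → Cd d p) w := by
      filter_upwards [Lp.coeFn_smul c (f : LpAlpha n d p α)] with w hw
      rw [Submodule.coe_smul, matMul, hw]
      simp only [matMul, Pi.smul_apply, WithLp.ofLp_smul, Matrix.mulVec_smul, WithLp.toLp_smul]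
    rw [Pi.smul_apply]
    simp only [hA]
    rw [bergmanProj_congr h1, bergmanProj, bergmanProj, ← integral_smul]
    simp only [smul_comm c]
  let L : bergmanSpace n d p α →ₗ[ℂ] bergmanSpace n d p α :=
    { toFun := fun f => ⟨(hmem f).toLp (A f), A f, hdiff f, (hmem f).coeFn_toLp⟩
      map_add' := fun f g => Subtype.ext (by
        change (hmem (f + g)).toLp (A (f + g)) = (hmem f).toLp (A f) + (hmem g).toLp (A g)
        rw [← MemLp.toLp_add]
        exact MemLp.toLp_congr _ _ (hadd f g))
      map_smul' := fun c f => Subtype.ext (by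
        change (hmem (c • f)).toLp (A (c • f)) = c • (hmem f).toLp (A f)
        rw [← MemLp.toLp_const_smul]
        exact MemLp.toLp_congr _ _ (hsmul c f)) }
  refine ⟨L.mkContinuous (B * C) fun f => ?_, fun f => (hmem f).coeFn_toLp⟩
  change ‖(hmem f).toLp (A f)‖ ≤ B * C * ‖(f : LpAlpha n d p α)‖
  rw [Lp.norm_toLp, Lp.norm_def, ← ENNReal.toReal_ofReal (by positivity : 0 ≤ B * C),
    ← ENNReal.toReal_mul]
  exact ENNReal.toReal_mono (ENNReal.mul_ne_top ENNReal.ofReal_ne_top (Lp.eLpNorm_ne_top _))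
    (hle f)

lemma IsToeplitz.eq {φ : Cn n → Matrix (Fin d) (Fin d) ℂ} {T S : BergmanOp n d p α}
    (hT : IsToeplitz φ T) (hS : IsToeplitz φ S) : T = S :=
  ContinuousLinearMap.ext fun f => Subtype.ext (Lp.ext ((hT f).trans (hS f).symm))

theorem existsUnique_isToeplitz (hn : 1 ≤ n) (hα : -1 < α) (hp : 1 < p) (hp' : p < ⊤)
    {φ : Cn n → Matrix (Fin d) (Fin d) ℂ} (hφ : IsBoundedSymbol n d α φ) :
    ∃! T : BergmanOp n d p α, IsToeplitz φ T := by
  obtain ⟨T, hT⟩ := exists_isToeplitz hn hα hp hp' hφ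
  exact ⟨T, hT, fun S hS => hS.eq hT⟩

/-! ### Symbols in `𝒜` -/

lemma IsBUC.continuousOn {a : Cn n → ℂ} (ha : IsBUC a) :
    ContinuousOn a (Metric.ball 0 1) := by
  intro z hz
  have hz' := mem_ball_zero_iff.1 hz
  have h0 : 0 < 1 - ‖z‖ := by linarith
  rw [Metric.continuousWithinAt_iff]
  intro ε hε
  obtain ⟨δ, hδ, h⟩ := ha.2 ε hε
  refine ⟨δ * (1 - ‖z‖) / 2, by positivity, fun w hw hwz => ?_⟩
  rw [dist_comm, dist_eq_norm]
  refine h z hz w hw ((pseudoHyp_le hz' (mem_ball_zero_iff.1 hw)).trans_lt ?_)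
  rw [dist_comm, dist_eq_norm] at hwz
  rw [div_lt_iff₀ h0]; linarith

lemma IsBUC.memLp_top {a : Cn n → ℂ} (ha : IsBUC a) : MemLp a ∞ (vMeasure n α) := by
  obtain ⟨C, hC⟩ := ha.1
  refine memLp_top_of_bound ((ha.continuousOn.aestronglyMeasurable
    Metric.isOpen_ball.measurableSet).mono_ac vMeasure_absolutelyContinuous) C ?_
  filter_upwards [ae_norm_lt_one] with z hz
  exact hC z (mem_ball_zero_iff.2 hz)

lemma IsBUCSymbol.isBoundedSymbol {a : Cn n → Matrix (Fin d) (Fin d) ℂ} (ha : IsBUCSymbol a) :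
    IsBoundedSymbol n d α a := fun i j => (ha i j).memLp_top

/-- Toeplitz operators with bounded symbols are norm limits of Toeplitz operators with symbols in
`𝒜`. -/
theorem mem_closure_isBUCSymbol (hn : 1 ≤ n) (hα : -1 < α) (hp : 1 < p) (hp' : p < ⊤)
    {φ : Cn n → Matrix (Fin d) (Fin d) ℂ} (hφ : IsBoundedSymbol n d α φ)
    {T : BergmanOp n d p α} (hT : IsToeplitz φ T) :
    T ∈ closure {S : BergmanOp n d p α | ∃ a, IsBUCSymbol a ∧ IsToeplitz a S} := by
  obtain ⟨C, hC, hop⟩ := exists_opNorm_sub_le (d := d) hn hα hp hp'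
  rw [Metric.mem_closure_iff]
  intro ε hε
  set ε' : ℝ := ε / ((d * d + 1) * (C + 1)) with hε'
  have hε'pos : 0 < ε' := by positivity
  choose a ha happrox using fun i j => exists_isBUC_enorm_sub_le hα (hφ i j) hε'pos
  set ψ : Cn n → Matrix (Fin d) (Fin d) ℂ := fun z => Matrix.of fun i j => a i j z with hψ
  have hψB : IsBUCSymbol ψ := fun i j => ha i j
  have hψb : IsBoundedSymbol n d α ψ := hψB.isBoundedSymbol
  obtain ⟨S, hS⟩ := exists_isToeplitz hn hα hp hp' hψb
  refine ⟨S, ⟨ψ, hψB, hS⟩, ?_⟩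
  have hTS := hop φ ψ T S (d * d * ε') (by positivity) hT hS fun f u hu => ?_
  · rw [dist_eq_norm]
    refine hTS.trans_lt ?_
    have h1 : d * d * ε' * C = ε * ((d * d * C) / ((d * d + 1) * (C + 1))) := by
      rw [hε']; field_simp
    rw [h1]
    refine mul_lt_of_lt_one_right hε ?_
    rw [div_lt_one (by positivity)]
    have : (0 : ℝ) ≤ d * d := by positivity
    nlinarith
  -- Each of the `d * d` entries contributes `ε'`; pass to the holomorphic representative of `f`.
  · obtain ⟨g, hg, hfg⟩ := f.2
    have hfi := integrable_bergmanSpace hα f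
    have hgi : Integrable g (vMeasure n α) := hfi.congr hfg
    have hlint : ∫⁻ w, ‖bergmanKernel n α u w‖ₑ *
          ‖((f : LpAlpha n d p α) : Cn n → Cd d p) w‖ₑ ∂(vMeasure n α) =
        ∫⁻ w, ‖bergmanKernel n α u w‖ₑ * ‖g w‖ₑ ∂(vMeasure n α) := by
      refine lintegral_congr_ae ?_
      filter_upwards [hfg] with w hw
      rw [hw]
    rw [hlint, bergmanProj_congr (matMul_congr φ hfg), bergmanProj_congr (matMul_congr ψ hfg),
      bergmanProj_matMul_eq_sum hα hφ hgi hu, bergmanProj_matMul_eq_sum hα hψb hgi hu,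
      ← Finset.sum_sub_distrib]
    simp only [← Finset.sum_sub_distrib, ← sub_smul]
    set I := ∫⁻ w, ‖bergmanKernel n α u w‖ₑ * ‖g w‖ₑ ∂(vMeasure n α) with hI
    have hij : ∀ i j, ‖(∫ w, φ w i j * (bergmanKernel n α u w * g w j) ∂(vMeasure n α) -
        ∫ w, ψ w i j * (bergmanKernel n α u w * g w j) ∂(vMeasure n α)) •
          (PiLp.single p i (1 : ℂ) : Cd d p)‖ₑ ≤ ENNReal.ofReal ε' * I := by
      intro i j
      have hone : ‖(PiLp.single p i (1 : ℂ) : Cd d p)‖ₑ = 1 := by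
        rw [← ofReal_norm, PiLp.norm_single, norm_one, ENNReal.ofReal_one]
      rw [enorm_smul, hone, mul_one]
      refine (happrox i j (fun w => g w j) ?_ (integrable_apply hgi j) u hu).trans ?_
      · exact (PiLp.proj p (fun _ : Fin d => ℂ) j (𝕜 := ℂ)).differentiable.comp_differentiableOn hg
      · gcongr ENNReal.ofReal ε' * ?_
        refine lintegral_mono fun w => ?_
        gcongr
        rw [← ofReal_norm, ← ofReal_norm]
        exact ENNReal.ofReal_le_ofReal (PiLp.norm_apply_le _ _)
    refine (enorm_sum_le _ _).trans ((Finset.sum_le_sum fun i _ => (enorm_sum_le _ _).trans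
      (Finset.sum_le_sum fun j _ => hij i j)).trans (le_of_eq ?_))
    simp only [Finset.sum_const, Finset.card_univ, Fintype.card_fin, nsmul_eq_mul]
    rw [ENNReal.ofReal_mul (by positivity), ENNReal.ofReal_mul (by positivity),
      ENNReal.ofReal_natCast]
    ring

/-! ### The Toeplitz algebra -/

lemma IsToeplitz.smul {φ : Cn n → Matrix (Fin d) (Fin d) ℂ} {T : BergmanOp n d p α}
    (hT : IsToeplitz φ T) (c : ℂ) : IsToeplitz (fun z => c • φ z) (c • T) := by
  intro f
  have h1 : (((c • T) f : LpAlpha n d p α) : Cn n → Cd d p) =ᵐ[vMeasure n α]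
      c • ((T f : LpAlpha n d p α) : Cn n → Cd d p) := Lp.coeFn_smul c (T f : LpAlpha n d p α)
  filter_upwards [h1, hT f] with u h1 h2
  rw [h1, Pi.smul_apply, h2, bergmanProj, bergmanProj, ← integral_smul]
  refine integral_congr_ae (Filter.Eventually.of_forall fun w => ?_)
  simp only [matMul, Matrix.smul_mulVec, WithLp.toLp_smul]
  rw [smul_comm]

lemma IsBoundedSymbol.smul {φ : Cn n → Matrix (Fin d) (Fin d) ℂ} (hφ : IsBoundedSymbol n d α φ)
    (c : ℂ) : IsBoundedSymbol n d α fun z => c • φ z :=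
  fun i j => (hφ i j).const_mul c

/-- If `s` is stable under scalars, sums of products of elements of `s` form a complex algebra. -/
lemma adjoin_subset_sumsOfProducts {R : Type*} [NormedRing R] [NormedAlgebra ℂ R] {s t : Set R}
    (hts : t ⊆ s) (hs : ∀ x ∈ s, ∀ c : ℂ, c • x ∈ s) :
    (NonUnitalAlgebra.adjoin ℂ t : Set R) ⊆
      (AddSubmonoid.closure (Subsemigroup.closure s : Set R) : Set R) := by
  rw [← NonUnitalSubsemiring.coe_closure_eq]
  intro x hx
  induction hx using NonUnitalAlgebra.adjoin_induction with
  | mem x hx => exact NonUnitalSubsemiring.subset_closure (hts hx)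
  | add x y _ _ hx hy => exact add_mem hx hy
  | zero => exact zero_mem _
  | mul x y _ _ hx hy => exact mul_mem hx hy
  | smul c x hx' hx =>
    clear hx'
    change x ∈ NonUnitalSubsemiring.closure s at hx
    induction hx using NonUnitalSubsemiring.closure_induction with
    | mem x hx => exact NonUnitalSubsemiring.subset_closure (hs x hx c)
    | zero => rw [smul_zero]; exact zero_mem _
    | add x y _ _ hx hy => rw [smul_add]; exact add_mem hx hy
    | mul x y _ hy hx _ => rw [← smul_mul_assoc]; exact mul_mem hx hy

/-- Sums of products of limits of elements of `t` lie in the closed algebra generated by `t`. -/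
lemma sumsOfProducts_subset_of_subset {R : Type*} [NormedRing R] [NormedAlgebra ℂ R] {s t : Set R}
    (hst : s ⊆ closure t) :
    closureSumsOfProducts s ⊆ (closedAlgebraGenerated t : Set R) := by
  have hclosed : IsClosed (closedAlgebraGenerated t : Set R) :=
    NonUnitalSubalgebra.isClosed_topologicalClosure _
  refine closure_minimal ?_ hclosed
  rw [← NonUnitalSubsemiring.coe_closure_eq]
  have ht : t ⊆ (closedAlgebraGenerated t : Set R) :=
    (NonUnitalAlgebra.subset_adjoin ℂ).trans (NonUnitalSubalgebra.le_topologicalClosure _)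
  exact NonUnitalSubsemiring.closure_le
    (t := (closedAlgebraGenerated t).toNonUnitalSubsemiring).2
    (hst.trans (closure_minimal ht hclosed))

end BergmanToeplitz

end

/-- Every bounded symbol, and every symbol with entries in `𝒜`, defines a unique bounded Toeplitz
operator on `A^p_α(𝔹ₙ; ℂᵈ)`, and the Toeplitz algebra equals the closed algebra generated by the
Toeplitz operators of the second kind. -/
theorem theorem4p3 (n d : ℕ) (hn : 1 ≤ n) (hd : 1 ≤ d) (p : ENNReal) [Fact (1 ≤ p)]
    (hp : 1 < p) (hp' : p < ⊤) (α : ℝ) (hα : -1 < α) :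
    (∀ φ : BergmanToeplitz.Cn n → Matrix (Fin d) (Fin d) ℂ,
      BergmanToeplitz.IsBoundedSymbol n d α φ →
        ∃! T : BergmanToeplitz.BergmanOp n d p α, BergmanToeplitz.IsToeplitz φ T) ∧
    (∀ a : BergmanToeplitz.Cn n → Matrix (Fin d) (Fin d) ℂ,
      BergmanToeplitz.IsBUCSymbol a →
        ∃! T : BergmanToeplitz.BergmanOp n d p α, BergmanToeplitz.IsToeplitz a T) ∧
    BergmanToeplitz.toeplitzAlgebra n d p α =
      (BergmanToeplitz.bucToeplitzAlgebra n d p α : Set (BergmanToeplitz.BergmanOp n d p α)) := by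
  refine ⟨fun φ hφ => BergmanToeplitz.existsUnique_isToeplitz hn hα hp hp' hφ,
    fun a ha => BergmanToeplitz.existsUnique_isToeplitz hn hα hp hp' ha.isBoundedSymbol,
    Set.Subset.antisymm ?_ ?_⟩
  · refine BergmanToeplitz.sumsOfProducts_subset_of_subset ?_
    rintro T ⟨φ, hφ, hT⟩
    exact BergmanToeplitz.mem_closure_isBUCSymbol hn hα hp hp' hφ hT
  · refine closure_mono (BergmanToeplitz.adjoin_subset_sumsOfProducts ?_ ?_)
    · rintro T ⟨a, ha, hT⟩
      exact ⟨a, ha.isBoundedSymbol, hT⟩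
    · rintro T ⟨φ, hφ, hT⟩ c
      exact ⟨_, hφ.smul c, hT.smul c⟩
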